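/- **Setting.** A hierarchically well-separated tree (HST) is a finite edge-weighted rooted tree in which all root-to-leaf paths have the same number of edges and in which the edge between a non-root vertex $v$ and its parent has weight $2^{\mathrm{level}(v)}$, where $\mathrm{level}(v)$ is the number of edges on a path from $v$ to any leaf below it. Let $F$ be the set of leaves of an HST $T$, let $d_T$ be the shortest path metric of $T$ on $F$, and let $D$ be the largest distance between two points of $F$. The points of $F$ are the facility locations; opening $i\in F$ costs a real number $f_i\ge 0$. The tree and the costs are given at the beginning, the tree in a form that takes $O(|F|)$ words (its leaves and its vertices with at least two children, in any order, each with its level and its lowest listed strict ancestor). Then requests are made one after the other: in each of them either a new client arrives or a client that is present departs. A client $j$ may be any point, with distances $d(j,i)$, $i\in F$, that extend $d_T$ to a (pseudo-)metric on $F\cup\{j\}$; on its arrival the algorithm is told only a facility nearest to $j$. When $C$ is the set of clients that are present, a solution consists of a set $S\subseteq F$ of open facilities and an assignment $\sigma:C\to S$, and its cost is $\sum_{i\in S}f_i+\sum_{j\in C}d(j,\sigma_j)$. At any time let $n$ be $|F|$ plus the number of clients that have arrived so far. **Theorem 3.** There is a deterministic algorithm, running on a random access machine with words of $O(\log n+\log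 (D+2))$ bits that copies and compares costs in unit time, such that for all HSTs $T$, all facility costs $f$ and all adaptive adversaries (which choose each request knowing everything that the algorithm has done so far) the following holds, with absolute constants hidden in the $O$-notation. 1. The preprocessing time, before the first request, is $O(|F|)$. 2. After each request the memory contains explicitly a set $S$ of open facilities and an assignment $\sigma$ of all clients that are present to facilities of $S$, of cost at most $O(1)$ times the minimum cost of a solution for the clients that are present. 3. After any number $N$ of requests, the total update time spent on them is $O(n\log^3 (D+2))$. 4. After any number $N$ of requests, the total client recourse (the sum over the requests of the number of clients that are present before and after the request and whose facility has changed) and the total facility recourse (the sum over the requests of the number of facilities opened or closed) are $O(N\log^2 (D+2))$; that is, the amortized client and facility recourse is $O(\log^2 (D+2))$. -/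

import Mathlib

/-! ### Hierarchically well-separated trees -/

/-- A hierarchically well-separated tree with (finite) vertex set `V`, given by its parent map.
Levels go up by exactly one along every edge towards the root and every vertex of positive level
has a child, so the childless vertices are those of level `0`, all root-to-leaf paths have
`level root` edges, and `level v` is the number of edges from `v` to any leaf below it. -/
structure HST (V : Type) where
  root : V
  parent : V → Option V
  level : V → ℕ
  parent_eq_none : ∀ v, parent v = none ↔ v = root
  level_parent : ∀ v u, parent v = some u → level u = level v + 1
  exists_child : ∀ v, level v ≠ 0 → ∃ u, parent u = some v

namespace HST

variable {V : Type}

/-- The leaves of the tree; they are the facility locations. -/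
abbrev Leaf (T : HST V) : Type := {v : V // T.level v = 0}

/-- The underlying undirected graph: every non-root vertex is joined to its parent. -/
def graph (T : HST V) : SimpleGraph V :=
  SimpleGraph.fromRel fun v u => T.parent v = some u

/-- The total weight of a walk; the edge between a vertex `v` and its parent has weight
`2 ^ level v`, and `v` is the endpoint of smaller level. -/
def walkWeight (T : HST V) : {u v : V} → T.graph.Walk u v → ℕ
  | _, _, .nil => 0
  | _, _, .cons (u := u) (v := v) _ p => 2 ^ min (T.level u) (T.level v) + walkWeight T p

/-- The shortest path metric of the weighted tree. -/
noncomputable def dist (T : HST V) (u v : V) : ℕ :=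
  sInf {x | ∃ p : T.graph.Walk u v, T.walkWeight p = x}

/-- The diameter `D`: the largest distance between two leaves. -/
noncomputable def diam [Fintype V] (T : HST V) : ℕ :=
  Finset.univ.sup fun p : T.Leaf × T.Leaf => T.dist p.1 p.2

/-- `u` is a strict ancestor of `v`. -/
def Above (T : HST V) (v u : V) : Prop :=
  Relation.TransGen (fun a b => T.parent a = some b) v u

/-- The vertices that are listed when the tree is written down with `O(|F|)` words: the leaves and
the vertices with at least two children. The vertices with exactly one child are left out; the
recorded levels determine them. -/
abbrev Essential (T : HST V) : Type :=
  {v : V // T.level v = 0 ∨ ∃ a b, a ≠ b ∧ T.parent a = some v ∧ T.parent b = some v}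

/-- A leaf as a listed vertex. -/
def Leaf.toEssential {T : HST V} (x : T.Leaf) : T.Essential := ⟨x.1, Or.inl x.2⟩

/-- `u` is the lowest listed strict ancestor of `v`. -/
def IsNext (T : HST V) (v u : T.Essential) : Prop :=
  T.Above v.1 u.1 ∧ ∀ w : T.Essential, T.Above v.1 w.1 → T.level u.1 ≤ T.level w.1

/-- For a numbering `e` of the listed vertices by `0, …, k - 1`: the number of the lowest listed
strict ancestor of the `i`-th listed vertex, and `k` if there is none. -/
noncomputable def nextIdx (T : HST V) {k : ℕ} (e : Fin k ≃ T.Essential) (i : Fin k) : ℕ :=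
  open Classical in
  if h : ∃ j : Fin k, T.IsNext (e i) (e j) then (h.choose : ℕ) else k

/-- The number of a facility. -/
def idx (T : HST V) {k : ℕ} (e : Fin k ≃ T.Essential) (x : T.Leaf) : ℕ :=
  (e.symm x.toEssential : ℕ)

end HST

/-! ### The machine

A random access machine with finitely many registers and arrays (those which its program mentions),
running a structured program. Words are natural numbers that may not exceed a bound `W`: a program
that computes a larger word has no execution. Facility costs are real numbers; they can only be
copied and compared, with each other and with words. Every operation takes one unit of time. -/

/-- Memory contents: registers, arrays of words, arrays of costs. -/
structure Mem where
  reg : ℕ → ℕ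
  arr : ℕ → ℕ → ℕ
  cost : ℕ → ℕ → ℝ

/-- Word expressions. -/
inductive WExp : Type
  | const (n : ℕ)
  | reg (x : ℕ)
  | read (a : ℕ) (i : WExp)
  | add (e₁ e₂ : WExp)
  | sub (e₁ e₂ : WExp)
  | mul (e₁ e₂ : WExp)

namespace WExp

/-- The value (subtraction is truncated). -/
def eval (m : Mem) : WExp → ℕ
  | const n => n
  | reg x => m.reg x
  | read a i => m.arr a (i.eval m)
  | add e₁ e₂ => e₁.eval m + e₂.eval m
  | sub e₁ e₂ => e₁.eval m - e₂.eval m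
  | mul e₁ e₂ => e₁.eval m * e₂.eval m

/-- The number of operations. -/
def time : WExp → ℕ
  | const _ => 1
  | reg _ => 1
  | read _ i => i.time + 1
  | add e₁ e₂ => e₁.time + e₂.time + 1
  | sub e₁ e₂ => e₁.time + e₂.time + 1
  | mul e₁ e₂ => e₁.time + e₂.time + 1

/-- No intermediate result exceeds the word bound. -/
def Fits (W : ℕ) (m : Mem) : WExp → Prop
  | const n => n ≤ W
  | reg x => m.reg x ≤ W
  | read a i => i.Fits W m ∧ m.arr a (i.eval m) ≤ W
  | add e₁ e₂ => e₁.Fits W m ∧ e₂.Fits W m ∧ e₁.eval m + e₂.eval m ≤ W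
  | sub e₁ e₂ => e₁.Fits W m ∧ e₂.Fits W m
  | mul e₁ e₂ => e₁.Fits W m ∧ e₂.Fits W m ∧ e₁.eval m * e₂.eval m ≤ W

end WExp

/-- Cost expressions: an entry of a cost array, or a word. -/
inductive CExp : Type
  | read (a : ℕ) (i : WExp)
  | word (e : WExp)

namespace CExp

noncomputable def eval (m : Mem) : CExp → ℝ
  | read a i => m.cost a (i.eval m)
  | word e => (e.eval m : ℝ)

def time : CExp → ℕ
  | read _ i => i.time + 1
  | word e => e.time + 1

def Fits (W : ℕ) (m : Mem) : CExp → Prop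
  | read _ i => i.Fits W m
  | word e => e.Fits W m

end CExp

/-- Tests. -/
inductive Test : Type
  | eq (e₁ e₂ : WExp)
  | lt (e₁ e₂ : WExp)
  | costLt (c₁ c₂ : CExp)
  | not (b : Test)
  | and (b₁ b₂ : Test)

namespace Test

def Holds (m : Mem) : Test → Prop
  | eq e₁ e₂ => e₁.eval m = e₂.eval m
  | lt e₁ e₂ => e₁.eval m < e₂.eval m
  | costLt c₁ c₂ => c₁.eval m < c₂.eval m
  | not b => ¬ b.Holds m
  | and b₁ b₂ => b₁.Holds m ∧ b₂.Holds m

def time : Test → ℕ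
  | eq e₁ e₂ => e₁.time + e₂.time + 1
  | lt e₁ e₂ => e₁.time + e₂.time + 1
  | costLt c₁ c₂ => c₁.time + c₂.time + 1
  | not b => b.time + 1
  | and b₁ b₂ => b₁.time + b₂.time + 1

def Fits (W : ℕ) (m : Mem) : Test → Prop
  | eq e₁ e₂ => e₁.Fits W m ∧ e₂.Fits W m
  | lt e₁ e₂ => e₁.Fits W m ∧ e₂.Fits W m
  | costLt c₁ c₂ => c₁.Fits W m ∧ c₂.Fits W m
  | not b => b.Fits W m
  | and b₁ b₂ => b₁.Fits W m ∧ b₂.Fits W m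

end Test

/-- Programs. -/
inductive Prog : Type
  | skip
  | setReg (x : ℕ) (e : WExp)
  | setArr (a : ℕ) (i e : WExp)
  | setCost (a : ℕ) (i : WExp) (c : CExp)
  | seq (p q : Prog)
  | ite (b : Test) (p q : Prog)
  | loop (b : Test) (p : Prog)

namespace Mem

def setReg (m : Mem) (x v : ℕ) : Mem :=
  { m with reg := Function.update m.reg x v }

def setArr (m : Mem) (a i v : ℕ) : Mem :=
  { m with arr := Function.update m.arr a (Function.update (m.arr a) i v) }

noncomputable def setCost (m : Mem) (a i : ℕ) (v : ℝ) : Mem :=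
  { m with cost := Function.update m.cost a (Function.update (m.cost a) i v) }

end Mem

/-- `Exec W p m t m'`: with word bound `W`, the program `p` started on memory `m` halts after `t`
units of time, without overflow, with memory `m'`. -/
inductive Exec (W : ℕ) : Prog → Mem → ℕ → Mem → Prop
  | skip (m : Mem) : Exec W .skip m 1 m
  | setReg (m : Mem) (x : ℕ) (e : WExp) : e.Fits W m →
      Exec W (.setReg x e) m (e.time + 1) (m.setReg x (e.eval m))
  | setArr (m : Mem) (a : ℕ) (i e : WExp) : i.Fits W m → e.Fits W m →
      Exec W (.setArr a i e) m (i.time + e.time + 1) (m.setArr a (i.eval m) (e.eval m))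
  | setCost (m : Mem) (a : ℕ) (i : WExp) (c : CExp) : i.Fits W m → c.Fits W m →
      Exec W (.setCost a i c) m (i.time + c.time + 1) (m.setCost a (i.eval m) (c.eval m))
  | seq {p q : Prog} {m m' m'' : Mem} {t t' : ℕ} : Exec W p m t m' → Exec W q m' t' m'' →
      Exec W (.seq p q) m (t + t') m''
  | iteTrue {b : Test} {p : Prog} (q : Prog) {m m' : Mem} {t : ℕ} : b.Fits W m → b.Holds m →
      Exec W p m t m' → Exec W (.ite b p q) m (b.time + t) m'
  | iteFalse {b : Test} (p : Prog) {q : Prog} {m m' : Mem} {t : ℕ} : b.Fits W m → ¬ b.Holds m →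
      Exec W q m t m' → Exec W (.ite b p q) m (b.time + t) m'
  | loopTrue {b : Test} {p : Prog} {m m' m'' : Mem} {t t' : ℕ} : b.Fits W m → b.Holds m →
      Exec W p m t m' → Exec W (.loop b p) m' t' m'' →
      Exec W (.loop b p) m (b.time + t + t') m''
  | loopFalse {b : Test} (p : Prog) {m : Mem} : b.Fits W m → ¬ b.Holds m →
      Exec W (.loop b p) m b.time m

/-- The machine is deterministic: running time and final memory are determined by the program and
the initial memory (and do not depend on the word bound). -/
theorem Exec.deterministic {W W' : ℕ} {p : Prog} {m m₁ m₂ : Mem} {t₁ t₂ : ℕ}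
    (h₁ : Exec W p m t₁ m₁) (h₂ : Exec W' p m t₂ m₂) : t₁ = t₂ ∧ m₁ = m₂ := by
  induction h₁ generalizing t₂ m₂ with
  | skip => cases h₂; exact ⟨rfl, rfl⟩
  | setReg => cases h₂; exact ⟨rfl, rfl⟩
  | setArr => cases h₂; exact ⟨rfl, rfl⟩
  | setCost => cases h₂; exact ⟨rfl, rfl⟩
  | seq _ _ ih ih' =>
    cases h₂ with
    | seq g g' =>
      obtain ⟨rfl, rfl⟩ := ih g
      obtain ⟨rfl, rfl⟩ := ih' g'
      exact ⟨rfl, rfl⟩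
  | iteTrue _ _ hb _ ih =>
    cases h₂ with
    | iteTrue _ _ _ g => obtain ⟨rfl, rfl⟩ := ih g; exact ⟨rfl, rfl⟩
    | iteFalse _ _ hb' _ => exact absurd hb hb'
  | iteFalse _ _ hb _ ih =>
    cases h₂ with
    | iteTrue _ _ hb' _ => exact absurd hb' hb
    | iteFalse _ _ _ g => obtain ⟨rfl, rfl⟩ := ih g; exact ⟨rfl, rfl⟩
  | loopTrue _ hb _ _ ih ih' =>
    cases h₂ with
    | loopTrue _ _ g g' =>
      obtain ⟨rfl, rfl⟩ := ih g
      obtain ⟨rfl, rfl⟩ := ih' g'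
      exact ⟨rfl, rfl⟩
    | loopFalse _ _ hb' => exact absurd hb hb'
  | loopFalse _ _ hb =>
    cases h₂ with
    | loopTrue _ hb' _ _ => exact absurd hb' hb
    | loopFalse _ _ _ => exact ⟨rfl, rfl⟩

/-! ### Dynamic facility location -/

/-- A request. An arriving client `j` has a distance `δ x` to every facility `x`; of these data the
algorithm is only told a facility `p` which is nearest to `j`. A departing client is named. -/
inductive Request (X : Type) : Type
  | arrive (p : X) (δ : X → ℝ)
  | depart (j : ℕ)

/-- The clients at some time: how many have arrived so far (they are named `0, 1, 2, …` in the
order of arrival), which ones are present, and the distances of each client to the facilities. -/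
structure Clients (X : Type) where
  arrived : ℕ
  present : Finset ℕ
  dist : ℕ → X → ℝ

namespace Clients

variable {X : Type}

/-- The clients after a request. -/
def next (C : Clients X) : Request X → Clients X
  | .arrive _ δ => ⟨C.arrived + 1, insert C.arrived C.present, Function.update C.dist C.arrived δ⟩
  | .depart j => ⟨C.arrived, C.present.erase j, C.dist⟩

/-- The clients after the first `t` requests of the sequence `r`; initially there are none. -/
def after (r : ℕ → Request X) : ℕ → Clients X
  | 0 => ⟨0, ∅, fun _ _ => 0⟩
  | t + 1 => (after r t).next (r t)

/-- The cost of opening the facilities in `S` and connecting every client `j` to `σ j`. -/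
def cost (C : Clients X) (f : X → ℝ) (S : Finset X) (σ : ℕ → X) : ℝ :=
  ∑ x ∈ S, f x + ∑ j ∈ C.present, C.dist j (σ j)

end Clients

namespace HST

variable {V : Type}

/-- A request that may be made when the clients are `C`: an arriving client extends the metric of
the facilities to a (pseudo-)metric with one more point and the reported facility is nearest to it;
a departing client is present. -/
def Legal (T : HST V) (C : Clients T.Leaf) : Request T.Leaf → Prop
  | .arrive p δ => (∀ x, δ p ≤ δ x) ∧ (∀ x y, δ x ≤ T.dist x.1 y.1 + δ y) ∧
      ∀ x y, (T.dist x.1 y.1 : ℝ) ≤ δ x + δ y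
  | .depart j => j ∈ C.present

/-- The memory before preprocessing. Register `0` holds the number `k` of listed vertices of the
tree; arrays `0` and `1` hold their levels and the numbers of their lowest listed strict ancestors;
cost array `0` holds the opening costs of the facilities; all else is `0`. -/
noncomputable def inputMem (T : HST V) (f : T.Leaf → ℝ) {k : ℕ} (e : Fin k ≃ T.Essential) :
    Mem where
  reg x := if x = 0 then k else 0
  arr a i := if h : i < k then
      if a = 0 then T.level (e ⟨i, h⟩).1 else if a = 1 then T.nextIdx e ⟨i, h⟩ else 0
    else 0
  cost a i := if h : i < k then
      if h' : T.level (e ⟨i, h⟩).1 = 0 then if a = 0 then f ⟨(e ⟨i, h⟩).1, h'⟩ else 0 else 0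
    else 0

/-- A request is handed over in the registers `1` (`0` for an arrival, `1` for a departure), `2`
(the name of the client) and `3` (for an arrival, the number of the reported facility). -/
def request (T : HST V) {k : ℕ} (e : Fin k ≃ T.Essential) (C : Clients T.Leaf) (m : Mem) :
    Request T.Leaf → Mem
  | .arrive p _ => ((m.setReg 1 0).setReg 2 C.arrived).setReg 3 (T.idx e p)
  | .depart j => ((m.setReg 1 1).setReg 2 j).setReg 3 0

/-- The open facilities according to memory `m`: array `3` holds a non-zero entry for them. -/
def openSet [Fintype V] (T : HST V) {k : ℕ} (e : Fin k ≃ T.Essential) (m : Mem) :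
    Finset T.Leaf :=
  {x : T.Leaf | m.arr 3 (T.idx e x) ≠ 0}

end HST

/-- The memory `m` stores a feasible solution: for every client `j` that is present, entry `j` of
array `2` is the number of the facility `σ j` to which `j` is connected, and `σ j` is open. -/
def Stores {V : Type} [Fintype V] (T : HST V) {k : ℕ} (e : Fin k ≃ T.Essential)
    (C : Clients T.Leaf) (m : Mem) (σ : ℕ → T.Leaf) : Prop :=
  ∀ j ∈ C.present, m.arr 2 j = T.idx e (σ j) ∧ σ j ∈ T.openSet e m

/-- The number of clients present before and after a step whose connection has changed. -/
def clientRecourse {X : Type} (C C' : Clients X) (m m' : Mem) : ℕ :=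
  {j ∈ C.present ∩ C'.present | m.arr 2 j ≠ m'.arr 2 j}.card

/-- The number of facilities that have been opened or closed in a step. -/
def facilityRecourse {V : Type} [Fintype V] [DecidableEq V] (T : HST V) {k : ℕ}
    (e : Fin k ≃ T.Essential) (m m' : Mem) : ℕ :=
  (symmDiff (T.openSet e m) (T.openSet e m')).card

/-! ### Reasoning about programs -/

namespace Mem

/-! The tree is cut at its highest listed vertex, which leaves O(log (D + 2)) levels
(`two_pow_height_le`) and turns it into a hierarchy of nested classes of leaves (`Hier`). Every
client is treated as if it sat at its nearest facility. A class v of level i is worth h(v) = max(G,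
1) / 2^i clients, where G is the least opening cost inside v, or 0 at the top: that many clients,
each paying 2^i, pay for a facility in v. Some vertices are owners and keep the cheapest facility of
their class open. A vertex is marked if there is an owner at or below it, and a client is residual
at v if its path has no marked vertex strictly below v. A vertex becomes an owner when it has at
least h residual clients and stops being one when it has fewer than h/4. A client is served at its
lowest marked ancestor: by the facility of that vertex if it is an owner, and otherwise by the
facility found when descending through first marked children (`rep`).

Quality (`Consistent.cost_le`). Group the leaves into cells, the classes just below the lowest
marked ancestors. An unmarked cell of level i has fewer than h clients. A competing solution either
opens a facility in the cell and pays at least G, or sends all clients of the cell away and pays at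
least 2^i for each. In both cases it pays 2^i for every client of the cell, which bounds the
connection cost up to a constant. An owner still has h/4 residual clients, and these charges pay for
its facility; owners at level 0 and at the top are charged to the competing solution directly.

Recourse and time. A request affects the vertices of one path. The gap between h/4 and h is
exploited by a potential (`pot`): with r residual clients it is 5/4 (h - r)⁺ at an owner and (min r
h - h/4)⁺ elsewhere. Inserting or removing a client raises it by O(1) per vertex, and switching a
vertex on or off releases a constant times h. As h at least halves from a vertex to its parent, the
released amount also pays for what the switch causes further up: its residual clients leave or enter
the list of the parent, and ancestors that are not owners, with fewer than h residual clients each,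
may find another facility when they descend. The part still to be spent is carried upwards as
`credit`; the inequalities are `account_insert`, `account_erase`, `account_gain`, `account_loss` and
`account_same`, and `PassInv.step` turns them into an invariant of the first pass. A second pass
rewrites the assignments that may be stale. It searches for a facility along the hierarchy at each
flagged vertex, so a request takes amortized time O(L²) with L the number of the top level
(`serve_runs`).

On the machine, each unit of time changes at most one entry of an array (`Exec.changed`), so the
running time also bounds both recourses. Preprocessing does nothing: the hierarchy is computed on
the first request, which costs O(|F| log (D + 2)) once and does not touch the solution. There are at
most twice as many requests as arrivals, so amortized time per request becomes total time in terms
of n. -/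

@[simp] theorem setReg_reg (m : Mem) (x v y : ℕ) :
    (m.setReg x v).reg y = if y = x then v else m.reg y := by
  simp [setReg, Function.update_apply]

@[simp] theorem setReg_arr (m : Mem) (x v : ℕ) : (m.setReg x v).arr = m.arr := rfl

@[simp] theorem setReg_cost (m : Mem) (x v : ℕ) : (m.setReg x v).cost = m.cost := rfl

@[simp] theorem setArr_reg (m : Mem) (a i v : ℕ) : (m.setArr a i v).reg = m.reg := rfl

@[simp] theorem setArr_arr (m : Mem) (a i v b j : ℕ) :
    (m.setArr a i v).arr b j = if b = a ∧ j = i then v else m.arr b j := by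
  by_cases hb : b = a
  · subst hb; simp [setArr, Function.update_apply]
  · simp [setArr, hb]

@[simp] theorem setArr_cost (m : Mem) (a i v : ℕ) : (m.setArr a i v).cost = m.cost := rfl

@[simp] theorem setCost_reg (m : Mem) (a i : ℕ) (v : ℝ) : (m.setCost a i v).reg = m.reg := rfl

@[simp] theorem setCost_arr (m : Mem) (a i : ℕ) (v : ℝ) : (m.setCost a i v).arr = m.arr := rfl

@[simp] theorem setCost_cost (m : Mem) (a i : ℕ) (v : ℝ) (b j : ℕ) :
    (m.setCost a i v).cost b j = if b = a ∧ j = i then v else m.cost b j := by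
  by_cases hb : b = a
  · subst hb; simp [setCost, Function.update_apply]
  · simp [setCost, hb]

/-- All words in memory respect the bound `W`. -/
def Bdd (W : ℕ) (m : Mem) : Prop := (∀ x, m.reg x ≤ W) ∧ ∀ a i, m.arr a i ≤ W

theorem Bdd.mono {W W' : ℕ} {m : Mem} (h : m.Bdd W) (hW : W ≤ W') : m.Bdd W' :=
  ⟨fun x => (h.1 x).trans hW, fun a i => (h.2 a i).trans hW⟩

theorem Bdd.setReg {W : ℕ} {m : Mem} (h : m.Bdd W) {x v : ℕ} (hv : v ≤ W) :
    (m.setReg x v).Bdd W :=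
  ⟨fun y => by rw [setReg_reg]; split_ifs; exacts [hv, h.1 y], h.2⟩

theorem Bdd.setArr {W : ℕ} {m : Mem} (h : m.Bdd W) {a i v : ℕ} (hv : v ≤ W) :
    (m.setArr a i v).Bdd W :=
  ⟨h.1, fun b j => by rw [setArr_arr]; split_ifs; exacts [hv, h.2 b j]⟩

end Mem

theorem WExp.Fits.eval_le {W : ℕ} {m : Mem} {e : WExp} (h : e.Fits W m) : e.eval m ≤ W := by
  induction e with
  | const n => exact h
  | reg x => exact h
  | read a i _ => exact h.2
  | add _ _ _ _ => exact h.2.2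
  | sub e₁ e₂ ih _ => exact (Nat.sub_le _ _).trans (ih h.1)
  | mul _ _ _ _ => exact h.2.2

theorem Exec.bdd {W : ℕ} {p : Prog} {m m' : Mem} {t : ℕ} (h : Exec W p m t m')
    (hm : m.Bdd W) : m'.Bdd W := by
  induction h with
  | skip => exact hm
  | setReg m x e h => exact hm.setReg h.eval_le
  | setArr m a i e _ h => exact hm.setArr h.eval_le
  | setCost m a i c _ _ => exact hm
  | seq _ _ ih ih' => exact ih' (ih hm)
  | iteTrue _ _ _ _ ih => exact ih hm
  | iteFalse _ _ _ _ ih => exact ih hm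
  | loopTrue _ _ _ _ ih ih' => exact ih' (ih hm)
  | loopFalse => exact hm

namespace Prog

/-- The registers that a program may write. -/
def regs : Prog → List ℕ
  | skip | setArr _ _ _ | setCost _ _ _ => []
  | setReg x _ => [x]
  | seq p q | ite _ p q => p.regs ++ q.regs
  | loop _ p => p.regs

/-- The word arrays that a program may write. -/
def arrs : Prog → List ℕ
  | skip | setReg _ _ | setCost _ _ _ => []
  | setArr a _ _ => [a]
  | seq p q | ite _ p q => p.arrs ++ q.arrs
  | loop _ p => p.arrs

/-- The cost arrays that a program may write. -/
def costs : Prog → List ℕ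
  | skip | setReg _ _ | setArr _ _ _ => []
  | setCost a _ _ => [a]
  | seq p q | ite _ p q => p.costs ++ q.costs
  | loop _ p => p.costs

/-- A sequence of programs. -/
def block : List Prog → Prog
  | [] => skip
  | p :: ps => seq p (block ps)

/-- The weakest precondition of a program without loops. -/
def wp (W : ℕ) : Prog → (Mem → Prop) → Mem → Prop
  | skip, Q, m => Q m
  | setReg x e, Q, m => e.Fits W m ∧ Q (m.setReg x (e.eval m))
  | setArr a i e, Q, m => i.Fits W m ∧ e.Fits W m ∧ Q (m.setArr a (i.eval m) (e.eval m))
  | setCost a i c, Q, m => i.Fits W m ∧ c.Fits W m ∧ Q (m.setCost a (i.eval m) (c.eval m))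
  | seq p q, Q, m => wp W p (wp W q Q) m
  | ite b p q, Q, m => b.Fits W m ∧ (b.Holds m → wp W p Q m) ∧ (¬ b.Holds m → wp W q Q m)
  | loop _ _, _, _ => False

/-- A bound for the running time of a program without loops. -/
def maxTime : Prog → ℕ
  | skip => 1
  | setReg _ e => e.time + 1
  | setArr _ i e => i.time + e.time + 1
  | setCost _ i c => i.time + c.time + 1
  | seq p q => p.maxTime + q.maxTime
  | ite b p q => b.time + max p.maxTime q.maxTime
  | loop _ _ => 0

/-- Started on `m`, the program halts within time `T` and establishes `Q`. -/
def Runs (W : ℕ) (p : Prog) (m : Mem) (T : ℕ) (Q : Mem → Prop) : Prop :=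
  ∃ t m', Exec W p m t m' ∧ t ≤ T ∧ Q m'

/-- Symbolic execution for loop-free code. `maxTime` takes the longer branch of every test, so the
time bound depends on the program text alone and can be decided. Loops are excluded because their
precondition is `False`. -/
theorem wp.runs {W : ℕ} {p : Prog} {Q : Mem → Prop} {m : Mem} (h : p.wp W Q m) {T : ℕ}
    (hT : p.maxTime ≤ T) : p.Runs W m T Q := by
  suffices h : p.Runs W m p.maxTime Q by
    obtain ⟨t, m', h₁, h₂, h₃⟩ := h
    exact ⟨t, m', h₁, h₂.trans hT, h₃⟩
  clear hT
  induction p generalizing m Q with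
  | skip => exact ⟨1, m, .skip m, le_rfl, h⟩
  | setReg x e => exact ⟨_, _, .setReg m x e h.1, le_rfl, h.2⟩
  | setArr a i e => exact ⟨_, _, .setArr m a i e h.1 h.2.1, le_rfl, h.2.2⟩
  | setCost a i c => exact ⟨_, _, .setCost m a i c h.1 h.2.1, le_rfl, h.2.2⟩
  | seq p q ihp ihq =>
    obtain ⟨t, m₁, h₁, ht, hq⟩ := ihp h
    obtain ⟨t', m₂, h₂, ht', hQ⟩ := ihq hq
    exact ⟨_, _, .seq h₁ h₂, Nat.add_le_add ht ht', hQ⟩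
  | ite b p q ihp ihq =>
    obtain ⟨hf, hp, hq⟩ := h
    by_cases hb : b.Holds m
    · obtain ⟨t, m₁, h₁, ht, hQ⟩ := ihp (hp hb)
      exact ⟨_, _, .iteTrue _ hf hb h₁, Nat.add_le_add_left (ht.trans (le_max_left _ _)) _, hQ⟩
    · obtain ⟨t, m₁, h₁, ht, hQ⟩ := ihq (hq hb)
      exact ⟨_, _, .iteFalse _ hf hb h₁, Nat.add_le_add_left (ht.trans (le_max_right _ _)) _, hQ⟩
  | loop => exact h.elim

theorem Runs.mono {W : ℕ} {p : Prog} {m : Mem} {T T' : ℕ} {Q Q' : Mem → Prop}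
    (h : p.Runs W m T Q) (hT : T ≤ T') (hQ : ∀ m', Q m' → Q' m') : p.Runs W m T' Q' := by
  obtain ⟨t, m', h₁, h₂, h₃⟩ := h
  exact ⟨t, m', h₁, h₂.trans hT, hQ _ h₃⟩

theorem Runs.seq {W : ℕ} {p q : Prog} {m : Mem} {T T' : ℕ} {Q Q' : Mem → Prop}
    (h : p.Runs W m T Q) (h' : ∀ m', Q m' → q.Runs W m' T' Q') :
    (Prog.seq p q).Runs W m (T + T') Q' := by
  obtain ⟨t, m₁, h₁, ht, hq⟩ := h
  obtain ⟨t', m₂, h₂, ht', hQ⟩ := h' _ hq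
  exact ⟨_, _, .seq h₁ h₂, Nat.add_le_add ht ht', hQ⟩

theorem Runs.ite {W : ℕ} {b : Test} {p q : Prog} {m : Mem} {T : ℕ} {Q : Mem → Prop}
    (hf : b.Fits W m) (hp : b.Holds m → p.Runs W m T Q) (hq : ¬ b.Holds m → q.Runs W m T Q) :
    (Prog.ite b p q).Runs W m (b.time + T) Q := by
  by_cases hb : b.Holds m
  · obtain ⟨t, m₁, h₁, ht, hQ⟩ := hp hb
    exact ⟨_, _, .iteTrue _ hf hb h₁, Nat.add_le_add_left ht _, hQ⟩
  · obtain ⟨t, m₁, h₁, ht, hQ⟩ := hq hb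
    exact ⟨_, _, .iteFalse _ hf hb h₁, Nat.add_le_add_left ht _, hQ⟩

/-- Strengthening a postcondition by facts that hold for every execution. -/
theorem Runs.and_exec {W : ℕ} {p : Prog} {m : Mem} {T : ℕ} {Q Q' : Mem → Prop}
    (h : p.Runs W m T Q) (h' : ∀ t m', Exec W p m t m' → t ≤ T → Q m' → Q' m') :
    p.Runs W m T Q' := by
  obtain ⟨t, m', h₁, h₂, h₃⟩ := h
  exact ⟨t, m', h₁, h₂, h' t m' h₁ h₂ h₃⟩

/-- A loop that is run `n` times; `I i t` is the invariant after `i` rounds, and `t` bounds the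
time spent so far. -/
theorem loop_runs {W : ℕ} {b : Test} {p : Prog} (I : ℕ → ℕ → Mem → Prop) (n : ℕ) {m : Mem}
    (h0 : I 0 0 m)
    (hs : ∀ i t m, i < n → I i t m → b.Fits W m ∧ b.Holds m ∧
      ∃ T, p.Runs W m T fun m' => I (i + 1) (t + b.time + T) m')
    (he : ∀ t m, I n t m → b.Fits W m ∧ ¬ b.Holds m) :
    ∃ t, (loop b p).Runs W m (t + b.time) (I n t) := by
  suffices h : ∀ d i t m, i + d = n → I i t m →
      ∃ t', (loop b p).Runs W m (t' + b.time) (I n (t + t')) by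
    obtain ⟨t, ht⟩ := h n 0 0 m (Nat.zero_add n) h0
    exact ⟨t, by simpa using ht⟩
  intro d
  induction d with
  | zero =>
    intro i t m hi hI
    obtain rfl : i = n := hi
    exact ⟨0, _, m, .loopFalse _ (he t m hI).1 (he t m hI).2, by simp, hI⟩
  | succ d ih =>
    intro i t m hi hI
    obtain ⟨hf, hb, T, t₁, m₁, h₁, ht₁, hI₁⟩ := hs i t m (by omega) hI
    obtain ⟨t₂, t₃, m₂, h₂, ht₂, hI₂⟩ := ih (i + 1) _ m₁ (by omega) hI₁
    refine ⟨b.time + T + t₂, _, m₂, .loopTrue hf hb h₁ h₂, by omega, ?_⟩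
    rwa [show t + (b.time + T + t₂) = t + b.time + T + t₂ by ring]

end Prog

/-- Frame rule: a register that does not occur as a target in the program text keeps its value.
Together with `Exec.arr_eq` and `Exec.cost_eq` it reduces non-interference to a decidable membership
in a list. -/
theorem Exec.reg_eq {W : ℕ} {p : Prog} {m m' : Mem} {t : ℕ} (h : Exec W p m t m') {x : ℕ}
    (hx : x ∉ p.regs) : m'.reg x = m.reg x := by
  induction h with
  | skip | setArr | setCost | loopFalse => rfl
  | setReg m y e _ =>
    rw [Mem.setReg_reg, if_neg]
    simpa [Prog.regs] using hx
  | seq _ _ ih ih' =>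
    simp only [Prog.regs, List.mem_append, not_or] at hx
    rw [ih' hx.2, ih hx.1]
  | iteTrue _ _ _ _ ih =>
    simp only [Prog.regs, List.mem_append, not_or] at hx
    exact ih hx.1
  | iteFalse _ _ _ _ ih =>
    simp only [Prog.regs, List.mem_append, not_or] at hx
    exact ih hx.2
  | loopTrue _ _ _ _ ih ih' => rw [ih' hx, ih hx]

theorem Exec.arr_eq {W : ℕ} {p : Prog} {m m' : Mem} {t : ℕ} (h : Exec W p m t m') {a : ℕ}
    (ha : a ∉ p.arrs) : m'.arr a = m.arr a := by
  induction h with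
  | skip | setReg | setCost | loopFalse => rfl
  | setArr m b i e _ _ =>
    funext j
    rw [Mem.setArr_arr, if_neg]
    simp only [Prog.arrs, List.mem_singleton] at ha
    exact fun h => ha h.1
  | seq _ _ ih ih' =>
    simp only [Prog.arrs, List.mem_append, not_or] at ha
    rw [ih' ha.2, ih ha.1]
  | iteTrue _ _ _ _ ih =>
    simp only [Prog.arrs, List.mem_append, not_or] at ha
    exact ih ha.1
  | iteFalse _ _ _ _ ih =>
    simp only [Prog.arrs, List.mem_append, not_or] at ha
    exact ih ha.2
  | loopTrue _ _ _ _ ih ih' => rw [ih' ha, ih ha]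

theorem Exec.cost_eq {W : ℕ} {p : Prog} {m m' : Mem} {t : ℕ} (h : Exec W p m t m') {a : ℕ}
    (ha : a ∉ p.costs) : m'.cost a = m.cost a := by
  induction h with
  | skip | setReg | setArr | loopFalse => rfl
  | setCost m b i e _ _ =>
    funext j
    rw [Mem.setCost_cost, if_neg]
    simp only [Prog.costs, List.mem_singleton] at ha
    exact fun h => ha h.1
  | seq _ _ ih ih' =>
    simp only [Prog.costs, List.mem_append, not_or] at ha
    rw [ih' ha.2, ih ha.1]
  | iteTrue _ _ _ _ ih =>
    simp only [Prog.costs, List.mem_append, not_or] at ha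
    exact ih ha.1
  | iteFalse _ _ _ _ ih =>
    simp only [Prog.costs, List.mem_append, not_or] at ha
    exact ih ha.2
  | loopTrue _ _ _ _ ih ih' => rw [ih' ha, ih ha]

/-- An execution of `t` steps changes at most `t` entries of an array. -/
theorem Exec.changed {W : ℕ} {p : Prog} {m m' : Mem} {t : ℕ} (h : Exec W p m t m') (a : ℕ) :
    ∃ S : Finset ℕ, S.card ≤ t ∧ ∀ i, m.arr a i ≠ m'.arr a i → i ∈ S := by
  induction h with
  | skip | setReg | setCost | loopFalse => exact ⟨∅, by simp, fun i hi => absurd rfl hi⟩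
  | setArr m b i e _ _ =>
    refine ⟨{i.eval m}, by simp, fun j hj => ?_⟩
    rw [Finset.mem_singleton]
    by_contra hne
    exact hj (by rw [Mem.setArr_arr, if_neg fun h => hne h.2])
  | seq _ _ ih ih' =>
    obtain ⟨S, hS, h⟩ := ih
    obtain ⟨S', hS', h'⟩ := ih'
    refine ⟨S ∪ S', (Finset.card_union_le _ _).trans (Nat.add_le_add hS hS'), fun i hi => ?_⟩
    by_contra hn
    simp only [Finset.mem_union, not_or] at hn
    exact hi ((not_not.1 (mt (h i) hn.1)).trans (not_not.1 (mt (h' i) hn.2)))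
  | iteTrue _ _ _ _ ih =>
    obtain ⟨S, hS, h⟩ := ih
    exact ⟨S, by omega, h⟩
  | iteFalse _ _ _ _ ih =>
    obtain ⟨S, hS, h⟩ := ih
    exact ⟨S, by omega, h⟩
  | loopTrue _ _ _ _ ih ih' =>
    obtain ⟨S, hS, h⟩ := ih
    obtain ⟨S', hS', h'⟩ := ih'
    refine ⟨S ∪ S', (Finset.card_union_le _ _).trans (by omega), fun i hi => ?_⟩
    by_contra hn
    simp only [Finset.mem_union, not_or] at hn
    exact hi ((not_not.1 (mt (h i) hn.1)).trans (not_not.1 (mt (h' i) hn.2)))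

/-! ### Bags: finite sets of numbers stored in arrays -/

/-- The index at which entry `i` of bag `b` is stored. -/
def pr (b i : ℕ) : ℕ := (b + i) * (b + i) + b

/-- (b + i)² ≤ pr b i < (b + i + 1)², so the value determines b + i and then b. -/
theorem pr_inj {b i b' i' : ℕ} : pr b i = pr b' i' ↔ b = b' ∧ i = i' := by
  refine ⟨fun h => ?_, fun h => by rw [h.1, h.2]⟩
  unfold pr at h
  have h₁ : b + i = b' + i' := by
    rcases lt_trichotomy (b + i) (b' + i') with hl | he | hl
    · nlinarith
    · exact he
    · nlinarith
  rw [h₁] at h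
  omega

theorem pr_le {b i N : ℕ} (hb : b ≤ 2 * N + 1) (hi : i ≤ N) : pr b i ≤ (4 * N + 4) ^ 2 := by
  unfold pr
  nlinarith [Nat.mul_le_mul (Nat.add_le_add hb hi) (Nat.add_le_add hb hi)]

/-- The expression for `pr`. -/
def prE (b i : WExp) : WExp := .add (.mul (.add b i) (.add b i)) b

@[simp] theorem prE_eval (m : Mem) (b i : WExp) : (prE b i).eval m = pr (b.eval m) (i.eval m) := rfl

theorem prE_fits {W : ℕ} {m : Mem} {b i : WExp} (hb : b.Fits W m) (hi : i.Fits W m)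
    (h : pr (b.eval m) (i.eval m) ≤ W) : (prE b i).Fits W m := by
  unfold pr at h
  have : b.eval m + i.eval m ≤ (b.eval m + i.eval m) * (b.eval m + i.eval m) := Nat.le_mul_self _
  exact ⟨⟨⟨hb, hi, by omega⟩, ⟨hb, hi, by omega⟩, by simp only [WExp.eval]; omega⟩, hb,
    by simpa [WExp.eval] using h⟩

/-- The bags `B` are stored in memory: array `4` holds their sizes, array `5` their elements and
array `6` the positions of the elements. -/
structure Bags (m : Mem) (B : ℕ → Finset ℕ) : Prop where
  card : ∀ b, m.arr 4 b = (B b).card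
  item : ∀ b i, i < (B b).card →
    m.arr 5 (pr b i) ∈ B b ∧ m.arr 6 (pr b (m.arr 5 (pr b i))) = i
  pos : ∀ b, ∀ x ∈ B b,
    m.arr 6 (pr b x) < (B b).card ∧ m.arr 5 (pr b (m.arr 6 (pr b x))) = x

theorem Bags.congr {m m' : Mem} {B : ℕ → Finset ℕ} (h : Bags m B) (h4 : m'.arr 4 = m.arr 4)
    (h5 : m'.arr 5 = m.arr 5) (h6 : m'.arr 6 = m.arr 6) : Bags m' B := by
  constructor
  · rw [h4]; exact h.card
  · rw [h5, h6]; exact h.item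
  · rw [h5, h6]; exact h.pos

/-- Inserts the element in register `21` into the bag in register `20`. -/
def bagInsert : Prog := .block [
  .setArr 5 (prE (.reg 20) (.read 4 (.reg 20))) (.reg 21),
  .setArr 6 (prE (.reg 20) (.reg 21)) (.read 4 (.reg 20)),
  .setArr 4 (.reg 20) (.add (.read 4 (.reg 20)) (.const 1))]

/-- Removes the element in register `21` from the bag in register `20`. -/
def bagRemove : Prog := .block [
  .setReg 22 (.read 6 (prE (.reg 20) (.reg 21))),
  .setArr 4 (.reg 20) (.sub (.read 4 (.reg 20)) (.const 1)),
  .setReg 23 (.read 5 (prE (.reg 20) (.read 4 (.reg 20)))),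
  .setArr 5 (prE (.reg 20) (.reg 22)) (.reg 23),
  .setArr 6 (prE (.reg 20) (.reg 23)) (.reg 22)]

/-- The second part of the conclusion matters for `fk`, which is read off the raw contents of other
bags, including empty ones. -/
theorem bagInsert_runs {W : ℕ} {m : Mem} {B : ℕ → Finset ℕ} (hm : m.Bdd W) (hB : Bags m B)
    {b x : ℕ} (hb : m.reg 20 = b) (hx : m.reg 21 = x) (hn : x ∉ B b) (h₁ : pr b x ≤ W)
    (h₂ : pr b (B b).card < W) :
    bagInsert.Runs W m 50 fun m' => Bags m' (Function.update B b (insert x (B b))) ∧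
      ∀ b' i, b' ≠ b → m'.arr 5 (pr b' i) = m.arr 5 (pr b' i) := by
  refine Prog.wp.runs ?_ (by decide)
  subst hb hx
  have hlt : (B (m.reg 20)).card < W := by
    refine lt_of_le_of_lt ?_ h₂
    unfold pr
    nlinarith [Nat.le_mul_self (m.reg 20 + (B (m.reg 20)).card)]
  refine ⟨prE_fits (hm.1 _) ⟨hm.1 _, hm.2 _ _⟩ (by simpa [WExp.eval, hB.card] using h₂.le), hm.1 _,
    prE_fits (hm.1 _) (hm.1 _) (by simpa [WExp.eval] using h₁), ⟨hm.1 _, ?_⟩, hm.1 _,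
    ⟨⟨hm.1 _, ?_⟩, ?_, ?_⟩, ?_⟩
  · simpa using hm.2 _ _
  · simpa using hm.2 _ _
  · show 1 ≤ W
    omega
  · simpa [WExp.eval, hB.card] using hlt
  · simp only [WExp.eval, prE_eval, hB.card]
    constructor
    · constructor
      · intro b
        by_cases h : b = m.reg 20
        · subst h; simp [hn, hB.card]
        · simp [h, hB.card]
      · intro b i hi
        by_cases h : b = m.reg 20
        · subst h
          simp only [Function.update_self, Finset.card_insert_of_notMem hn] at hi ⊢
          rcases Nat.lt_succ_iff_lt_or_eq.1 hi with hi | rfl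
          · have := hB.item _ i hi
            have hne : m.arr 5 (pr (m.reg 20) i) ≠ m.reg 21 := fun h => hn (h ▸ this.1)
            simp [pr_inj, hi.ne, hne, this]
          · simp [pr_inj, hB.card]
        · have := hB.item b i (by simpa [h] using hi)
          simpa [h, pr_inj] using this
      · intro b x hx
        by_cases h : b = m.reg 20
        · subst h
          simp only [Function.update_self, Finset.card_insert_of_notMem hn, Finset.mem_insert]
            at hx ⊢
          by_cases hxe : x = m.reg 21
          · simp [pr_inj, hxe, hB.card]
          · have := hB.pos _ x (hx.resolve_left hxe)
            simp [pr_inj, hxe, this, this.1.ne, this.1.le]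
        · have := hB.pos b x (by simpa [h] using hx)
          simpa [h, pr_inj] using this
    · intro b' i hb'
      simp [pr_inj, hb']

/-- The last element is moved into the gap. If the removed element is itself the last one, the two
final writes only touch a position beyond the new end. -/
theorem bagRemove_runs {W : ℕ} {m : Mem} {B : ℕ → Finset ℕ} (hm : m.Bdd W) (hB : Bags m B)
    {b x : ℕ} (hb : m.reg 20 = b) (hx : m.reg 21 = x) (hn : x ∈ B b) (h₁ : 1 ≤ W)
    (h₂ : ∀ y ∈ B b, pr b y ≤ W) (h₃ : pr b (B b).card ≤ W) :
    bagRemove.Runs W m 70 fun m' => Bags m' (Function.update B b ((B b).erase x)) ∧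
      ∀ b' i, b' ≠ b → m'.arr 5 (pr b' i) = m.arr 5 (pr b' i) := by
  refine Prog.wp.runs ?_ (by decide)
  subst hb hx
  have hpr : ∀ i ≤ (B (m.reg 20)).card, pr (m.reg 20) i ≤ W := by
    intro i hi
    refine le_trans ?_ h₃
    unfold pr
    gcongr
  have hpos := hB.pos _ _ hn
  have hc : 0 < (B (m.reg 20)).card := Finset.card_pos.2 ⟨_, hn⟩
  have hlast := hB.item (m.reg 20) ((B (m.reg 20)).card - 1) (by omega)
  refine ⟨⟨prE_fits (hm.1 _) (hm.1 _) (h₂ _ hn), hm.2 _ _⟩, ?_, ⟨⟨?_, ?_⟩, ?_⟩, ⟨?_, ?_⟩, ?_, ?_,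
    ?_, ?_, ?_⟩
  · simpa [WExp.Fits] using hm.1 _
  · simpa [WExp.Fits] using hm.1 _
  · simpa [WExp.eval] using hm.2 _ _
  · exact h₁
  · refine prE_fits ?_ ?_ ?_
    · simpa [WExp.Fits] using hm.1 _
    · refine ⟨by simpa [WExp.Fits] using hm.1 _, ?_⟩
      simp only [WExp.eval, Mem.setArr_arr, Mem.setArr_reg, Mem.setReg_reg, Mem.setReg_arr]
      have := hm.2 4 (m.reg 20)
      simp
      omega
    · simp only [WExp.eval, Mem.setArr_arr, Mem.setArr_reg, Mem.setReg_reg, Mem.setReg_arr]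
      simp only [and_self, if_true, hB.card, show (20 : ℕ) ≠ 22 by norm_num, if_false]
      exact hpr _ (by omega)
  · simp [WExp.eval]
    exact hm.2 _ _
  · refine prE_fits ?_ ?_ ?_
    · simpa [WExp.Fits] using hm.1 _
    · simpa [WExp.Fits, WExp.eval] using hm.2 _ _
    · simpa [WExp.eval] using hpr _ hpos.1.le
  · simpa [WExp.Fits, WExp.eval] using hm.2 _ _
  · refine prE_fits ?_ ?_ ?_
    · simpa [WExp.Fits] using hm.1 _
    · simpa [WExp.Fits, WExp.eval] using hm.2 _ _
    · simpa [WExp.eval, hB.card] using h₂ _ hlast.1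
  · simpa [WExp.eval, WExp.Fits] using hm.2 _ _
  · simp only [WExp.eval, prE_eval, Mem.setArr_arr, Mem.setArr_reg, Mem.setReg_reg,
      Mem.setReg_arr, hB.card]
    norm_num only [if_true, if_false, true_and, false_and, and_self]
    set p := m.arr 6 (pr (m.reg 20) (m.reg 21)) with hp
    set c := (B (m.reg 20)).card with hcdef
    set y := m.arr 5 (pr (m.reg 20) (c - 1)) with hy
    have hcy : ((B (m.reg 20)).erase (m.reg 21)).card = c - 1 := Finset.card_erase_of_mem hn
    constructor
    · constructor
      · intro b
        by_cases h : b = m.reg 20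
        · subst h
          simp [hcy]
        · simp [h, hB.card]
      · intro b i hi
        by_cases h : b = m.reg 20
        · subst h
          simp only [Function.update_self, hcy] at hi ⊢
          have hi' := hB.item (m.reg 20) i (by omega)
          by_cases hip : i = p
          · subst hip
            have hne : y ≠ m.reg 21 := by
              intro h
              rw [h, ← hp] at hlast
              omega
            simp [pr_inj, hne, hlast.1]
          · have hne : m.arr 5 (pr (m.reg 20) i) ≠ m.reg 21 := by
              intro h
              rw [h, ← hp] at hi'
              exact hip hi'.2.symm
            have hney : m.arr 5 (pr (m.reg 20) i) ≠ y := by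
              intro h
              rw [h, hlast.2] at hi'
              omega
            simp [pr_inj, hip, hne, hney, hi']
        · have := hB.item b i (by simpa [h] using hi)
          simpa [h, pr_inj] using this
      · intro b x hx
        by_cases h : b = m.reg 20
        · subst h
          simp only [Function.update_self, hcy, Finset.mem_erase] at hx ⊢
          have hx' := hB.pos _ x hx.2
          by_cases hxy : x = y
          · have hpc : p ≠ c - 1 := by
              intro h
              rw [hxy] at hx
              apply hx.1
              rw [hy, ← h]
              exact hpos.2
            simp [pr_inj, hxy]
            omega
          · have hne : m.arr 6 (pr (m.reg 20) x) ≠ p := by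
              intro h
              rw [h, hpos.2] at hx'
              exact hx.1 hx'.2.symm
            have hne' : m.arr 6 (pr (m.reg 20) x) ≠ c - 1 := by
              intro h
              rw [h, ← hy] at hx'
              exact hxy hx'.2.symm
            simp [pr_inj, hxy, hne, hx']
            omega
        · have := hB.pos b x (by simpa [h] using hx)
          simpa [h, pr_inj] using this
    · intro b' i hb'
      simp [pr_inj, hb']

/-! ### The state of the algorithm -/

/-- A hierarchy of partitions of `X`: `anc x i` is the number of the class of `x` at level `i`, and
`h` is the number of clients which is worth a facility in the class. -/
structure Hier (X : Type) where
  L : ℕ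
  anc : X → ℕ → ℕ
  ids : Finset ℕ
  h : ℕ → ℝ
  anc_mem : ∀ x i, i ≤ L → anc x i ∈ ids
  anc_level : ∀ x y i j, i ≤ L → j ≤ L → anc x i = anc y j → i = j
  anc_succ : ∀ x y i, i < L → anc x i = anc y i → anc x (i + 1) = anc y (i + 1)
  anc_top : ∀ x y, anc x L = anc y L
  h_pos : ∀ x i, i ≤ L → 0 < h (anc x i)
  h_half : ∀ x i, i < L → 2 * h (anc x (i + 1)) ≤ h (anc x i)
  h_top : ∀ x, h (anc x L) ≤ 1

namespace Hier

variable {X : Type} (H : Hier X)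

theorem anc_mono {x y : X} {i j : ℕ} (hij : i ≤ j) (hj : j ≤ H.L) (h : H.anc x i = H.anc y i) :
    H.anc x j = H.anc y j := by
  induction j, hij using Nat.le_induction with
  | base => exact h
  | succ j _ ih => exact H.anc_succ x y j hj (ih (by omega))

end Hier

/-- Bag `2 * v` holds the residual clients of vertex `v`, bag `2 * v + 1` its marked children; `O`
is the set of owners, and `fk v` the first marked child of `v`. -/
structure St where
  B : ℕ → Finset ℕ
  O : Finset ℕ
  fk : ℕ → ℕ

namespace St

/-- The residual clients of a vertex. -/
abbrev R (s : St) (v : ℕ) : Finset ℕ := s.B (2 * v)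

/-- The marked children of a vertex. -/
abbrev K (s : St) (v : ℕ) : Finset ℕ := s.B (2 * v + 1)

/-- The vertices that have an owner below. -/
def Marked (s : St) (v : ℕ) : Prop := v ∈ s.O ∨ (s.K v).Nonempty

end St

/-- The potential of a vertex. -/
noncomputable def pot (o : Prop) [Decidable o] (r h : ℝ) : ℝ :=
  if o then 5 / 4 * max (h - r) 0 else max (min r h - h / 4) 0

theorem pot_nonneg (o : Prop) [Decidable o] (r h : ℝ) : 0 ≤ pot o r h := by
  unfold pot
  split_ifs <;> positivity

/-- The potential of a state. -/
noncomputable def St.pot {X : Type} (H : Hier X) (s : St) : ℝ :=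
  ∑ v ∈ H.ids, _root_.pot (v ∈ s.O) (s.R v).card (H.h v)

theorem St.pot_nonneg {X : Type} (H : Hier X) (s : St) : 0 ≤ s.pot H :=
  Finset.sum_nonneg fun _ _ => _root_.pot_nonneg _ _ _

/-- The residual clients of a vertex are right. -/
def ResidAt {X : Type} (H : Hier X) (P : Finset ℕ) (home : ℕ → X) (s : St) (x : X) (i : ℕ) : Prop :=
  ∀ j, j ∈ s.R (H.anc x i) ↔
    j ∈ P ∧ H.anc (home j) i = H.anc x i ∧ ∀ i' < i, ¬ s.Marked (H.anc (home j) i')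

/-- The marked children of a vertex are right. -/
def KidsAt {X : Type} (H : Hier X) (s : St) (x : X) (i : ℕ) : Prop :=
  ∀ w, w ∈ s.K (H.anc x i) ↔
    ∃ y i', i = i' + 1 ∧ w = H.anc y i' ∧ H.anc y i = H.anc x i ∧ s.Marked w

/-- Owners have enough residual clients, and others do not have too many. -/
def ThreshAt {X : Type} (H : Hier X) (s : St) (v : ℕ) : Prop :=
  (v ∈ s.O → H.h v / 4 ≤ (s.R v).card) ∧ (v ∉ s.O → ((s.R v).card : ℝ) < H.h v)

/-- The invariants of the algorithm between two requests. -/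
structure Consistent {X : Type} (H : Hier X) (P : Finset ℕ) (home : ℕ → X) (s : St) : Prop where
  resid : ∀ x, ∀ i ≤ H.L, ResidAt H P home s x i
  kids : ∀ x, ∀ i ≤ H.L, KidsAt H s x i
  thresh : ∀ x, ∀ i ≤ H.L, ThreshAt H s (H.anc x i)
  owner : ∀ v ∈ s.O, ∃ x, ∃ i ≤ H.L, v = H.anc x i

namespace Consistent

variable {X : Type} {H : Hier X} {P : Finset ℕ} {home : ℕ → X} {s : St}

theorem marked_succ (h : Consistent H P home s) {x : X} {i : ℕ} (hi : i < H.L)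
    (hm : s.Marked (H.anc x i)) : s.Marked (H.anc x (i + 1)) :=
  Or.inr ⟨_, (h.kids x (i + 1) hi _).2 ⟨x, i, rfl, rfl, rfl, hm⟩⟩

theorem marked_mono (h : Consistent H P home s) {x : X} {i j : ℕ} (hij : i ≤ j) (hj : j ≤ H.L)
    (hm : s.Marked (H.anc x i)) : s.Marked (H.anc x j) := by
  induction j, hij using Nat.le_induction with
  | base => exact hm
  | succ j _ ih => exact h.marked_succ hj (ih (by omega))

end Consistent

namespace St

/-- The new residual clients of `v` when those of its child `w` are known. -/
def newR (s : St) (j : ℕ) (ins om nm : Bool) (w v : ℕ) : Finset ℕ :=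
  if om = nm then (if om then s.R v else if ins then insert j (s.R v) else (s.R v).erase j)
  else if nm then s.R v \ (s.R w).erase j else s.R v ∪ s.R w

/-- The new marked children of `v`. -/
def newK (s : St) (om nm : Bool) (w v : ℕ) : Finset ℕ :=
  if om = nm then s.K v else if nm then insert w (s.K v) else (s.K v).erase w

/-- The new owners when `v` has `r` residual clients. -/
noncomputable def newO (s : St) (v : ℕ) (h r : ℝ) : Finset ℕ :=
  if v ∈ s.O then (if r < h / 4 then s.O.erase v else s.O)
  else if h ≤ r then insert v s.O else s.O

/-- One step of the first pass. -/
structure IsStep (s : St) (j : ℕ) (ins om nm : Bool) (w v : ℕ) (h : ℝ) (s' : St) : Prop where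
  R_self : s'.R v = s.newR j ins om nm w v
  K_self : s'.K v = s.newK om nm w v
  B_ne : ∀ u, u ≠ v → s'.R u = s.R u ∧ s'.K u = s.K u
  O : s'.O = s.newO v h (s.newR j ins om nm w v).card
  fk_ne : ∀ u, u ≠ v → s'.fk u = s.fk u
  fk_self : om = nm → s'.fk v = s.fk v

theorem mem_newO_of_ne {s : St} {u v : ℕ} {h r : ℝ} (hu : u ≠ v) :
    u ∈ s.newO v h r ↔ u ∈ s.O := by
  unfold newO
  split_ifs <;> simp [hu]

theorem mem_newO_self {s : St} {v : ℕ} {h r : ℝ} :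
    v ∈ s.newO v h r ↔ if v ∈ s.O then ¬ r < h / 4 else h ≤ r := by
  unfold newO
  split_ifs <;> simp_all

end St

/-- The status of a vertex has not been changed. -/
def Same (s₀ s : St) (v : ℕ) : Prop :=
  (v ∈ s.O ↔ v ∈ s₀.O) ∧ s.fk v = s₀.fk v ∧ (s.Marked v ↔ s₀.Marked v)

/-- The part of the potential that is set aside for later steps. -/
noncomputable def credit (om nm tog : Bool) (h : ℝ) : ℝ :=
  if om = nm then (if tog then h else 0) else if nm then 33 / 2 * h else 21 * h

/-- The number of loop rounds in a step. -/
def rounds (s : St) (om nm : Bool) (w : ℕ) : ℕ := if om = nm then 0 else (s.R w).card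

/-- Whether the assignment of the residual clients of a vertex has to be renewed; `o` and `o'` tell
whether the vertex was and is an owner. -/
def needs (o o' : Prop) [Decidable o] [Decidable o'] (tog : Bool) : Bool :=
  if o then decide (¬ o') else tog || decide o'

/-- The requested change of the set of clients. -/
def change (P : Finset ℕ) (j : ℕ) (ins : Bool) : Finset ℕ := if ins then insert j P else P.erase j

/-- The invariants of the first pass after the first `l` vertices of the path of `x₀`. `X` counts
loop rounds and the clients whose assignment has to be renewed. -/
structure PassInv {X : Type} (H : Hier X) (P : Finset ℕ) (home : ℕ → X) (s₀ : St) (x₀ : X)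
    (j : ℕ) (ins : Bool) (l : ℕ) (s : St) (om nm tog : Bool) (TG : ℕ → Bool) (X₁ : ℕ) : Prop where
  unch : ∀ v, (∀ i < l, v ≠ H.anc x₀ i) →
    s.R v = s₀.R v ∧ s.K v = s₀.K v ∧ (v ∈ s.O ↔ v ∈ s₀.O) ∧ s.fk v = s₀.fk v
  resid : ∀ x, ∀ i ≤ H.L, (H.anc x i = H.anc x₀ i → i < l) →
    ResidAt H (change P j ins) home s x i
  kids : ∀ x, ∀ i ≤ H.L, (H.anc x i = H.anc x₀ i → i < l) → KidsAt H s x i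
  thresh : ∀ x, ∀ i ≤ H.L, (H.anc x i = H.anc x₀ i → i < l) → ThreshAt H s (H.anc x i)
  owner : ∀ v ∈ s.O, ∃ x, ∃ i ≤ H.L, v = H.anc x i
  zero : l = 0 → om = false ∧ nm = false ∧ tog = false
  om_iff : ∀ i, l = i + 1 → (om = true ↔ s₀.Marked (H.anc x₀ i))
  nm_iff : ∀ i, l = i + 1 → (nm = true ↔ s.Marked (H.anc x₀ i))
  same : om = false → nm = false → tog = false ∧
    ∀ i, l = i + 1 → s.R (H.anc x₀ i) = change (s₀.R (H.anc x₀ i)) j ins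
  -- The `insert j` covers both ways to gain a mark. Either the vertex reached its worth with `j`
  -- among its residual clients, or the mark came from below, where `j` stayed, and the vertex
  -- itself has no residual clients.
  gain : om = false → nm = true → tog = true ∧ ins = true ∧
    ∀ i, l = i + 1 → (s.R (H.anc x₀ i)).erase j = s₀.R (H.anc x₀ i) ∧
      H.h (H.anc x₀ i) ≤ (insert j (s.R (H.anc x₀ i))).card ∧
      ((s.R (H.anc x₀ i)).card : ℝ) ≤ H.h (H.anc x₀ i) + 1
  loss : om = true → nm = false → tog = true
  -- An owner before and after the request serves its residual clients by its own facility, whatever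
  -- happened below it. Otherwise nothing on the path up to this vertex may have changed.
  clean : ∀ i < l, TG i = false → (H.anc x₀ i ∈ s.O ∧ H.anc x₀ i ∈ s₀.O) ∨
    ∀ i' ≤ i, Same s₀ s (H.anc x₀ i')
  quiet : tog = false → ∀ i < l, Same s₀ s (H.anc x₀ i)
  -- Work done and renewals ordered are paid by 24 times the drop of the potential and by 60 per
  -- vertex; the credit is held back for the ancestors.
  account : (X₁ : ℝ) + ∑ i ∈ Finset.range l, (if TG i then ((s.R (H.anc x₀ i)).card : ℝ) else 0) +
    24 * s.pot H + (if l = 0 then 0 else credit om nm tog (H.h (H.anc x₀ (l - 1)))) ≤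
      24 * s₀.pot H + 60 * l

/-! ### Potential inequalities at a single vertex -/

section Accounting

variable {h hw r r' : ℝ} {o o' : Prop} [Decidable o] [Decidable o']

/-- The potential in its linear pieces (see also `pot_off`), so that each accounting inequality
splits into finitely many cases of linear arithmetic. -/
theorem pot_on (ho : o) : (h ≤ r ∧ pot o r h = 0) ∨ (r < h ∧ pot o r h = 5 / 4 * (h - r)) := by
  rw [pot, if_pos ho]
  rcases le_or_gt h r with hr | hr
  · exact Or.inl ⟨hr, by rw [max_eq_right (by linarith)]; ring⟩
  · exact Or.inr ⟨hr, by rw [max_eq_left (by linarith)]⟩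

theorem pot_off (hh : 0 < h) (ho : ¬ o) : (r ≤ h / 4 ∧ pot o r h = 0) ∨
    (h / 4 < r ∧ r ≤ h ∧ pot o r h = r - h / 4) ∨ (h < r ∧ pot o r h = 3 / 4 * h) := by
  rw [pot, if_neg ho]
  rcases le_or_gt r (h / 4) with hr | hr
  · refine Or.inl ⟨hr, ?_⟩
    rw [min_eq_left (by linarith), max_eq_right (by linarith)]
  rcases le_or_gt r h with hr' | hr'
  · refine Or.inr (Or.inl ⟨hr, hr', ?_⟩)
    rw [min_eq_left hr', max_eq_left (by linarith)]
  · refine Or.inr (Or.inr ⟨hr', ?_⟩)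
    rw [min_eq_right hr'.le, max_eq_left (by linarith)]
    ring

/-- When a vertex is switched on, its potential drops from at least 3/4 h - 1 to 0. The 18 h
released cover the credit 33/2 h and the renewal of about h assignments; additive constants go into
the 60. -/
theorem account_insert (hh : 0 < h) (hr : 0 ≤ r) (hr' : r' = r + 1) (ho : o → h / 4 ≤ r)
    (hn : ¬ o → r < h) (ho' : o' ↔ if o then ¬ r' < h / 4 else h ≤ r') {cr : ℝ}
    (hcr : cr ≤ if o ↔ o' then 0 else 33 / 2 * h) :
    (if needs o o' false then r' else 0) + 24 * pot o' r' h + cr ≤ 24 * pot o r h + 60 := by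
  have a₁ := fun ho : o => pot_on (h := h) (r := r) ho
  have a₂ := fun ho : ¬ o => pot_off (r := r) hh ho
  have a₃ := fun ho : o' => pot_on (h := h) (r := r') ho
  have a₄ := fun ho : ¬ o' => pot_off (r := r') hh ho
  generalize pot o r h = p at a₁ a₂ ⊢
  generalize pot o' r' h = p' at a₃ a₄ ⊢
  by_cases o1 : o <;> by_cases o2 : o' <;>
    simp only [o1, o2, needs, if_true, if_false, true_iff, false_iff, not_true_eq_false,
      not_false_eq_true, true_imp_iff, false_imp_iff, not_lt, not_le, decide_true, decide_false,
      Bool.or_true, Bool.or_false, Bool.false_eq_true, iff_self, iff_false, iff_true, Bool.true_or] at ho hn ho' hcr a₁ a₂ a₃ a₄ ⊢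
  · rcases a₁ with e | e <;> rcases a₃ with e' | e' <;> linarith
  · rcases a₁ with e | e <;> rcases a₄ with e' | e' | e' <;> linarith
  · rcases a₂ with e | e | e <;> rcases a₃ with e' | e' <;> linarith
  · rcases a₂ with e | e | e <;> rcases a₄ with e' | e' | e' <;> linarith

/-- When an owner is switched off it has about h/4 clients and potential about 15/16 h. The 45/2 h
released cover the credit 21 h and the renewal of fewer than h/4 assignments. An owner that survives
gains at most 5/4 in potential, that is 30 ≤ 60. -/
theorem account_erase (hh : 0 < h) (hr : 1 ≤ r) (hr' : r' = r - 1) (ho : o → h / 4 ≤ r)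
    (hn : ¬ o → r < h) (ho' : o' ↔ if o then ¬ r' < h / 4 else h ≤ r') {cr : ℝ}
    (hcr : cr ≤ if o ↔ o' then 0 else 21 * h) :
    (if needs o o' false then r' else 0) + 24 * pot o' r' h + cr ≤ 24 * pot o r h + 60 := by
  have a₁ := fun ho : o => pot_on (h := h) (r := r) ho
  have a₂ := fun ho : ¬ o => pot_off (r := r) hh ho
  have a₃ := fun ho : o' => pot_on (h := h) (r := r') ho
  have a₄ := fun ho : ¬ o' => pot_off (r := r') hh ho
  generalize pot o r h = p at a₁ a₂ ⊢
  generalize pot o' r' h = p' at a₃ a₄ ⊢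
  by_cases o1 : o <;> by_cases o2 : o' <;>
    simp only [o1, o2, needs, if_true, if_false, true_iff, false_iff, not_true_eq_false,
      not_false_eq_true, true_imp_iff, false_imp_iff, not_lt, not_le, decide_true, decide_false,
      Bool.or_true, Bool.or_false, Bool.false_eq_true, iff_self, iff_false, iff_true, Bool.true_or] at ho hn ho' hcr a₁ a₂ a₃ a₄ ⊢
  · rcases a₁ with e | e <;> rcases a₃ with e' | e' <;> linarith
  · rcases a₁ with e | e <;> rcases a₄ with e' | e' | e' <;> linarith
  · rcases a₂ with e | e | e <;> rcases a₃ with e' | e' <;> linarith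
  · rcases a₂ with e | e | e <;> rcases a₄ with e' | e' | e' <;> linarith

/-- After paying for the q clients that leave the list, the credit still contains 31/2 hw ≥ 31 h. A
surviving owner needs at most 24 · 15/16 h for its potential and h for the new credit. A vertex that
was not an owner stays so; it needs at most h for renewals and 33/2 h for the credit. -/
theorem account_gain {q : ℝ} (hh : 0 < h) (hhw : 2 * h ≤ hw) (hr : 0 ≤ r') (hr' : r' ≤ r)
    (hq : q ≤ hw + 1) (ho : o → h / 4 ≤ r)
    (hn : ¬ o → r < h) (ho' : o' ↔ if o then ¬ r' < h / 4 else h ≤ r') {cr : ℝ}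
    (hcr : cr ≤ if o then h else 33 / 2 * h) :
    q + (if needs o o' true then r' else 0) + 24 * pot o' r' h + cr ≤
      24 * pot o r h + 60 + 33 / 2 * hw := by
  have a₁ := fun ho : o => pot_on (h := h) (r := r) ho
  have a₂ := fun ho : ¬ o => pot_off (r := r) hh ho
  have a₃ := fun ho : o' => pot_on (h := h) (r := r') ho
  have a₄ := fun ho : ¬ o' => pot_off (r := r') hh ho
  generalize pot o r h = p at a₁ a₂ ⊢
  generalize pot o' r' h = p' at a₃ a₄ ⊢
  by_cases o1 : o <;> by_cases o2 : o' <;>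
    simp only [o1, o2, needs, if_true, if_false, true_iff, false_iff, not_true_eq_false,
      not_false_eq_true, true_imp_iff, false_imp_iff, not_lt, not_le, decide_true, decide_false,
      Bool.or_true, Bool.or_false, Bool.false_eq_true, iff_self, iff_false, iff_true, Bool.true_or] at ho hn ho' hcr a₁ a₂ a₃ a₄ ⊢
  · rcases a₁ with e | e <;> rcases a₃ with e' | e' <;> linarith
  · rcases a₁ with e | e <;> rcases a₄ with e' | e' | e' <;> linarith
  · rcases a₂ with e | e | e <;> rcases a₃ with e' | e' <;> linarith
  · rcases a₂ with e | e | e <;> rcases a₄ with e' | e' | e' <;> linarith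

/-- The critical case is a vertex that stays off while its list grows from nothing to almost h: 18 h
of potential, h of renewals and 21 h of new credit. This is exactly the 2 · (21 - 1) h left of the
incoming credit, which is where 21 comes from. -/
theorem account_loss {q : ℝ} (hh : 0 < h) (hhw : 2 * h ≤ hw) (hr : 0 ≤ r) (hr' : r' = r + q)
    (hq0 : 0 ≤ q) (hq : q ≤ hw) (ho : o → h / 4 ≤ r)
    (hn : ¬ o → r < h) (ho' : o' ↔ if o then ¬ r' < h / 4 else h ≤ r') {cr : ℝ}
    (hcr : cr ≤ if o' then h else 21 * h) :
    q + (if needs o o' true then r' else 0) + 24 * pot o' r' h + cr ≤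
      24 * pot o r h + 60 + 21 * hw := by
  have a₁ := fun ho : o => pot_on (h := h) (r := r) ho
  have a₂ := fun ho : ¬ o => pot_off (r := r) hh ho
  have a₃ := fun ho : o' => pot_on (h := h) (r := r') ho
  have a₄ := fun ho : ¬ o' => pot_off (r := r') hh ho
  generalize pot o r h = p at a₁ a₂ ⊢
  generalize pot o' r' h = p' at a₃ a₄ ⊢
  by_cases o1 : o <;> by_cases o2 : o' <;>
    simp only [o1, o2, needs, if_true, if_false, true_iff, false_iff, not_true_eq_false,
      not_false_eq_true, true_imp_iff, false_imp_iff, not_lt, not_le, decide_true, decide_false,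
      Bool.or_true, Bool.or_false, Bool.false_eq_true, iff_self, iff_false, iff_true, Bool.true_or] at ho hn ho' hcr a₁ a₂ a₃ a₄ ⊢
  · rcases a₁ with e | e <;> rcases a₃ with e' | e' <;> linarith
  · rcases a₁ with e | e <;> rcases a₄ with e' | e' | e' <;> linarith
  · rcases a₂ with e | e | e <;> rcases a₃ with e' | e' <;> linarith
  · rcases a₂ with e | e | e <;> rcases a₄ with e' | e' | e' <;> linarith

/-- The incoming credit is at least 2 h: one h renews the list of a vertex that is not an owner, the
other h is passed on. -/
theorem account_same {tog : Bool} (hh : 0 < h) (hhw : 2 * h ≤ hw) (hr : 0 ≤ r) (ho : o → h / 4 ≤ r)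
    (hn : ¬ o → r < h) (ho' : o' ↔ if o then ¬ r < h / 4 else h ≤ r) {cr : ℝ}
    (hcr : cr ≤ if tog then h else 0) :
    (if needs o o' tog then r else 0) + 24 * pot o' r h + cr ≤
      24 * pot o r h + 60 + (if tog then hw else 0) := by
  have a₁ := fun ho : o => pot_on (h := h) (r := r) ho
  have a₂ := fun ho : ¬ o => pot_off (r := r) hh ho
  have a₃ := fun ho : o' => pot_on (h := h) (r := r) ho
  have a₄ := fun ho : ¬ o' => pot_off (r := r) hh ho
  generalize pot o r h = p at a₁ a₂ ⊢
  generalize pot o' r h = p' at a₃ a₄ ⊢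
  by_cases o1 : o <;> by_cases o2 : o' <;>
    simp only [o1, o2, needs, if_true, if_false, true_iff, false_iff, not_true_eq_false,
      not_false_eq_true, true_imp_iff, false_imp_iff, not_lt, not_le, decide_true, decide_false,
      Bool.or_true, Bool.or_false, Bool.false_eq_true, iff_self, iff_false, iff_true, Bool.true_or] at ho hn ho' hcr a₁ a₂ a₃ a₄ ⊢
  · rcases a₁ with e | e <;> rcases a₃ with e' | e' <;> (cases tog <;> simp only [if_true, if_false, Bool.false_eq_true] at hcr ⊢ <;> linarith)
  · rcases a₁ with e | e <;> rcases a₄ with e' | e' | e' <;> (cases tog <;> simp only [if_true, if_false, Bool.false_eq_true] at hcr ⊢ <;> linarith)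
  · rcases a₂ with e | e | e <;> rcases a₃ with e' | e' <;> (cases tog <;> simp only [if_true, if_false, Bool.false_eq_true] at hcr ⊢ <;> linarith)
  · rcases a₂ with e | e | e <;> rcases a₄ with e' | e' | e' <;> (cases tog <;> simp only [if_true, if_false, Bool.false_eq_true] at hcr ⊢ <;> linarith)

end Accounting

/-! ### Effect of one step of the first pass on residual clients, marks and potential -/

namespace PassInv

variable {X : Type} {H : Hier X} {P : Finset ℕ} {home : ℕ → X} {s₀ s s' : St} {x₀ : X}
  {j : ℕ} {ins : Bool} {l : ℕ} {om nm tog : Bool} {TG : ℕ → Bool} {X₁ w : ℕ}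

theorem path_ne (hl : l ≤ H.L) {x y : X} : ∀ i < l, H.anc x l ≠ H.anc y i :=
  fun i hi h => hi.ne' (H.anc_level x y l i hl (hi.le.trans hl) h)

theorem marked_iff_of_unch (hI : PassInv H P home s₀ x₀ j ins l s om nm tog TG X₁) {v : ℕ}
    (hv : ∀ i < l, v ≠ H.anc x₀ i) : s.Marked v ↔ s₀.Marked v := by
  obtain ⟨_, h₂, h₃, _⟩ := hI.unch v hv
  rw [St.Marked, St.Marked, h₂, h₃]

/-- Marks are inherited upwards, so an unmarked last vertex leaves no mark on the path below it. -/
theorem not_marked_below (hc : Consistent H P home s₀) (hl : l ≤ H.L)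
    (hI : PassInv H P home s₀ x₀ j ins l s om nm tog TG X₁) (hom : om = false) :
    ∀ i < l, ¬ s₀.Marked (H.anc x₀ i) := by
  intro i hi hm
  obtain ⟨k, rfl⟩ : ∃ k, l = k + 1 := ⟨l - 1, by omega⟩
  have := (hI.om_iff k rfl).2 (hc.marked_mono (Nat.lt_succ_iff.1 hi) (by omega) hm)
  simp [hom] at this

theorem notMem_of_insert (hc : Consistent H P home s₀) (hP : ins = true → j ∉ P)
    (hl : l ≤ H.L) (hI : PassInv H P home s₀ x₀ j ins l s om nm tog TG X₁) (hins : ins = true) :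
    j ∉ s.R (H.anc x₀ l) := by
  rw [(hI.unch _ (path_ne hl)).1, hc.resid x₀ l hl j]
  exact fun h => hP hins h.1

theorem mem_of_erase (hc : Consistent H P home s₀) (hj : home j = x₀) (hP : ins = false → j ∈ P)
    (hl : l ≤ H.L) (hI : PassInv H P home s₀ x₀ j ins l s om nm tog TG X₁) (hins : ins = false)
    (hom : om = false) : j ∈ s.R (H.anc x₀ l) := by
  rw [(hI.unch _ (path_ne hl)).1, hc.resid x₀ l hl j, hj]
  exact ⟨hP hins, rfl, not_marked_below hc hl hI hom⟩

/-- The conditions at consecutive levels differ only in whether the lower vertex is marked. So an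
unmarked vertex hands its whole list on, and a marked one hands on nothing. -/
theorem mem_R_succ (hc : Consistent H P home s₀) {i : ℕ} (hi : i < H.L) {x : X} {a : ℕ}
    (ha : H.anc (home a) i = H.anc x i) :
    a ∈ s₀.R (H.anc x (i + 1)) ↔ ¬ s₀.Marked (H.anc x i) ∧ a ∈ s₀.R (H.anc x i) := by
  rw [hc.resid x (i + 1) hi, hc.resid x i hi.le]
  have := H.anc_succ _ _ _ hi ha
  constructor
  · rintro ⟨h₁, h₂, h₃⟩
    exact ⟨ha ▸ h₃ i (Nat.lt_succ_self i), h₁, ha, fun i' hi' => h₃ i' (by omega)⟩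
  · rintro ⟨h₁, h₂, h₃, h₄⟩
    refine ⟨h₂, this, fun i' hi' => ?_⟩
    rcases Nat.lt_succ_iff_lt_or_eq.1 hi' with h | rfl
    · exact h₄ i' h
    · rwa [ha]

/-- What a gained mark means: all former clients of the child are to be removed. -/
theorem gain_subset (hc : Consistent H P home s₀) (hl : l ≤ H.L)
    (hI : PassInv H P home s₀ x₀ j ins l s om nm tog TG X₁)
    (hw : ∀ i, l = i + 1 → w = H.anc x₀ i) (hom : om = false) (hnm : nm = true) :
    (s.R w).erase j ⊆ s.R (H.anc x₀ l) ∧ w ∉ s.K (H.anc x₀ l) := by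
  obtain ⟨i, rfl⟩ : ∃ k, l = k + 1 := by
    rcases l with _ | k
    · simp [hnm] at hI
      have := hI.zero rfl
      simp at this
    · exact ⟨k, rfl⟩
  obtain rfl := hw i rfl
  have hnot := not_marked_below hc hl hI hom i (Nat.lt_succ_self i)
  obtain ⟨h₁, h₂, -, -⟩ := hI.unch _ (path_ne hl (y := x₀))
  rw [h₁, h₂, ((hI.gain hom hnm).2.2 i rfl).1]
  constructor
  · intro a ha
    have := (hc.resid x₀ i (by omega) a).1 ha
    exact (mem_R_succ hc hl this.2.1).2 ⟨hnot, ha⟩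
  · intro h
    obtain ⟨y, i', h₃, h₄, h₅, h₆⟩ := (hc.kids x₀ (i + 1) hl _).1 h
    exact hnot h₆

/-- While the child was marked it hid its clients from the parent, so all clients handed over when
the mark is lost are new there. -/
theorem loss_disjoint (hc : Consistent H P home s₀) (hl : l ≤ H.L)
    (hI : PassInv H P home s₀ x₀ j ins l s om nm tog TG X₁)
    (hw : ∀ i, l = i + 1 → w = H.anc x₀ i) (hom : om = true) :
    Disjoint (s.R (H.anc x₀ l)) (s.R w) ∧ w ∈ s.K (H.anc x₀ l) := by
  obtain ⟨i, rfl⟩ : ∃ k, l = k + 1 := by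
    rcases l with _ | k
    · have := hI.zero rfl
      simp [hom] at this
    · exact ⟨k, rfl⟩
  obtain rfl := hw i rfl
  have hm := (hI.om_iff i rfl).1 hom
  obtain ⟨h₁, h₂, -, -⟩ := hI.unch _ (path_ne hl (y := x₀))
  rw [h₁, h₂]
  constructor
  · rw [Finset.disjoint_left]
    intro a ha ha'
    have := (hI.resid x₀ i (by omega) (fun _ => Nat.lt_succ_self i) a).1 ha'
    exact ((mem_R_succ hc hl this.2.1).1 ha).1 hm
  · exact (hc.kids x₀ (i + 1) hl _).2 ⟨x₀, i, rfl, rfl, rfl, hm⟩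

/-- If the child has gained its mark and the vertex was unmarked, it had no clients before. -/
theorem gain_empty (hc : Consistent H P home s₀) (hl : l ≤ H.L)
    (hI : PassInv H P home s₀ x₀ j ins l s om nm tog TG X₁) (hom : om = false) (hnm : nm = true)
    (hv : ¬ s₀.Marked (H.anc x₀ l)) :
    s₀.R (H.anc x₀ l) = ∅ ∧ H.h (H.anc x₀ l) ≤ 1 := by
  obtain ⟨i, rfl⟩ : ∃ k, l = k + 1 := by
    rcases l with _ | k
    · have := hI.zero rfl
      simp [hnm] at this
    · exact ⟨k, rfl⟩
  obtain ⟨hsub, -⟩ := gain_subset hc hl hI (w := H.anc x₀ i) (fun k hk => by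
    obtain rfl : i = k := by omega
    rfl) hom hnm
  obtain ⟨-, -, h⟩ := hI.gain hom hnm
  obtain ⟨h₁, h₂, -⟩ := h i rfl
  have hlt := (hc.thresh x₀ (i + 1) hl).2 (fun h => hv (Or.inl h))
  have hhalf := H.h_half x₀ i hl
  have hcard := Finset.card_le_card hsub
  rw [(hI.unch _ (path_ne hl (y := x₀))).1] at hcard
  have hc' : (insert j (s.R (H.anc x₀ i))).card ≤ ((s.R (H.anc x₀ i)).erase j).card + 1 := by
    have : insert j (s.R (H.anc x₀ i)) = insert j ((s.R (H.anc x₀ i)).erase j) := by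
      ext a; by_cases h : a = j <;> simp [h]
    rw [this]
    exact Finset.card_insert_le _ _
  have h₃ : ((insert j (s.R (H.anc x₀ i))).card : ℝ) ≤ (s₀.R (H.anc x₀ (i + 1))).card + 1 := by
    exact_mod_cast hc'.trans (Nat.add_le_add_right hcard 1)
  -- If the vertex has c residual clients and is worth h while its child is worth hw, then c < h ≤
  -- hw / 2 ≤ (c + 1) / 2, hence c < 1.
  have h₄ : ((s₀.R (H.anc x₀ (i + 1))).card : ℝ) < 1 := by linarith
  have h₅ : (s₀.R (H.anc x₀ (i + 1))).card = 0 := by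
    have : (s₀.R (H.anc x₀ (i + 1))).card < 1 := by exact_mod_cast h₄
    omega
  refine ⟨Finset.card_eq_zero.1 h₅, ?_⟩
  rw [h₅] at h₃
  push_cast at h₃
  linarith

end PassInv

namespace PassInv

variable {X : Type} {H : Hier X} {P : Finset ℕ} {home : ℕ → X} {s₀ s s' : St} {x₀ : X}
  {j : ℕ} {ins : Bool} {l : ℕ} {om nm tog : Bool} {TG : ℕ → Bool} {X₁ w : ℕ}

theorem _root_.St.IsStep.marked_ne {v : ℕ} {h : ℝ} (hs : s.IsStep j ins om nm w v h s') {u : ℕ}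
    (hu : u ≠ v) : s'.Marked u ↔ s.Marked u := by
  rw [St.Marked, St.Marked, hs.O, St.mem_newO_of_ne hu, (hs.B_ne u hu).2]

theorem _root_.mem_change {Q : Finset ℕ} {a : ℕ} :
    a ∈ change Q j ins ↔ if ins then a = j ∨ a ∈ Q else a ≠ j ∧ a ∈ Q := by
  unfold change
  split_ifs <;> simp

theorem newR_eq_change (hom : om = false) (hnm : nm = false) (v : ℕ) :
    s.newR j ins om nm w v = change (s.R v) j ins := by
  simp [St.newR, change, hom, hnm]

/-- The new residual clients of the vertex that is being processed. -/
theorem resid_self (hc : Consistent H P home s₀) (hj : home j = x₀)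
    (hl : l ≤ H.L) (hI : PassInv H P home s₀ x₀ j ins l s om nm tog TG X₁)
    (hw : ∀ i, l = i + 1 → w = H.anc x₀ i) (a : ℕ) :
    a ∈ s.newR j ins om nm w (H.anc x₀ l) ↔ a ∈ change P j ins ∧
      H.anc (home a) l = H.anc x₀ l ∧ ∀ i' < l, ¬ s.Marked (H.anc (home a) i') := by
  obtain ⟨hR, -⟩ := hI.unch (H.anc x₀ l) (path_ne hl)
  have h0 := hc.resid x₀ l hl a
  rcases l with _ | i
  · obtain ⟨rfl, rfl, -⟩ := hI.zero rfl
    rw [newR_eq_change rfl rfl, hR, mem_change, mem_change, h0]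
    cases ins
    · simp
      tauto
    · simp
      constructor
      · rintro (rfl | h)
        · simp [hj]
        · tauto
      · tauto
  obtain rfl := hw i rfl
  -- For clients below the path child, the already corrected list of that child decides. Every other
  -- client only sees unchanged marks below the vertex.
  by_cases ha : H.anc (home a) i = H.anc x₀ i
  · have hR' := hI.resid x₀ i (by omega) (fun _ => Nat.lt_succ_self i) a
    have h0' := mem_R_succ hc hl ha
    have hmw := hI.nm_iff i rfl
    have hmw0 := hI.om_iff i rfl
    have key : (a ∈ change P j ins ∧ H.anc (home a) (i + 1) = H.anc x₀ (i + 1) ∧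
        ∀ i' < i + 1, ¬ s.Marked (H.anc (home a) i')) ↔
        nm = false ∧ a ∈ s.R (H.anc x₀ i) := by
      rw [hR', ← Bool.not_eq_true, hmw]
      have := H.anc_succ _ _ _ hl ha
      constructor
      · rintro ⟨h₁, h₂, h₃⟩
        exact ⟨ha ▸ h₃ i (Nat.lt_succ_self i), h₁, ha, fun i' hi' => h₃ i' (by omega)⟩
      · rintro ⟨h₁, h₂, h₃, h₄⟩
        refine ⟨h₂, this, fun i' hi' => ?_⟩
        rcases Nat.lt_succ_iff_lt_or_eq.1 hi' with h | rfl
        · exact h₄ i' h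
        · rwa [ha]
    rw [key]
    rw [← hmw0] at h0'
    cases hom : om <;> cases hnm : nm <;> simp only [hom, hnm] at *
    · rw [newR_eq_change rfl rfl, hR, ((hI.same rfl rfl).2 i rfl), mem_change, mem_change, h0']
      simp
    · have := ((hI.gain rfl rfl).2.2 i rfl).1
      simp [St.newR, hR, h0', ← this]
    · simp [St.newR, hR, h0']
    · simp [St.newR, hR, h0']
  · have hR' : a ∉ s.R (H.anc x₀ i) := fun h =>
      ha ((hI.resid x₀ i (by omega) (fun _ => Nat.lt_succ_self i) a).1 h).2.1
    have haj : a ≠ j := by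
      rintro rfl
      exact ha (by rw [hj])
    have hP : a ∈ change P j ins ↔ a ∈ P := by
      rw [mem_change]
      split_ifs <;> simp [haj]
    have hN : a ∈ s.newR j ins om nm (H.anc x₀ i) (H.anc x₀ (i + 1)) ↔
        a ∈ s₀.R (H.anc x₀ (i + 1)) := by
      unfold St.newR
      split_ifs <;> simp [haj, hR, hR']
    rw [hN, h0, hP]
    refine and_congr_right fun _ => and_congr_right fun h₂ => ?_
    refine forall_congr' fun i' => imp_congr_right fun hi' => not_congr ?_
    refine (hI.marked_iff_of_unch fun k hk hk' => ha ?_).symm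
    obtain rfl : i' = k := H.anc_level _ _ _ _ (by omega) (by omega) hk'
    exact H.anc_mono (by omega) (by omega) hk'

/-- The new marked children of the vertex that is being processed. -/
theorem kids_self (hc : Consistent H P home s₀)
    (hl : l ≤ H.L) (hI : PassInv H P home s₀ x₀ j ins l s om nm tog TG X₁)
    (hw : ∀ i, l = i + 1 → w = H.anc x₀ i) (u : ℕ) :
    u ∈ s.newK om nm w (H.anc x₀ l) ↔
      ∃ y i', l = i' + 1 ∧ u = H.anc y i' ∧ H.anc y l = H.anc x₀ l ∧ s.Marked u := by
  obtain ⟨-, hK, -⟩ := hI.unch (H.anc x₀ l) (path_ne hl)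
  have h0 := hc.kids x₀ l hl u
  rcases l with _ | i
  · obtain ⟨rfl, rfl, -⟩ := hI.zero rfl
    simp [St.newK, hK, h0]
  obtain rfl := hw i rfl
  have hmw := hI.nm_iff i rfl
  have hmw0 := hI.om_iff i rfl
  by_cases hu : u = H.anc x₀ i
  · subst hu
    have key : (∃ y i', i + 1 = i' + 1 ∧ H.anc x₀ i = H.anc y i' ∧
        H.anc y (i + 1) = H.anc x₀ (i + 1) ∧ s.Marked (H.anc x₀ i)) ↔ nm = true := by
      rw [hmw]
      exact ⟨fun ⟨_, _, _, _, _, h⟩ => h, fun h => ⟨x₀, i, rfl, rfl, rfl, h⟩⟩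
    have key0 : H.anc x₀ i ∈ s₀.K (H.anc x₀ (i + 1)) ↔ om = true := by
      rw [hmw0, h0]
      exact ⟨fun ⟨_, _, _, _, _, h⟩ => h, fun h => ⟨x₀, i, rfl, rfl, rfl, h⟩⟩
    rw [key]
    cases om <;> cases nm <;> simp [St.newK, hK, key0]
  · have hN : u ∈ s.newK om nm (H.anc x₀ i) (H.anc x₀ (i + 1)) ↔
        u ∈ s₀.K (H.anc x₀ (i + 1)) := by
      unfold St.newK
      split_ifs <;> simp [hu, hK]
    rw [hN, h0]
    refine exists_congr fun y => exists_congr fun i' => and_congr_right fun hi' =>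
      and_congr_right fun hu' => and_congr_right fun _ => ?_
    refine (hI.marked_iff_of_unch fun k hk hk' => hu ?_).symm
    obtain rfl : i' = k := H.anc_level _ _ _ _ (by omega) (by omega) (hu' ▸ hk')
    obtain rfl : i = i' := by omega
    exact hk'

/-- A vertex is not changed by a step before or after it. -/
theorem _root_.St.IsStep.same_ne {v : ℕ} {h : ℝ} (hs : s.IsStep j ins om nm w v h s') {u : ℕ}
    (hu : u ≠ v) : Same s₀ s' u ↔ Same s₀ s u := by
  rw [Same, Same, hs.O, St.mem_newO_of_ne hu, hs.fk_ne u hu, hs.marked_ne hu]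

theorem _root_.St.IsStep.pot_eq {h : ℝ} (hl : l ≤ H.L)
    (hs : s.IsStep j ins om nm w (H.anc x₀ l) h s') :
    s'.pot H + _root_.pot (H.anc x₀ l ∈ s.O) (s.R (H.anc x₀ l)).card (H.h (H.anc x₀ l)) =
      s.pot H + _root_.pot (H.anc x₀ l ∈ s'.O) (s'.R (H.anc x₀ l)).card (H.h (H.anc x₀ l)) := by
  unfold St.pot
  rw [← Finset.add_sum_erase _ _ (H.anc_mem x₀ l hl), ← Finset.add_sum_erase _ _ (H.anc_mem x₀ l hl)]
  have : ∑ v ∈ H.ids.erase (H.anc x₀ l), _root_.pot (v ∈ s'.O) (s'.R v).card (H.h v) =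
      ∑ v ∈ H.ids.erase (H.anc x₀ l), _root_.pot (v ∈ s.O) (s.R v).card (H.h v) := by
    refine Finset.sum_congr rfl fun v hv => ?_
    have hne := (Finset.mem_erase.1 hv).1
    rw [(hs.B_ne v hne).1]
    congr 1
    rw [hs.O, St.mem_newO_of_ne hne]
  rw [this]
  ring

/-- The accounting inequality for one step. -/
theorem account_step (hc : Consistent H P home s₀) (hj : home j = x₀) (hP : ins = true → j ∉ P)
    (hP' : ins = false → j ∈ P) (hl : l ≤ H.L)
    (hI : PassInv H P home s₀ x₀ j ins l s om nm tog TG X₁)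
    (hw : ∀ i, l = i + 1 → w = H.anc x₀ i)
    (hs : s.IsStep j ins om nm w (H.anc x₀ l) (H.h (H.anc x₀ l)) s') {om' nm' : Bool}
    (hom' : om' = true ↔ s.Marked (H.anc x₀ l)) (hnm' : nm' = true ↔ s'.Marked (H.anc x₀ l)) :
    (rounds s om nm w : ℝ) +
      (if needs (H.anc x₀ l ∈ s.O) (H.anc x₀ l ∈ s'.O) tog then ((s'.R (H.anc x₀ l)).card : ℝ)
        else 0) +
      24 * _root_.pot (H.anc x₀ l ∈ s'.O) (s'.R (H.anc x₀ l)).card (H.h (H.anc x₀ l)) +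
      credit om' nm' (tog || decide (¬ (H.anc x₀ l ∈ s.O ↔ H.anc x₀ l ∈ s'.O)))
        (H.h (H.anc x₀ l)) ≤
      24 * _root_.pot (H.anc x₀ l ∈ s.O) (s.R (H.anc x₀ l)).card (H.h (H.anc x₀ l)) + 60 +
      (if l = 0 then 0 else credit om nm tog (H.h (H.anc x₀ (l - 1)))) := by
  set v := H.anc x₀ l with hv
  set h := H.h v with hh
  have hpos : 0 < h := H.h_pos x₀ l hl
  obtain ⟨hR0, hK0, hO0, -⟩ := hI.unch v (path_ne hl (y := x₀))
  have hth := hc.thresh x₀ l hl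
  rw [← hv] at hth
  unfold ThreshAt at hth
  rw [← hR0, ← hO0, ← hh] at hth
  have hO' : v ∈ s'.O ↔ if v ∈ s.O then ¬ ((s'.R v).card : ℝ) < h / 4 else h ≤ (s'.R v).card := by
    rw [hs.O, St.mem_newO_self, hs.R_self]
  have hmk : v ∈ s.O → om' = true := fun ho => hom'.2 (Or.inl ho)
  have hmk' : v ∈ s'.O → nm' = true := fun ho => hnm'.2 (Or.inl ho)
  have hprev : l ≠ 0 → ∃ i, l = i + 1 ∧ w = H.anc x₀ i ∧ 2 * h ≤ H.h w := by
    intro hl0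
    obtain ⟨i, rfl⟩ : ∃ k, l = k + 1 := ⟨l - 1, by omega⟩
    obtain rfl := hw i rfl
    exact ⟨i, rfl, rfl, H.h_half x₀ i hl⟩
  have hRs := hs.R_self
  have hKs := hs.K_self
  cases hom : om <;> cases hnm : nm
  · -- an unmarked child stays unmarked
    subst hom hnm
    have htog : tog = false := (hI.same rfl rfl).1
    have hcr0 : (if l = 0 then 0 else credit false false tog (H.h (H.anc x₀ (l - 1)))) = 0 := by
      simp [credit, htog]
    rw [newR_eq_change rfl rfl] at hRs
    have hK : s'.K v = s.K v := hKs
    have hmm : (v ∈ s.O ↔ v ∈ s'.O) → om' = nm' := by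
      intro h
      rw [Bool.eq_iff_iff, hom', hnm', St.Marked, St.Marked, hK, h]
    have hcr : ∀ c, (v ∉ s.O → v ∈ s'.O → 33 / 2 * h ≤ c) → (v ∈ s.O → v ∉ s'.O → 21 * h ≤ c) →
        credit om' nm' (tog || decide (¬ (v ∈ s.O ↔ v ∈ s'.O))) h ≤
          if (v ∈ s.O ↔ v ∈ s'.O) then 0 else c := by
      intro c h₁ h₂
      split_ifs with hiff
      · simp [credit, htog, hmm hiff, hiff]
      · by_cases ho : v ∈ s.O
        · have ho' : v ∉ s'.O := fun h => hiff (by simp [ho, h])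
          have := h₂ ho ho'
          rw [hmk ho]
          unfold credit
          split_ifs <;> linarith
        · have ho' : v ∈ s'.O := by_contra fun h => hiff (by simp [ho, h])
          have := h₁ ho ho'
          rw [hmk' ho']
          simp only [credit, if_true]
          split_ifs <;> linarith
    rw [hcr0, htog, rounds, if_pos rfl, Nat.cast_zero, zero_add, add_zero]
    cases hins : ins
    · have hmem := mem_of_erase hc hj hP' hl hI hins rfl
      rw [← hv] at hmem
      have hcard : ((s'.R v).card : ℝ) = (s.R v).card - 1 := by
        rw [hRs, hins, change, if_neg (by simp), Finset.card_erase_of_mem hmem,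
          Nat.cast_sub (Finset.card_pos.2 ⟨j, hmem⟩), Nat.cast_one]
      refine account_erase hpos ?_ hcard hth.1 hth.2 hO' ?_
      · exact_mod_cast Finset.card_pos.2 ⟨j, hmem⟩
      · rw [← htog]
        refine hcr _ (fun ho ho' => ?_) (fun _ _ => le_rfl)
        rw [hO', if_neg ho] at ho'
        linarith [hth.2 ho]
    · have hmem := notMem_of_insert hc hP hl hI hins
      rw [← hv] at hmem
      have hcard : ((s'.R v).card : ℝ) = (s.R v).card + 1 := by
        rw [hRs, hins, change, if_pos rfl, Finset.card_insert_of_notMem hmem, Nat.cast_add,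
          Nat.cast_one]
      refine account_insert hpos (Nat.cast_nonneg _) hcard hth.1 hth.2 hO' ?_
      rw [← htog]
      refine hcr _ (fun _ _ => le_rfl) (fun ho ho' => ?_)
      rw [hO', if_pos ho, not_not] at ho'
      linarith [hth.1 ho]
  · -- the child has gained a mark
    subst hom hnm
    obtain ⟨htog, -, hg⟩ := hI.gain rfl rfl
    have hl0 : l ≠ 0 := fun h => by simpa using (hI.zero h).2.1
    obtain ⟨i, rfl, rfl, hhalf⟩ := hprev hl0
    have hcr0 : (if i + 1 = 0 then 0 else credit false true tog (H.h (H.anc x₀ (i + 1 - 1)))) =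
        33 / 2 * H.h (H.anc x₀ i) := by
      simp [credit]
    have hKne : (s'.K v).Nonempty := by
      rw [hKs]
      exact ⟨H.anc x₀ i, by simp [St.newK]⟩
    have hnm'' : nm' = true := hnm'.2 (Or.inr hKne)
    rw [hcr0, htog, rounds, if_neg (by simp)]
    refine account_gain hpos hhalf (Nat.cast_nonneg _) ?_ (hg i rfl).2.2 hth.1 hth.2 hO' ?_
    · rw [hRs]
      exact_mod_cast Finset.card_le_card (by simp [St.newR])
    · rw [hnm'']
      split_ifs with ho
      · rw [hmk ho]
        simp [credit]
      · unfold credit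
        split_ifs <;> simp_all <;> linarith
  · -- the child has lost its mark
    subst hom hnm
    have htog := hI.loss rfl rfl
    have hl0 : l ≠ 0 := fun h => by simpa using (hI.zero h).1
    obtain ⟨i, rfl, rfl, hhalf⟩ := hprev hl0
    have hcr0 : (if i + 1 = 0 then 0 else credit true false tog (H.h (H.anc x₀ (i + 1 - 1)))) =
        21 * H.h (H.anc x₀ i) := by
      simp [credit]
    have hd := loss_disjoint hc hl hI hw rfl
    rw [← hv] at hd
    have hom'' : om' = true := hom'.2 (Or.inr ⟨_, hd.2⟩)
    have hoff : H.anc x₀ i ∉ s.O := fun ho => by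
      simpa using (hI.nm_iff i rfl).2 (Or.inl ho)
    have hRw := (hI.thresh x₀ i (by omega) (fun _ => Nat.lt_succ_self i)).2 hoff
    rw [hcr0, htog, rounds, if_neg (by simp)]
    refine account_loss hpos hhalf (Nat.cast_nonneg _) ?_ (Nat.cast_nonneg _) hRw.le hth.1 hth.2
      hO' ?_
    · rw [hRs]
      simp only [St.newR]
      simp only [Bool.true_eq_false, if_false, Bool.false_eq_true]
      rw [Finset.card_union_of_disjoint hd.1, Nat.cast_add]
    · rw [hom'']
      split_ifs with ho
      · rw [hmk' ho]
        simp [credit]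
      · unfold credit
        split_ifs <;> simp_all
  · -- a marked child stays marked
    subst hom hnm
    have hl0 : l ≠ 0 := fun h => by simpa using (hI.zero h).1
    obtain ⟨i, rfl, rfl, hhalf⟩ := hprev hl0
    have hcr0 : (if i + 1 = 0 then 0 else credit true true tog (H.h (H.anc x₀ (i + 1 - 1)))) =
        if tog then H.h (H.anc x₀ i) else 0 := by
      simp [credit]
    have hd := loss_disjoint hc hl hI hw rfl
    rw [← hv] at hd
    have hom'' : om' = true := hom'.2 (Or.inr ⟨_, hd.2⟩)
    have hK : s'.K v = s.K v := hKs
    have hnm'' : nm' = true := hnm'.2 (Or.inr ⟨_, hK ▸ hd.2⟩)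
    have hR : s'.R v = s.R v := hRs
    rw [hR] at hO' ⊢
    -- The list is unchanged and respected the thresholds before the request, so the vertex cannot
    -- switch.
    have hiff : v ∈ s.O ↔ v ∈ s'.O := by
      rw [hO']
      by_cases ho : v ∈ s.O
      · simp only [ho, if_true, true_iff, not_lt]
        exact hth.1 ho
      · simp only [ho, if_false, false_iff, not_le]
        exact hth.2 ho
    rw [hcr0, rounds, if_pos rfl, Nat.cast_zero, zero_add]
    refine account_same hpos hhalf (Nat.cast_nonneg _) hth.1 hth.2 hO' ?_
    rw [hom'', hnm'']
    simp [credit, hiff]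

/-- The invariants are preserved by a step. -/
theorem step (hc : Consistent H P home s₀) (hj : home j = x₀) (hP : ins = true → j ∉ P)
    (hP' : ins = false → j ∈ P) (hl : l ≤ H.L)
    (hI : PassInv H P home s₀ x₀ j ins l s om nm tog TG X₁)
    (hw : ∀ i, l = i + 1 → w = H.anc x₀ i)
    (hs : s.IsStep j ins om nm w (H.anc x₀ l) (H.h (H.anc x₀ l)) s') {om' nm' tog' : Bool}
    {TG' : ℕ → Bool}
    (hom' : om' = true ↔ s.Marked (H.anc x₀ l)) (hnm' : nm' = true ↔ s'.Marked (H.anc x₀ l))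
    (htog' : tog' = (tog || decide (¬ (H.anc x₀ l ∈ s.O ↔ H.anc x₀ l ∈ s'.O))))
    (hTG : ∀ i < l, TG' i = TG i)
    (hTG' : TG' l = needs (H.anc x₀ l ∈ s.O) (H.anc x₀ l ∈ s'.O) tog) :
    PassInv H P home s₀ x₀ j ins (l + 1) s' om' nm' tog' TG' (X₁ + rounds s om nm w) := by
  have hacc := account_step hc hj hP hP' hl hI hw hs hom' hnm'
  have hpot := hs.pot_eq hl
  have hres := resid_self hc hj hl hI hw
  have hkid := kids_self hc hl hI hw
  set v := H.anc x₀ l with hv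
  set h := H.h v with hh
  obtain ⟨hR0, hK0, hO0, hf0⟩ := hI.unch v (path_ne hl (y := x₀))
  have hM0 : s.Marked v ↔ s₀.Marked v := hI.marked_iff_of_unch (path_ne hl)
  have hth := hc.thresh x₀ l hl
  rw [← hv] at hth
  unfold ThreshAt at hth
  rw [← hR0, ← hO0, ← hh] at hth
  have hO' : v ∈ s'.O ↔ if v ∈ s.O then ¬ ((s'.R v).card : ℝ) < h / 4 else h ≤ (s'.R v).card := by
    rw [hs.O, St.mem_newO_self, hs.R_self]
  have hdom : ∀ {x i}, i ≤ H.L → (H.anc x i = H.anc x₀ i → i < l + 1) → H.anc x i ≠ v →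
      (H.anc x i = H.anc x₀ i → i < l) := by
    intro x i hi h₁ h₂ h₃
    have h₄ : i ≠ l := by
      rintro rfl
      exact h₂ h₃
    have := h₁ h₃
    omega
  have hlev : ∀ {x i}, i ≤ H.L → H.anc x i = v → i = l := fun hi h =>
    H.anc_level _ _ _ _ hi hl h
  have hK' : om = nm → s'.K v = s.K v := by
    intro h
    rw [hs.K_self, St.newK, if_pos h]
  have hmm : (v ∈ s.O ↔ v ∈ s'.O) → om = nm → om' = nm' := by
    intro h₁ h₂
    rw [Bool.eq_iff_iff, hom', hnm', St.Marked, St.Marked, hK' h₂, h₁]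
  -- A mark changes only if an owner at or below the vertex has been switched.
  have htog_ne : om ≠ nm → tog = true := by
    intro h
    cases hom : om <;> cases hnm : nm <;> simp only [hom, hnm] at h
    · exact absurd rfl h
    · exact (hI.gain hom hnm).1
    · exact hI.loss hom hnm
    · exact absurd rfl h
  have hom_of : om' = false → om = false := by
    intro h
    by_contra hn
    have hd := loss_disjoint hc hl hI hw (by simpa using hn)
    have := hom'.2 (Or.inr ⟨_, hd.2⟩)
    simp [h] at this
  have hnotO : om' = false → v ∉ s.O := fun h ho => by simpa [h] using hom'.2 (Or.inl ho)
  have hnotO' : nm' = false → v ∉ s'.O := fun h ho => by simpa [h] using hnm'.2 (Or.inl ho)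
  have hsame_self : (v ∈ s.O ↔ v ∈ s'.O) → om = nm → Same s₀ s' v := by
    intro h₁ h₂
    refine ⟨h₁.symm.trans hO0, (hs.fk_self h₂).trans hf0, ?_⟩
    rw [← hM0, ← hom', ← hnm', hmm h₁ h₂]
  have hquiet : tog' = false → ∀ i < l + 1, Same s₀ s' (H.anc x₀ i) := by
    intro ht i hi
    rw [htog'] at ht
    simp only [Bool.or_eq_false_iff, decide_eq_false_iff_not, not_not] at ht
    rcases Nat.lt_succ_iff_lt_or_eq.1 hi with h | rfl
    · exact (hs.same_ne (path_ne hl i h).symm).2 (hI.quiet ht.1 i h)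
    · exact hsame_self ht.2 (by_contra fun hn => by simp [htog_ne hn] at ht)
  constructor
  case unch =>
    intro u hu
    have hne : u ≠ v := hu l (Nat.lt_succ_self l)
    obtain ⟨h₁, h₂, h₃, h₄⟩ := hI.unch u fun i hi => hu i (by omega)
    refine ⟨(hs.B_ne u hne).1.trans h₁, (hs.B_ne u hne).2.trans h₂, ?_, (hs.fk_ne u hne).trans h₄⟩
    rw [hs.O, St.mem_newO_of_ne hne, h₃]
  case resid =>
    intro x i hi hd a
    by_cases hx : H.anc x i = v
    · obtain rfl := hlev hi hx
      rw [hx, hs.R_self, hres]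
      refine and_congr_right fun _ => and_congr_right fun _ => ?_
      refine forall_congr' fun i' => imp_congr_right fun hi' => not_congr ?_
      exact (hs.marked_ne (path_ne hi i' hi').symm).symm
    · rw [(hs.B_ne _ hx).1, hI.resid x i hi (hdom hi hd hx) a]
      refine and_congr_right fun _ => and_congr_right fun h₂ => ?_
      refine forall_congr' fun i' => imp_congr_right fun hi' => not_congr ?_
      refine (hs.marked_ne fun hne => ?_).symm
      obtain rfl := hlev (by omega) hne
      have := hd (h₂.symm.trans (H.anc_mono hi'.le hi hne))
      omega
  case kids =>
    intro x i hi hd u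
    by_cases hx : H.anc x i = v
    · obtain rfl := hlev hi hx
      rw [hx, hs.K_self, hkid]
      refine exists_congr fun y => exists_congr fun i' => and_congr_right fun hi' =>
        and_congr_right fun hu' => and_congr_right fun _ => ?_
      rw [hs.marked_ne]
      rw [hu']
      exact (path_ne hi i' (by omega)).symm
    · rw [(hs.B_ne _ hx).2, hI.kids x i hi (hdom hi hd hx) u]
      refine exists_congr fun y => exists_congr fun i' => and_congr_right fun hi' =>
        and_congr_right fun hu' => and_congr_right fun h₃ => ?_
      refine (hs.marked_ne fun hne => ?_).symm
      subst hi'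
      rw [hu'] at hne
      obtain rfl := hlev (by omega) hne
      have := hd (h₃.symm.trans (H.anc_succ _ _ _ (by omega) hne))
      omega
  case thresh =>
    intro x i hi hd
    by_cases hx : H.anc x i = v
    · rw [hx]
      constructor
      · intro ho
        rw [hO'] at ho
        split_ifs at ho
        · exact not_lt.1 ho
        · linarith [H.h_pos x₀ l hl]
      · intro ho
        rw [hO'] at ho
        split_ifs at ho
        · linarith [not_not.1 ho, H.h_pos x₀ l hl]
        · exact not_le.1 ho
    · have := hI.thresh x i hi (hdom hi hd hx)
      unfold ThreshAt at this ⊢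
      rwa [(hs.B_ne _ hx).1, hs.O, St.mem_newO_of_ne hx]
  case owner =>
    intro u hu
    by_cases hne : u = v
    · exact ⟨x₀, l, hl, hne⟩
    · rw [hs.O, St.mem_newO_of_ne hne] at hu
      exact hI.owner u hu
  case zero => simp
  case om_iff =>
    intro i hi
    obtain rfl : l = i := by omega
    rw [hom', hM0]
  case nm_iff =>
    intro i hi
    obtain rfl : l = i := by omega
    exact hnm'
  case same =>
    intro h₁ h₂
    have hom := hom_of h₁
    have ho := hnotO h₁
    have ho' := hnotO' h₂
    have hnm : nm = false := by
      by_contra hn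
      have hn : nm = true := by simpa using hn
      have : (s'.K v).Nonempty := by
        rw [hs.K_self]
        exact ⟨w, by simp [St.newK, hom, hn]⟩
      simpa [h₂] using hnm'.2 (Or.inr this)
    refine ⟨by simp [htog', (hI.same hom hnm).1, ho, ho'], fun i hi => ?_⟩
    obtain rfl : l = i := by omega
    rw [← hv, hs.R_self, newR_eq_change hom hnm, hR0]
  case gain =>
    intro h₁ h₂
    have hom := hom_of h₁
    have ho := hnotO h₁
    -- Either the vertex switches on by itself, which only an arrival can cause, or the mark comes
    -- from its child. In the second case `gain_empty` shows that its list is empty and its worth at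
    -- most 1.
    cases hnm : nm
    · have ho' : v ∈ s'.O := by
        rcases hnm'.1 h₂ with ho' | hk
        · exact ho'
        · rw [hK' (hom.trans hnm.symm)] at hk
          simpa [h₁] using hom'.2 (Or.inr hk)
      have hRs := hs.R_self
      rw [newR_eq_change hom hnm] at hRs
      have hins : ins = true := by
        by_contra hn
        rw [hO', if_neg ho, hRs, change, if_neg hn] at ho'
        have : (((s.R v).erase j).card : ℝ) ≤ (s.R v).card := by
          exact_mod_cast Finset.card_le_card (Finset.erase_subset _ _)
        linarith [hth.2 ho]
      have hmem := notMem_of_insert hc hP hl hI hins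
      refine ⟨by simp [htog', ho, ho'], hins, fun i hi => ?_⟩
      obtain rfl : l = i := by omega
      rw [hO', if_neg ho] at ho'
      rw [← hv, ← hh, hRs, change, if_pos hins]
      rw [hRs, change, if_pos hins] at ho'
      refine ⟨by rw [Finset.erase_insert hmem, hR0], by simpa using ho', ?_⟩
      rw [Finset.card_insert_of_notMem hmem]
      push_cast
      linarith [hth.2 ho]
    · obtain ⟨ht, hins, -⟩ := hI.gain hom hnm
      have hM : ¬ s₀.Marked v := by rw [← hM0, ← hom', h₁]; simp
      obtain ⟨he, hle⟩ := gain_empty hc hl hI hom hnm hM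
      refine ⟨by simp [htog', ht], hins, fun i hi => ?_⟩
      obtain rfl : l = i := by omega
      have hRv : s.R v = ∅ := hR0.trans he
      have hR' : s'.R v = ∅ := by
        rw [hs.R_self]
        simp [St.newR, hom, hnm, hRv]
      rw [← hv, hR', hv, he]
      refine ⟨by simp, by simpa using hle, ?_⟩
      simp only [Finset.card_empty, Nat.cast_zero]
      linarith [H.h_pos x₀ l hl]
  case loss =>
    intro h₁ h₂
    by_cases hon : om = nm
    · by_cases ho : v ∈ s.O ↔ v ∈ s'.O
      · have := hmm ho hon
        simp [h₁, h₂] at this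
      · simp [htog', ho]
    · simp [htog', htog_ne hon]
  case clean =>
    intro i hi ht
    rcases Nat.lt_succ_iff_lt_or_eq.1 hi with h | rfl
    · rw [hTG i h] at ht
      rcases hI.clean i h ht with h₁ | h₁
      · left
        rwa [hs.O, St.mem_newO_of_ne (path_ne hl i h).symm]
      · right
        intro i' hi'
        exact (hs.same_ne (path_ne hl i' (by omega)).symm).2 (h₁ i' hi')
    · rw [hTG'] at ht
      unfold needs at ht
      split_ifs at ht with ho
      · left
        exact ⟨by simpa using ht, hO0.1 ho⟩
      · right
        simp only [Bool.or_eq_false_iff, decide_eq_false_iff_not] at ht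
        intro i' hi'
        exact hquiet (by simp [htog', ht, ho]) i' (by omega)
  case quiet => exact hquiet
  case account =>
    have hsum : ∑ i ∈ Finset.range l, (if TG' i then ((s'.R (H.anc x₀ i)).card : ℝ) else 0) =
        ∑ i ∈ Finset.range l, (if TG i then ((s.R (H.anc x₀ i)).card : ℝ) else 0) := by
      refine Finset.sum_congr rfl fun i hi => ?_
      have hi := Finset.mem_range.1 hi
      rw [hTG i hi, (hs.B_ne _ (path_ne hl i hi).symm).1]
    have := hI.account
    rw [Finset.sum_range_succ, hsum, hTG', htog', if_neg (Nat.succ_ne_zero l), Nat.add_sub_cancel]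
    push_cast
    linarith

end PassInv

/-! ### Which facility serves a client, and when this stays the same -/

/-- The facility that serves the residual clients of a marked vertex `v` of level `i`. -/
def rep (fac : ℕ → ℕ) (s : St) : ℕ → ℕ → ℕ
  | 0, v => fac v
  | i + 1, v => if v ∈ s.O then fac v else rep fac s i (s.fk v)

theorem rep_of_mem {fac : ℕ → ℕ} {s : St} {v : ℕ} (h : v ∈ s.O) (i : ℕ) :
    rep fac s i v = fac v := by
  cases i with
  | zero => rfl
  | succ i => rw [rep, if_pos h]

/-- The facility `y` is the one that serves clients at `x`. -/
def Serves {X : Type} (H : Hier X) (fac : ℕ → ℕ) (s : St) (x : X) (y : ℕ) : Prop :=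
  ∃ i ≤ H.L, s.Marked (H.anc x i) ∧ (∀ i' < i, ¬ s.Marked (H.anc x i')) ∧
    y = rep fac s i (H.anc x i)

/-- `fk` points to marked children. -/
def FirstKid (s : St) : Prop := ∀ v, (s.K v).Nonempty → s.fk v ∈ s.K v

namespace Consistent

variable {X : Type} {H : Hier X} {P : Finset ℕ} {home : ℕ → X} {s : St}

/-- The top is worth at most one client. If it were unmarked, any present client would be residual
there and would violate the threshold. -/
theorem marked_top (h : Consistent H P home s) {a : ℕ} (ha : a ∈ P) (x : X) :
    s.Marked (H.anc x H.L) := by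
  by_contra hn
  rw [H.anc_top x (home a)] at hn
  have hmem : a ∈ s.R (H.anc (home a) H.L) :=
    (h.resid _ _ le_rfl a).2 ⟨ha, rfl, fun i hi hm => hn (h.marked_mono hi.le le_rfl hm)⟩
  have h₁ := (h.thresh (home a) H.L le_rfl).2 fun ho => hn (Or.inl ho)
  have h₂ : (1 : ℝ) ≤ (s.R (H.anc (home a) H.L)).card := by
    exact_mod_cast Finset.card_pos.2 ⟨a, hmem⟩
  linarith [H.h_top (home a)]

theorem exists_low (h : Consistent H P home s) (hP : P.Nonempty) (x : X) :
    ∃ i ≤ H.L, s.Marked (H.anc x i) ∧ ∀ i' < i, ¬ s.Marked (H.anc x i') := by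
  classical
  obtain ⟨a, ha⟩ := hP
  have hex : ∃ i, s.Marked (H.anc x i) := ⟨H.L, h.marked_top ha x⟩
  exact ⟨Nat.find hex, Nat.find_min' hex (h.marked_top ha x), Nat.find_spec hex,
    fun i' hi' => Nat.find_min hex hi'⟩

/-- A marked vertex that is not an owner has a marked child, and there are no children below level
0; so the descent ends at an owner. By `anc_succ` that owner lies below the starting vertex. -/
theorem rep_owner (h : Consistent H P home s) (hf : FirstKid s) (fac : ℕ → ℕ) :
    ∀ i (x : X), i ≤ H.L → s.Marked (H.anc x i) → ∃ y, ∃ i' ≤ i, H.anc y i = H.anc x i ∧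
      H.anc y i' ∈ s.O ∧ rep fac s i (H.anc x i) = fac (H.anc y i') := by
  intro i
  induction i with
  | zero =>
    rintro x hi (ho | ⟨w, hw⟩)
    · exact ⟨x, 0, le_rfl, rfl, ho, rfl⟩
    · obtain ⟨y, i', h₁, -⟩ := (h.kids x 0 hi w).1 hw
      omega
  | succ i ih =>
    intro x hi hm
    by_cases ho : H.anc x (i + 1) ∈ s.O
    · exact ⟨x, i + 1, le_rfl, rfl, ho, by rw [rep, if_pos ho]⟩
    · have hk := hf _ (hm.resolve_left ho)
      obtain ⟨y, i', h₁, h₂, h₃, h₄⟩ := (h.kids x (i + 1) hi _).1 hk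
      obtain rfl : i = i' := by omega
      rw [h₂] at h₄
      obtain ⟨z, i', h₅, h₆, h₇, h₈⟩ := ih y (by omega) h₄
      refine ⟨z, i', by omega, (H.anc_succ _ _ _ hi h₆).trans h₃, h₇, ?_⟩
      rw [rep, if_neg ho, h₂, h₈]

end Consistent

namespace PassInv

variable {X : Type} {H : Hier X} {P : Finset ℕ} {home : ℕ → X} {s₀ s : St} {x₀ : X}
  {j : ℕ} {ins : Bool} {om nm tog : Bool} {TG : ℕ → Bool} {X₁ : ℕ}

theorem start (hc : Consistent H P home s) (hj : home j = x₀) :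
    PassInv H P home s x₀ j ins 0 s false false false TG 0 where
  unch _ _ := ⟨rfl, rfl, Iff.rfl, rfl⟩
  resid x i hi h := by
    have hne : H.anc x i ≠ H.anc x₀ i := fun he => absurd (h he) (Nat.not_lt_zero i)
    intro a
    rw [hc.resid x i hi a, mem_change]
    by_cases ha : a = j
    · subst ha
      rw [hj]
      exact ⟨fun h => absurd h.2.1.symm hne, fun h => absurd h.2.1.symm hne⟩
    · split_ifs <;> simp [ha]
  kids x i hi _ := hc.kids x i hi
  thresh x i hi _ := hc.thresh x i hi
  owner := hc.owner
  zero _ := ⟨rfl, rfl, rfl⟩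
  om_iff i h := by simp at h
  nm_iff i h := by simp at h
  same _ _ := ⟨rfl, fun i h => by simp at h⟩
  gain _ h := by simp at h
  loss h := by simp at h
  clean i h := by simp at h
  quiet _ i h := by simp at h
  account := by simp

theorem finish (hI : PassInv H P home s₀ x₀ j ins (H.L + 1) s om nm tog TG X₁) :
    Consistent H (change P j ins) home s where
  resid x i hi := hI.resid x i hi fun _ => Nat.lt_succ_of_le hi
  kids x i hi := hI.kids x i hi fun _ => Nat.lt_succ_of_le hi
  thresh x i hi := hI.thresh x i hi fun _ => Nat.lt_succ_of_le hi
  owner := hI.owner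

/-- The credit left after the top vertex is nonnegative and can be dropped. -/
theorem pot_le (hI : PassInv H P home s₀ x₀ j ins (H.L + 1) s om nm tog TG X₁) :
    (X₁ : ℝ) + ∑ i ∈ Finset.range (H.L + 1), (if TG i then ((s.R (H.anc x₀ i)).card : ℝ) else 0) +
      24 * s.pot H ≤ 24 * s₀.pot H + 60 * (H.L + 1) := by
  have h := hI.account
  rw [if_neg (Nat.succ_ne_zero _), Nat.add_sub_cancel] at h
  have hpos := H.h_pos x₀ H.L le_rfl
  have : 0 ≤ credit om nm tog (H.h (H.anc x₀ H.L)) := by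
    unfold credit
    split_ifs <;> linarith
  push_cast at h
  linarith

/-- The descent only consults the owner status and the first marked children of vertices below the
starting point. -/
theorem rep_eq (hc : Consistent H P home s) (hf : FirstKid s) {fac : ℕ → ℕ} :
    ∀ i (x : X), i ≤ H.L → s.Marked (H.anc x i) →
      (∀ y, ∀ i' ≤ i, H.anc y i = H.anc x i → Same s₀ s (H.anc y i')) →
      rep fac s i (H.anc x i) = rep fac s₀ i (H.anc x i) := by
  intro i
  induction i with
  | zero => intros; rfl
  | succ i ih =>
    intro x hi hm hs
    obtain ⟨hO, hk, -⟩ := hs x (i + 1) le_rfl rfl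
    by_cases ho : H.anc x (i + 1) ∈ s.O
    · rw [rep, rep, if_pos ho, if_pos (hO.1 ho)]
    · rw [rep, rep, if_neg ho, if_neg (mt hO.2 ho), ← hk]
      obtain ⟨y, i', h₁, h₂, h₃, h₄⟩ := (hc.kids x (i + 1) hi _).1 (hf _ (hm.resolve_left ho))
      obtain rfl : i = i' := by omega
      rw [h₂]
      rw [h₂] at h₄
      exact ih y (by omega) h₄ fun z i' hi' hz =>
        hs z i' (by omega) ((H.anc_succ _ _ _ hi hz).trans h₃)

/-- Clients whose assignment is not renewed are still served by their facility. -/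
theorem serves (hc₀ : Consistent H P home s₀)
    (hI : PassInv H P home s₀ x₀ j ins (H.L + 1) s om nm tog TG X₁) (hf : FirstKid s)
    {fac : ℕ → ℕ} {a y : ℕ} (ha : a ∈ P) (ha' : a ∈ change P j ins)
    (hy : Serves H fac s₀ (home a) y)
    (hTG : ∀ i ≤ H.L, TG i = true → a ∉ s.R (H.anc x₀ i)) : Serves H fac s (home a) y := by
  have hc := hI.finish
  obtain ⟨i, hi, hm₀, hn₀, rfl⟩ := hy
  obtain ⟨i', hi', hm, hn⟩ := hc.exists_low ⟨a, ha'⟩ (home a)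
  -- The client is residual at every vertex of its path up to the lowest marked one. Since it is not
  -- renewed, those of these vertices that lie on the changed path carry no flag `TG`.
  have hR : ∀ k ≤ i', a ∈ s.R (H.anc (home a) k) := fun k hk =>
    (hc.resid _ k (by omega) a).2 ⟨ha', rfl, fun k' hk' => hn k' (by omega)⟩
  have hoff : ∀ {z : X} {k : ℕ}, k ≤ H.L → H.anc z k ≠ H.anc x₀ k → Same s₀ s (H.anc z k) := by
    intro z k hk hne
    have hu : ∀ i < H.L + 1, H.anc z k ≠ H.anc x₀ i := by
      intro i hi he
      obtain rfl := H.anc_level _ _ _ _ hk (by omega) he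
      exact hne he
    obtain ⟨-, -, h₃, h₄⟩ := hI.unch _ hu
    exact ⟨h₃, h₄, hI.marked_iff_of_unch hu⟩
  -- on the path, clients of a vertex which is clean keep the status of the vertex
  have hmark : ∀ k ≤ i', s.Marked (H.anc (home a) k) ↔ s₀.Marked (H.anc (home a) k) := by
    intro k hk
    by_cases he : H.anc (home a) k = H.anc x₀ k
    · have hT : TG k = false := by
        by_contra hT
        exact hTG k (by omega) (by simpa using hT) (he ▸ hR k hk)
      rw [he]
      rcases hI.clean k (by omega) hT with h | h
      · exact ⟨fun _ => Or.inl h.2, fun _ => Or.inl h.1⟩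
      · exact (h k le_rfl).2.2
    · exact (hoff (by omega) he).2.2
  obtain rfl : i = i' := by
    rcases lt_trichotomy i i' with h | h | h
    · exact absurd ((hmark i h.le).2 hm₀) (hn i h)
    · exact h
    · exact absurd ((hmark i' le_rfl).1 hm) (hn₀ i' h)
  refine ⟨i, hi, hm, hn, ?_⟩
  by_cases he : H.anc (home a) i = H.anc x₀ i
  · have hT : TG i = false := by
      by_contra hT
      exact hTG i hi (by simpa using hT) (he ▸ hR i le_rfl)
    rcases hI.clean i (by omega) hT with h | h
    · rw [he, rep_of_mem h.1, rep_of_mem h.2]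
    · symm
      refine rep_eq hc hf i (home a) hi hm fun z k hk hz => ?_
      by_cases hz' : H.anc z k = H.anc x₀ k
      · rw [hz']
        exact h k hk
      · exact hoff (by omega) hz'
  · symm
    refine rep_eq hc hf i (home a) hi hm fun z k hk hz => hoff (by omega) fun hz' => he ?_
    rw [← hz]
    exact H.anc_mono hk hi hz'

end PassInv

/-! ### The cost of the solution -/

namespace Consistent

variable {X : Type} [Fintype X] [DecidableEq X] {H : Hier X} {P : Finset ℕ} {home : ℕ → X} {s : St}

/-- The clients below an unmarked vertex whose facilities are closed pay for its facility, and so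
do those of a leaf. -/
theorem cost_le (hc : Consistent H P home s) (hf : FirstKid s) {f : X → ℝ} (hf0 : ∀ x, 0 ≤ f x)
    {d : X → X → ℝ} (hd0 : ∀ x y, 0 ≤ d x y) (hd_self : ∀ x, d x x = 0)
    (hd_le : ∀ x y i, i ≤ H.L → H.anc x i = H.anc y i → d x y ≤ 2 * 2 ^ i)
    (hd_ge : ∀ x y i, i ≤ H.L → H.anc x i ≠ H.anc y i → 2 ^ i ≤ d x y)
    (hzero : ∀ x y, H.anc x 0 = H.anc y 0 → x = y)
    {num : X → ℕ} (hnum : Function.Injective num) {fac : ℕ → ℕ}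
    (hfac : ∀ x i, i ≤ H.L → ∃ y, fac (H.anc x i) = num y ∧ H.anc y i = H.anc x i ∧
      (∀ z, H.anc z i = H.anc x i → f y ≤ f z) ∧
      (i < H.L → H.h (H.anc x i) = max (f y) 1 / 2 ^ i))
    {σ : ℕ → X} (hσ : ∀ a ∈ P, Serves H fac s (home a) (num (σ a)))
    {S : Finset X} (hS : ∀ x ∈ S, ∃ v ∈ s.O, fac v = num x)
    {S' : Finset X} {σ' : ℕ → X} (hσ' : ∀ a ∈ P, σ' a ∈ S') :
    ∑ x ∈ S, f x + ∑ a ∈ P, d (home a) (σ a) ≤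
      17 * (∑ x ∈ S', f x + ∑ a ∈ P, d (home a) (σ' a)) := by
  classical
  have hRP : ∀ {x i}, i ≤ H.L → s.R (H.anc x i) ⊆ P := fun hi a ha => ((hc.resid _ _ hi a).1 ha).1
  rcases P.eq_empty_or_nonempty with rfl | hP
  · have hO : ∀ v, v ∉ s.O := by
      intro v hv
      obtain ⟨x, i, hi, rfl⟩ := hc.owner v hv
      have h₁ := (hc.thresh x i hi).1 hv
      rw [Finset.subset_empty.1 (hRP (x := x) hi), Finset.card_empty] at h₁
      have := H.h_pos x i hi
      push_cast at h₁
      linarith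
    have hS0 : S = ∅ := Finset.eq_empty_of_forall_notMem fun x hx => by
      obtain ⟨v, hv, -⟩ := hS x hx
      exact hO v hv
    rw [hS0]
    simp only [Finset.sum_empty, add_zero]
    exact mul_nonneg (by norm_num) (Finset.sum_nonneg fun x _ => hf0 x)
  choose lo hloL hlo hlo' using hc.exists_low hP
  choose! Y hYfac hYanc hYmin hYh using hfac
  have lo_eq : ∀ {x i}, s.Marked (H.anc x i) → (∀ i' < i, ¬ s.Marked (H.anc x i')) → lo x = i := by
    intro x i h₁ h₂
    rcases lt_trichotomy (lo x) i with h | h | h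
    · exact absurd (hlo x) (h₂ _ h)
    · exact h
    · exact absurd h₁ (hlo' x i h)
  -- the partition into cells
  set lam : X → ℕ := fun x => lo x - 1 with hlam
  have hlamL : ∀ x, lam x ≤ H.L := fun x => (Nat.sub_le _ _).trans (hloL x)
  set cell : X → ℕ := fun x => H.anc x (lam x) with hcell
  have lo_congr : ∀ {x y}, H.anc y (lam x) = H.anc x (lam x) → lo y = lo x := by
    intro x y h
    refine lo_eq ?_ ?_
    · rw [H.anc_mono (Nat.sub_le _ _) (hloL x) h]
      exact hlo x
    · intro i hi hm
      have := hc.marked_mono (show i ≤ lam x by simp only [hlam]; omega) (hlamL x) hm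
      rw [h] at this
      exact hlo' x _ (by simp only [hlam]; omega) this
  have cell_of_anc : ∀ {x y}, H.anc y (lam x) = cell x → cell y = cell x := by
    intro x y h
    have := lo_congr h
    simp only [hcell, hlam, this] at h ⊢
    exact h
  have anc_of_cell : ∀ {x y}, cell y = cell x → H.anc y (lam x) = cell x := by
    intro x y h
    have : lam y = lam x := H.anc_level _ _ _ _ (hlamL y) (hlamL x) h
    rw [← this]
    exact h
  -- The charge of a client: the least distance it must travel to leave its cell. At a marked leaf
  -- it is 0, since such a client is served at distance 0.
  set q : X → ℝ := fun x => if lo x = 0 then 0 else 2 ^ lam x with hq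
  have hq0 : ∀ x, 0 ≤ q x := by
    intro x
    simp only [hq]
    split_ifs <;> positivity
  -- The share of a cell in the cost of the competing solution; the cells partition the leaves.
  set pay : ℕ → ℝ := fun c => ∑ z ∈ S' with cell z = c, f z +
    ∑ a ∈ P with cell (home a) = c, d (home a) (σ' a) with hpay
  have hpay0 : ∀ c, 0 ≤ pay c := fun c =>
    add_nonneg (Finset.sum_nonneg fun x _ => hf0 x) (Finset.sum_nonneg fun a _ => hd0 _ _)
  have hcellmem : ∀ x, cell x ∈ H.ids := fun x => H.anc_mem x _ (hlamL x)
  have htotal : ∑ c ∈ H.ids, pay c = ∑ x ∈ S', f x + ∑ a ∈ P, d (home a) (σ' a) := by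
    rw [Finset.sum_add_distrib, Finset.sum_fiberwise_of_maps_to (fun x _ => hcellmem x),
      Finset.sum_fiberwise_of_maps_to (fun a _ => hcellmem (home a))]
  set OPT := ∑ x ∈ S', f x + ∑ a ∈ P, d (home a) (σ' a) with hOPT
  -- the lower bound for a cell
  have hlow : ∀ x, f (Y x (lam x)) ≤ pay (cell x) ∨
      (({a ∈ P | cell (home a) = cell x}).card : ℝ) * 2 ^ lam x ≤ pay (cell x) := by
    intro x
    by_cases hex : ∃ z ∈ S', cell z = cell x
    · left
      obtain ⟨z, hz, hzc⟩ := hex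
      refine (hYmin x _ (hlamL x) z (anc_of_cell hzc)).trans ?_
      have : f z ≤ ∑ z ∈ S' with cell z = cell x, f z :=
        Finset.single_le_sum (f := f) (fun y _ => hf0 y) (Finset.mem_filter.2 ⟨hz, hzc⟩)
      exact this.trans (le_add_of_nonneg_right (Finset.sum_nonneg fun a _ => hd0 _ _))
    · right
      have : ∀ a ∈ ({a ∈ P | cell (home a) = cell x} : Finset ℕ),
          (2 : ℝ) ^ lam x ≤ d (home a) (σ' a) := by
        intro a ha
        obtain ⟨haP, hac⟩ := Finset.mem_filter.1 ha
        refine hd_ge _ _ _ (hlamL x) fun h => hex ⟨σ' a, hσ' a haP, cell_of_anc ?_⟩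
        rw [← h]
        exact anc_of_cell hac
      have h₁ := Finset.card_nsmul_le_sum _ _ _ this
      rw [nsmul_eq_mul] at h₁
      exact h₁.trans (le_add_of_nonneg_left (Finset.sum_nonneg fun y _ => hf0 y))
  -- the payments of clients in unmarked cells
  have hqcell : ∀ c ∈ H.ids, ∑ a ∈ P with cell (home a) = c, q (home a) ≤ pay c := by
    intro c _
    by_cases hne : ∃ a ∈ P, cell (home a) = c
    · obtain ⟨a₀, ha₀, rfl⟩ := hne
      set x := home a₀ with hx
      have hqe : ∀ a ∈ ({a ∈ P | cell (home a) = cell x} : Finset ℕ), q (home a) = q x := by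
        intro a ha
        have h := lo_congr (anc_of_cell (Finset.mem_filter.1 ha).2)
        simp only [hq, hlam, h]
      rw [Finset.sum_congr rfl hqe, Finset.sum_const, nsmul_eq_mul]
      by_cases h0 : lo x = 0
      · simp only [hq, h0, if_true, mul_zero]
        exact hpay0 _
      · have hqx : q x = 2 ^ lam x := by simp only [hq, h0, if_false]
        rw [hqx]
        have hlt : lam x < H.L := by
          have := hloL x
          simp only [hlam]
          omega
        have hun : ¬ s.Marked (cell x) := hlo' x _ (by simp only [hlam]; omega)
        have hRe : s.R (cell x) = {a ∈ P | cell (home a) = cell x} := by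
          ext a
          rw [hc.resid x _ (hlamL x) a, Finset.mem_filter]
          refine and_congr_right fun haP => ⟨fun h => cell_of_anc h.1, fun h => ?_⟩
          have h' := anc_of_cell h
          refine ⟨h', fun i' hi' hm => hun ?_⟩
          have := hc.marked_mono hi'.le (hlamL x) hm
          rwa [h'] at this
        have hth := (hc.thresh x _ (hlamL x)).2 fun ho => hun (Or.inl ho)
        rw [hYh x _ (hlamL x) hlt, lt_div_iff₀ (by positivity)] at hth
        rcases hlow x with h | h
        · refine le_trans ?_ h
          rw [← hRe]
          change ((s.R (cell x)).card : ℝ) * 2 ^ lam x < _ at hth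
          -- If it is the 1 in the maximum that bounds the number of clients times a power of two,
          -- there are no clients at all.
          rcases lt_max_iff.1 hth with h' | h'
          · exact h'.le
          · have h₁ : (s.R (cell x)).card * 2 ^ lam x < 1 := by exact_mod_cast h'
            have h₂ : (s.R (cell x)).card = 0 := by
              by_contra hne
              have := Nat.mul_le_mul (Nat.one_le_iff_ne_zero.2 hne) (Nat.one_le_two_pow (n := lam x))
              omega
            rw [h₂]
            simpa using hf0 _
        · exact h
    · rw [Finset.filter_false_of_mem fun a ha h => hne ⟨a, ha, h⟩, Finset.sum_empty]
      exact hpay0 c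
  have hqsum : ∑ a ∈ P, q (home a) ≤ OPT := by
    rw [← htotal, ← Finset.sum_fiberwise_of_maps_to (fun a _ => hcellmem (home a))]
    exact Finset.sum_le_sum hqcell
  -- the connection cost
  have hconn : ∑ a ∈ P, d (home a) (σ a) ≤ 4 * OPT := by
    refine le_trans ?_ (mul_le_mul_of_nonneg_left hqsum (by norm_num))
    rw [Finset.mul_sum]
    refine Finset.sum_le_sum fun a ha => ?_
    obtain ⟨i, hi, hm, hn, hy⟩ := hσ a ha
    have hloi : lo (home a) = i := lo_eq hm hn
    obtain ⟨y, i', hi', h₁, h₂, h₃⟩ := hc.rep_owner hf fac i (home a) hi hm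
    have hσY : σ a = Y y i' := hnum (by rw [hy, h₃, hYfac y i' (by omega)])
    have hanc : H.anc (home a) i = H.anc (σ a) i := by
      rw [hσY, ← h₁]
      exact (H.anc_mono hi' hi (hYanc y i' (by omega))).symm
    rcases i with _ | i
    · rw [← hzero _ _ hanc, hd_self]
      exact mul_nonneg (by norm_num) (hq0 _)
    -- The cell lies one level below the lowest marked ancestor, so the bound 2 · 2^(i + 1) is four
    -- times the charge 2^i.
    · have := hd_le _ _ _ hi hanc
      simp only [hq, hlam, hloi]
      rw [if_neg (Nat.succ_ne_zero i), Nat.add_sub_cancel]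
      rw [pow_succ] at this
      linarith
  -- the opening cost
  have hOPT0 : 0 ≤ OPT := add_nonneg (Finset.sum_nonneg fun x _ => hf0 x)
    (Finset.sum_nonneg fun a _ => hd0 _ _)
  obtain ⟨a₁, ha₁⟩ := hP
  -- There are three ways to pay for an owner. The top is charged to the whole competing solution.
  -- An owner at level i + 1 costs at most 4 · 2^(i + 1) per residual client, eight times their
  -- charge. At a marked leaf clients have charge 0, and the owner is charged to the share of that
  -- leaf.
  have hown : ∀ v ∈ s.O, ∃ x, fac v = num x ∧ f x ≤ (if v = H.anc (home a₁) H.L then OPT else 0) +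
      8 * ∑ a ∈ s.R v, q (home a) + 4 * (if v ∈ H.ids then pay v else 0) := by
    intro v hv
    obtain ⟨x, i, hi, rfl⟩ := hc.owner v hv
    refine ⟨Y x i, hYfac x i hi, ?_⟩
    rw [if_pos (H.anc_mem x i hi)]
    have hs0 : 0 ≤ ∑ a ∈ s.R (H.anc x i), q (home a) := Finset.sum_nonneg fun a _ => hq0 _
    rcases hi.lt_or_eq with hlt | rfl
    · have hth := (hc.thresh x i hi).1 hv
      rw [hYh x i hi hlt, div_div, div_le_iff₀ (by positivity)] at hth
      have hth' : f (Y x i) ≤ 4 * ((s.R (H.anc x i)).card * 2 ^ i) := by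
        have := le_max_left (f (Y x i)) 1
        linarith
      have htop : 0 ≤ (if H.anc x i = H.anc (home a₁) H.L then OPT else 0) := by
        split_ifs <;> simp [hOPT0]
      rcases i with _ | i
      · have hlo0 : lo x = 0 := lo_eq (Or.inl hv) (by simp)
        have hlam0 : lam x = 0 := by simp [hlam, hlo0]
        have hcx : cell x = H.anc x 0 := by simp [hcell, hlam0]
        have hRe : s.R (H.anc x 0) = {a ∈ P | cell (home a) = cell x} := by
          ext a
          rw [hc.resid x _ hi a, Finset.mem_filter]
          refine and_congr_right fun haP => ⟨fun h => cell_of_anc ?_, fun h => ?_⟩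
          · rw [hlam0, hcx]
            exact h.1
          · have := anc_of_cell h
            rw [hlam0, hcx] at this
            exact ⟨this, by simp⟩
        have := hlow x
        rw [hlam0, hcx, ← hcx, ← hRe] at this
        rw [← hcx]
        rw [hcx] at this ⊢
        rcases this with h | h
        · have := hpay0 (H.anc x 0)
          linarith
        · linarith
      · have hlow' : ∀ a ∈ s.R (H.anc x (i + 1)), q (home a) = 2 ^ i := by
          intro a ha
          obtain ⟨-, h₂, h₃⟩ := (hc.resid x _ hi a).1 ha
          have : lo (home a) = i + 1 := lo_eq (by rw [h₂]; exact Or.inl hv) h₃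
          simp [hq, hlam, this]
        rw [Finset.sum_congr rfl hlow', Finset.sum_const, nsmul_eq_mul]
        have := hpay0 (H.anc x (i + 1))
        rw [pow_succ] at hth'
        linarith
    · rw [if_pos (H.anc_top _ _)]
      have h₁ := hYmin x _ le_rfl (σ' a₁) (H.anc_top _ _)
      have h₂ : f (σ' a₁) ≤ ∑ x ∈ S', f x :=
        Finset.single_le_sum (f := f) (fun y _ => hf0 y) (hσ' a₁ ha₁)
      have h₃ : 0 ≤ ∑ a ∈ P, d (home a) (σ' a) := Finset.sum_nonneg fun a _ => hd0 _ _
      have := hpay0 (H.anc x H.L)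
      linarith
  -- A client is residual at one owner at most, namely at its lowest marked ancestor, so no charge
  -- is used twice.
  have hlowfib : ∑ v ∈ s.O, ∑ a ∈ s.R v, q (home a) ≤ OPT := by
    refine le_trans ?_ hqsum
    have hsub : ∀ v ∈ s.O, ∑ a ∈ s.R v, q (home a) ≤
        ∑ a ∈ P with H.anc (home a) (lo (home a)) = v, q (home a) := by
      intro v hv
      refine Finset.sum_le_sum_of_subset_of_nonneg ?_ fun a _ _ => hq0 _
      intro a ha
      obtain ⟨x, i, hi, rfl⟩ := hc.owner v hv
      obtain ⟨h₁, h₂, h₃⟩ := (hc.resid x _ hi a).1 ha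
      have : lo (home a) = i := lo_eq (by rw [h₂]; exact Or.inl hv) h₃
      rw [Finset.mem_filter, this]
      exact ⟨h₁, h₂⟩
    refine (Finset.sum_le_sum hsub).trans ?_
    exact Finset.sum_fiberwise_le_sum_of_sum_fiber_nonneg fun v _ =>
      Finset.sum_nonneg fun a _ => hq0 _
  have hpayO : ∑ v ∈ s.O, (if v ∈ H.ids then pay v else 0) ≤ OPT := by
    rw [← htotal, ← Finset.sum_filter]
    refine Finset.sum_le_sum_of_subset_of_nonneg ?_ fun v _ _ => hpay0 v
    intro v hv
    exact (Finset.mem_filter.1 hv).2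
  have htopO : ∑ v ∈ s.O, (if v = H.anc (home a₁) H.L then OPT else 0) ≤ OPT := by
    rw [Finset.sum_ite_eq']
    split_ifs <;> simp [hOPT0]
  have : Nonempty X := ⟨home a₁⟩
  choose! Z hZfac hZ using hown
  have hopen : ∑ x ∈ S, f x ≤ ∑ v ∈ s.O, f (Z v) := by
    have hsub : S ⊆ s.O.image Z := by
      intro x hx
      obtain ⟨v, hv, hvx⟩ := hS x hx
      exact Finset.mem_image.2 ⟨v, hv, hnum (by rw [← hZfac v hv, hvx])⟩
    refine (Finset.sum_le_sum_of_subset_of_nonneg hsub fun x _ _ => hf0 x).trans ?_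
    exact Finset.sum_image_le_of_nonneg fun x _ => hf0 _
  -- Opening costs at most 1 + 8 + 4 = 13 times the competing solution; with 4 for the connections
  -- this gives 17.
  have hopen' : ∑ v ∈ s.O, f (Z v) ≤ OPT + 8 * OPT + 4 * OPT := by
    refine (Finset.sum_le_sum hZ).trans ?_
    rw [Finset.sum_add_distrib, Finset.sum_add_distrib, ← Finset.mul_sum, ← Finset.mul_sum]
    linarith
  linarith

end Consistent

/-! ### The programs for bags -/

theorem Bags.subset_image {m : Mem} {B : ℕ → Finset ℕ} (h : Bags m B) (b : ℕ) :
    (Finset.range (B b).card).image (fun i => m.arr 5 (pr b i)) = B b := by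
  ext x
  simp only [Finset.mem_image, Finset.mem_range]
  exact ⟨fun ⟨i, hi, hx⟩ => hx ▸ (h.item b i hi).1, fun hx => ⟨_, (h.pos b x hx).1, (h.pos b x hx).2⟩⟩

/-- Runs `p` for all elements of bag `2 * v`, where `v` is in register `r`; `p` finds the element
in register `21`. -/
def forEach (r : ℕ) (p : Prog) : Prog := .block [
  .setReg 13 (.const 0),
  .loop (.lt (.reg 13) (.read 4 (.mul (.const 2) (.reg r))))
    (.block [
      .setReg 21 (.read 5 (prE (.mul (.const 2) (.reg r)) (.reg 13))),
      p,
      .setReg 13 (.add (.reg 13) (.const 1))])]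

/-- The body may change other bags but not the one being traversed, so the i-th round always meets
its i-th original element. `I D m` says that exactly the elements of `D` have been treated, and `hI`
makes it insensitive to the registers of the loop itself. -/
theorem forEach_runs {W M r T v : ℕ} {p : Prog} {m₀ : Mem} {B : ℕ → Finset ℕ} (hr13 : r ≠ 13)
    (hr21 : r ≠ 21) (hp13 : 13 ∉ p.regs) (hMW : (4 * M + 4) ^ 2 < W) (hm₀ : m₀.Bdd W)
    (hB : Bags m₀ B) (hv : v < M) (hr : m₀.reg r = v) (hsub : B (2 * v) ⊆ Finset.range M)
    (I : Finset ℕ → Mem → Prop) (hI0 : I ∅ m₀)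
    (hI : ∀ D m x c, x = 13 ∨ x = 21 → I D m → I D (m.setReg x c))
    (hp : ∀ D a m, m.Bdd W → m.reg r = v → m.arr 4 (2 * v) = m₀.arr 4 (2 * v) →
      (∀ i, m.arr 5 (pr (2 * v) i) = m₀.arr 5 (pr (2 * v) i)) → D ⊆ B (2 * v) → a ∈ B (2 * v) →
      a ∉ D → I D m → m.reg 21 = a →
      p.Runs W m T fun m' => I (insert a D) m' ∧ m'.reg r = v ∧
        m'.arr 4 (2 * v) = m₀.arr 4 (2 * v) ∧
        ∀ i, m'.arr 5 (pr (2 * v) i) = m₀.arr 5 (pr (2 * v) i)) :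
    (forEach r p).Runs W m₀ (20 + (B (2 * v)).card * (T + 40)) (I (B (2 * v))) := by
  set n := (B (2 * v)).card with hn
  have hnM : n ≤ M := by simpa using Finset.card_le_card hsub
  have hW : 4 * M + 4 < W := lt_of_le_of_lt (Nat.le_self_pow (by norm_num) _) hMW
  set a : ℕ → ℕ := fun i => m₀.arr 5 (pr (2 * v) i) with ha
  set D : ℕ → Finset ℕ := fun i => (Finset.range i).image a with hD
  have hDn : D n = B (2 * v) := hB.subset_image (2 * v)
  have hmono : ∀ i ≤ n, D i ⊆ B (2 * v) := by
    intro i hi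
    rw [← hDn]
    exact Finset.image_subset_image (by simpa using hi)
  have hnot : ∀ i < n, a i ∉ D i := by
    intro i hi hmem
    simp only [hD, Finset.mem_image, Finset.mem_range] at hmem
    obtain ⟨k, hk, hka⟩ := hmem
    have h₁ := (hB.item (2 * v) i hi).2
    have h₂ := (hB.item (2 * v) k (by omega)).2
    change m₀.arr 6 (pr (2 * v) (a i)) = i at h₁
    change m₀.arr 6 (pr (2 * v) (a k)) = k at h₂
    rw [hka, h₁] at h₂
    omega
  have hsucc : ∀ i, D (i + 1) = insert (a i) (D i) := by
    intro i
    simp [hD, Finset.range_add_one, Finset.image_insert]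
  set J : ℕ → Mem → Prop := fun i m => m.Bdd W ∧ m.reg 13 = i ∧ m.reg r = v ∧
    m.arr 4 (2 * v) = m₀.arr 4 (2 * v) ∧
    (∀ i, m.arr 5 (pr (2 * v) i) = m₀.arr 5 (pr (2 * v) i)) ∧ I (D i) m with hJ
  have hfit : ∀ i m, J i m → (Test.lt (.reg 13) (.read 4 (.mul (.const 2) (.reg r)))).Fits W m := by
    rintro i m ⟨hb, -, h, -⟩
    refine ⟨hb.1 _, ⟨⟨?_, hb.1 _, ?_⟩, hb.2 _ _⟩⟩
    · show 2 ≤ W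
      omega
    · simp only [WExp.eval, h]
      omega
  have hloop := Prog.loop_runs (W := W) (m := m₀.setReg 13 0)
    (b := .lt (.reg 13) (.read 4 (.mul (.const 2) (.reg r))))
    (p := .block [
      .setReg 21 (.read 5 (prE (.mul (.const 2) (.reg r)) (.reg 13))),
      p,
      .setReg 13 (.add (.reg 13) (.const 1))])
    (fun i t m => J i m ∧ t = i * (T + 40)) n ?_ ?_ ?_
  · obtain ⟨t, hloop⟩ := hloop
    have hset : (Prog.setReg 13 (.const 0)).Runs W m₀ 2 (fun m => m = m₀.setReg 13 0) :=
      ⟨_, _, .setReg _ _ _ (Nat.zero_le _), le_rfl, rfl⟩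
    obtain ⟨t', m', h₁, h₂, h₃, h₄⟩ := hloop
    have h₅ := hset.seq (T' := n * (T + 40) + 8) (Q' := J n) (q := Prog.block [.loop _ _])
      (fun m hm => by
        subst hm
        refine ⟨_, m', .seq h₁ (.skip _), ?_, h₃⟩
        simp only [Test.time, WExp.time] at h₂
        omega)
    exact h₅.mono (by omega) fun m hm => hDn ▸ hm.2.2.2.2.2
  · refine ⟨⟨hm₀.setReg (Nat.zero_le _), by simp, by simp [hr13, hr], by simp, by simp, ?_⟩, by simp⟩
    simp only [hD, Finset.range_zero, Finset.image_empty]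
    exact hI _ _ _ _ (Or.inl rfl) hI0
  · rintro i t m hi ⟨hJi, ht⟩
    refine ⟨hfit i m hJi, ?_, ?_⟩
    · obtain ⟨-, h₁, h₂, h₃, -⟩ := hJi
      simp only [Test.Holds, WExp.eval, h₁, h₂, h₃, hB.card]
      exact hi
    obtain ⟨hb, h₁, h₂, h₃, h₄, h₅⟩ := hJi
    have hpi : pr (2 * v) i ≤ W := (pr_le (N := M) (by omega) (by omega)).trans hMW.le
    have hr1 : (Prog.setReg 21 (.read 5 (prE (.mul (.const 2) (.reg r)) (.reg 13)))).Runs W m 17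
        (fun m' => m' = m.setReg 21 (a i)) := by
      refine ⟨_, _, .setReg _ _ _ ⟨prE_fits ⟨?_, hb.1 _, ?_⟩ (hb.1 _) ?_, hb.2 _ _⟩, le_rfl, ?_⟩
      · show 2 ≤ W
        omega
      · simp only [WExp.eval, h₂]
        omega
      · simpa only [WExp.eval, h₂, h₁] using hpi
      · simp only [WExp.eval, prE_eval, h₂, h₁, h₄, ha]
    refine ⟨T + 34, ?_⟩
    refine Prog.Runs.mono (T := 17 + (T + (4 + 1))) (hr1.seq fun m₁ hm₁ => ?_) (by omega)
      (fun m' (hm' : J (i + 1) m') => ⟨hm', by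
        simp only [Test.time, WExp.time]
        rw [ht]
        ring⟩)
    subst hm₁
    have hbd : (m.setReg 21 (a i)).Bdd W := hb.setReg (hm₀.2 _ _)
    have hrun := hp (D i) (a i) (m.setReg 21 (a i)) hbd (by simp [hr21, h₂]) (by simpa using h₃)
      (by simpa using h₄) (hmono i hi.le) (hB.item (2 * v) i hi).1 (hnot i hi)
      (hI _ _ _ _ (Or.inr rfl) h₅) (by simp)
    have hrun' := hrun.and_exec (Q' := fun m' => (I (D (i + 1)) m' ∧ m'.reg r = v ∧
        m'.arr 4 (2 * v) = m₀.arr 4 (2 * v) ∧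
        ∀ i, m'.arr 5 (pr (2 * v) i) = m₀.arr 5 (pr (2 * v) i)) ∧ m'.Bdd W ∧ m'.reg 13 = i)
      fun t m' he _ hq => ⟨hsucc i ▸ hq, he.bdd hbd, by rw [he.reg_eq hp13]; simp [h₁]⟩
    refine hrun'.seq fun m₂ hm₂ => ?_
    obtain ⟨⟨h₆, h₇, h₈, h₉⟩, hb₂, h₁₃⟩ := hm₂
    refine ⟨_, _, .seq (.setReg _ _ _ ⟨hb₂.1 _, ?_, ?_⟩) (.skip _), le_rfl, ?_⟩
    · show 1 ≤ W
      omega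
    · simp only [WExp.eval, h₁₃]
      omega
    · simp only [WExp.eval, h₁₃]
      exact ⟨hb₂.setReg (by omega), by simp, by simp [hr13, h₇], by simpa using h₈,
        by simpa using h₉, hI _ _ _ _ (Or.inl rfl) h₆⟩
  · rintro t m ⟨hJn, -⟩
    refine ⟨hfit n m hJn, ?_⟩
    obtain ⟨-, h₁, h₂, h₃, -⟩ := hJn
    simp only [Test.Holds, WExp.eval, h₁, h₂, h₃, hB.card]
    exact lt_irrefl _

/-- Inserts the element in register `x` into bag `be`. -/
def callInsert (be : WExp) (x : ℕ) : Prog := .block [.setReg 20 be, .setReg 21 (.reg x), bagInsert]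

/-- Removes the element in register `x` from bag `be`. -/
def callRemove (be : WExp) (x : ℕ) : Prog := .block [.setReg 20 be, .setReg 21 (.reg x), bagRemove]

section

variable {W M b a x : ℕ} {m : Mem} {B : ℕ → Finset ℕ} {be : WExp}

theorem callInsert_runs (hx : x ≠ 20) (hMW : (4 * M + 4) ^ 2 < W) (hm : m.Bdd W) (hB : Bags m B)
    (hbe : be.Fits W m) (hb : be.eval m = b) (ha : m.reg x = a) (hbM : b ≤ 2 * M + 1) (haM : a < M)
    (hsub : B b ⊆ Finset.range M) (hn : a ∉ B b) :
    (callInsert be x).Runs W m (be.time + 60)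
      fun m' => Bags m' (Function.update B b (insert a (B b))) ∧
        ∀ b' i, b' ≠ b → m'.arr 5 (pr b' i) = m.arr 5 (pr b' i) := by
  have hc : (B b).card ≤ M := by simpa using Finset.card_le_card hsub
  have hbd := (hm.setReg (x := 20) hbe.eval_le).setReg (x := 21) (hm.1 x)
  obtain ⟨t, m', h₁, h₂, h₃⟩ := bagInsert_runs hbd (hB.congr rfl rfl rfl) (b := b) (x := a)
    (by simp [hb]) (by simp [ha]) hn ((pr_le hbM haM.le).trans hMW.le)
    ((pr_le hbM hc).trans_lt hMW)
  have h₁' : Exec W bagInsert ((m.setReg 20 (be.eval m)).setReg 21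
      ((WExp.reg x).eval (m.setReg 20 (be.eval m)))) t m' := by
    simpa [WExp.eval, hx] using h₁
  refine ⟨_, m', .seq (.setReg _ _ _ hbe) (.seq (.setReg _ _ _ ((hm.setReg hbe.eval_le).1 x))
    (.seq h₁' (.skip _))), ?_, h₃⟩
  simp only [WExp.time]
  omega

theorem callRemove_runs (hx : x ≠ 20) (hMW : (4 * M + 4) ^ 2 < W) (hm : m.Bdd W) (hB : Bags m B)
    (hbe : be.Fits W m) (hb : be.eval m = b) (ha : m.reg x = a) (hbM : b ≤ 2 * M + 1)
    (hsub : B b ⊆ Finset.range M) (hn : a ∈ B b) :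
    (callRemove be x).Runs W m (be.time + 80)
      fun m' => Bags m' (Function.update B b ((B b).erase a)) ∧
        ∀ b' i, b' ≠ b → m'.arr 5 (pr b' i) = m.arr 5 (pr b' i) := by
  have hc : (B b).card ≤ M := by simpa using Finset.card_le_card hsub
  have hbd := (hm.setReg (x := 20) hbe.eval_le).setReg (x := 21) (hm.1 x)
  obtain ⟨t, m', h₁, h₂, h₃⟩ := bagRemove_runs hbd (hB.congr rfl rfl rfl) (b := b) (x := a)
    (by simp [hb]) (by simp [ha]) hn (by omega)
    (fun y hy => (pr_le hbM (Finset.mem_range.1 (hsub hy)).le).trans hMW.le)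
    ((pr_le hbM hc).trans hMW.le)
  have h₁' : Exec W bagRemove ((m.setReg 20 (be.eval m)).setReg 21
      ((WExp.reg x).eval (m.setReg 20 (be.eval m)))) t m' := by
    simpa [WExp.eval, hx] using h₁
  refine ⟨_, m', .seq (.setReg _ _ _ hbe) (.seq (.setReg _ _ _ ((hm.setReg hbe.eval_le).1 x))
    (.seq h₁' (.skip _))), ?_, h₃⟩
  simp only [WExp.time]
  omega

end

/-! ### Updating the lists of a vertex -/

/-- Moves the residual clients of the vertex in register `8` out of the residual clients of its
parent in register `6`, except for the client in register `2`. -/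
def takeAll : Prog := .block [
  forEach 8 (.ite (.eq (.reg 21) (.reg 2)) .skip (callRemove (.mul (.const 2) (.reg 6)) 21)),
  callInsert (.add (.mul (.const 2) (.reg 6)) (.const 1)) 8]

/-- Moves the residual clients of the vertex in register `8` to its parent in register `6`. -/
def giveAll : Prog := .block [
  forEach 8 (callInsert (.mul (.const 2) (.reg 6)) 21),
  callRemove (.add (.mul (.const 2) (.reg 6)) (.const 1)) 8]

/-- Inserts or removes the client in register `2`. -/
def moveOne : Prog := .ite (.eq (.reg 1) (.const 0)) (callInsert (.mul (.const 2) (.reg 6)) 2)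
  (callRemove (.mul (.const 2) (.reg 6)) 2)

/-- Updates the lists of the vertex in register `6`; its child on the path is in register `8`, and
registers `9` and `10` tell whether that child was and is marked. -/
def relist : Prog := .ite (.eq (.reg 9) (.reg 10))
  (.ite (.eq (.reg 9) (.const 0)) moveOne .skip)
  (.ite (.eq (.reg 9) (.const 0)) takeAll giveAll)

section

variable {W M v w j : ℕ} {m : Mem} {B : ℕ → Finset ℕ}

theorem twice_fits (hMW : (4 * M + 4) ^ 2 < W) (hm : m.Bdd W) {r : ℕ} (hv : m.reg r < M) :
    (WExp.mul (.const 2) (.reg r)).Fits W m ∧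
      (WExp.add (.mul (.const 2) (.reg r)) (.const 1)).Fits W m := by
  have hW : 4 * M + 4 < W := lt_of_le_of_lt (Nat.le_self_pow (by norm_num) _) hMW
  have h2 : 2 ≤ W := by omega
  have h1 : 1 ≤ W := by omega
  refine ⟨⟨h2, hm.1 _, ?_⟩, ⟨h2, hm.1 _, ?_⟩, h1, ?_⟩ <;> simp only [WExp.eval] <;> omega

theorem update_card_eq {m m' : Mem} {B B' : ℕ → Finset ℕ} (h : Bags m B) (h' : Bags m' B') {b : ℕ}
    (hb : B' b = B b) : m'.arr 4 b = m.arr 4 b := by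
  rw [h.card, h'.card, hb]

/-- What an update of the lists of `v` does not change. -/
def Away (v : ℕ) (K : Prop) (m m' : Mem) : Prop :=
  ∀ b' i, b' ≠ 2 * v → (K → b' ≠ 2 * v + 1) → m'.arr 5 (pr b' i) = m.arr 5 (pr b' i)

/-- The client `j` of the request is skipped: it may be on the list of the child, but as a new
arrival it never was on the list of the parent. Each round costs at most 200, as in `giveAll_runs`.
-/
theorem takeAll_runs (hMW : (4 * M + 4) ^ 2 < W) (hm : m.Bdd W) (hB : Bags m B)
    (hM : ∀ b, B b ⊆ Finset.range M) (h6 : m.reg 6 = v) (h8 : m.reg 8 = w) (h2 : m.reg 2 = j)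
    (hv : v < M) (hw : w < M) (hne : w ≠ v) (hsub : (B (2 * w)).erase j ⊆ B (2 * v))
    (hn : w ∉ B (2 * v + 1)) :
    takeAll.Runs W m (200 + 200 * (B (2 * w)).card) fun m' =>
      Bags m' (Function.update (Function.update B (2 * v) (B (2 * v) \ (B (2 * w)).erase j))
        (2 * v + 1) (insert w (B (2 * v + 1)))) ∧ Away v True m m' := by
  have hfe := forEach_runs (r := 8) (T := 90) (by decide) (by decide)
    (p := .ite (.eq (.reg 21) (.reg 2)) .skip (callRemove (.mul (.const 2) (.reg 6)) 21))
    (by decide) hMW hm hB hw h8 (hM _)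
    (fun D m' => Bags m' (Function.update B (2 * v) (B (2 * v) \ D.erase j)) ∧
      m'.reg 6 = v ∧ m'.reg 2 = j ∧ Away v False m m')
    ⟨by simpa using hB, h6, h2, fun _ _ _ _ => rfl⟩ ?_ ?_
  · unfold takeAll Prog.block
    refine Prog.Runs.mono (T' := 200 + 200 * (B (2 * w)).card)
      ((hfe.and_exec (Q' := fun m' => m'.Bdd W ∧ m'.reg 8 = w ∧
        Bags m' (Function.update B (2 * v) (B (2 * v) \ (B (2 * w)).erase j)) ∧
        m'.reg 6 = v ∧ Away v False m m') fun t m' he _ hq =>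
        ⟨he.bdd hm, by rw [he.reg_eq (by decide), h8], hq.1, hq.2.1, hq.2.2.2⟩).seq
        (T' := 70) fun m₁ ⟨hb₁, h8₁, hB₁, h6₁, ha₁⟩ => ?_) (by omega) fun _ h => h
    have hc := callInsert_runs (x := 8) (by decide) hMW hb₁ hB₁
      (be := .add (.mul (.const 2) (.reg 6)) (.const 1)) (b := 2 * v + 1) (a := w)
      (twice_fits hMW hb₁ (by omega)).2 (by simp [WExp.eval, h6₁]) h8₁ (by omega) hw
      (by simpa using hM _) (by simpa using hn)
    refine Prog.Runs.mono (T := 65 + 1) (hc.seq fun m₂ h => ⟨_, _, .skip _, le_rfl, ?_⟩) (by omega)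
      fun _ h => h
    refine ⟨by simpa using h.1, fun b' i h₁ h₂ => ?_⟩
    rw [h.2 b' i (h₂ trivial), ha₁ b' i h₁ (fun h => h.elim)]
  · rintro D m' x c hx ⟨h₁, h₂, h₃, h₄⟩
    refine ⟨h₁.congr rfl rfl rfl, ?_, ?_, h₄⟩
    · rcases hx with rfl | rfl <;> simp [h₂]
    · rcases hx with rfl | rfl <;> simp [h₃]
  · rintro D a m' hb hr8 - - hD ha haD ⟨hB', h6', h2', haw⟩ h21
    refine Prog.Runs.mono (T := 3 + 84) (Prog.Runs.ite ⟨hb.1 _, hb.1 _⟩ ?_ ?_) (by omega)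
      fun _ h => h
    · intro haj
      have haj : a = j := by rw [← h21, ← h2']; exact haj
      refine ⟨_, _, .skip _, by omega, ⟨?_, h6', h2', haw⟩, hr8, ?_, ?_⟩
      · have he : (insert a D).erase j = D.erase j := by
          subst haj
          ext x
          simp only [Finset.mem_erase, Finset.mem_insert]
          tauto
        rwa [he]
      · exact update_card_eq hB hB' (by simp [hne])
      · intro i
        exact haw _ _ (by omega) (fun h => h.elim)
    · intro haj
      have haj : a ≠ j := by rw [← h21, ← h2']; exact haj
      have hc := callRemove_runs (x := 21) (by decide) hMW hb hB'
        (be := .mul (.const 2) (.reg 6)) (b := 2 * v) (a := a)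
        (twice_fits hMW hb (by omega)).1 (by simp [WExp.eval, h6']) h21 (by omega)
        (by simpa using Finset.sdiff_subset.trans (hM _))
        (by
          simp only [Function.update_self, Finset.mem_sdiff, Finset.mem_erase]
          exact ⟨hsub (Finset.mem_erase.2 ⟨haj, ha⟩), fun h => haD h.2⟩)
      refine (hc.and_exec (Q' := fun m'' => (Bags m'' _ ∧ _) ∧ m''.reg 6 = m'.reg 6 ∧
        m''.reg 2 = m'.reg 2 ∧ m''.reg 8 = m'.reg 8) fun t m'' he _ hq =>
        ⟨hq, he.reg_eq (by decide), he.reg_eq (by decide), he.reg_eq (by decide)⟩).mono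
        (by simp only [WExp.time]; omega) ?_
      rintro m'' ⟨⟨hB'', h5⟩, e6, e2, e8⟩
      have he : (B (2 * v) \ D.erase j).erase a = B (2 * v) \ (insert a D).erase j := by
        ext x
        simp only [Finset.mem_erase, Finset.mem_insert, Finset.mem_sdiff]
        by_cases hxa : x = a
        · subst hxa; simp [haj]
        · simp [hxa]
      simp only [Function.update_self, Function.update_idem, he] at hB''
      refine ⟨⟨hB'', e6.trans h6', e2.trans h2', fun b' i h₁ h₂ => ?_⟩, e8.trans hr8, ?_, ?_⟩
      · rw [h5 b' i h₁, haw b' i h₁ h₂]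
      · exact update_card_eq hB hB'' (by simp [hne])
      · intro i
        rw [h5 _ i (by omega)]
        exact haw _ _ (by omega) (fun h => h.elim)

theorem giveAll_runs (hMW : (4 * M + 4) ^ 2 < W) (hm : m.Bdd W) (hB : Bags m B)
    (hM : ∀ b, B b ⊆ Finset.range M) (h6 : m.reg 6 = v) (h8 : m.reg 8 = w)
    (hv : v < M) (hw : w < M) (hne : w ≠ v) (hdis : Disjoint (B (2 * v)) (B (2 * w)))
    (hn : w ∈ B (2 * v + 1)) :
    giveAll.Runs W m (200 + 200 * (B (2 * w)).card) fun m' =>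
      Bags m' (Function.update (Function.update B (2 * v) (B (2 * v) ∪ B (2 * w)))
        (2 * v + 1) ((B (2 * v + 1)).erase w)) ∧ Away v True m m' := by
  have hfe := forEach_runs (r := 8) (T := 90) (by decide) (by decide)
    (p := callInsert (.mul (.const 2) (.reg 6)) 21)
    (by decide) hMW hm hB hw h8 (hM _)
    (fun D m' => Bags m' (Function.update B (2 * v) (B (2 * v) ∪ D)) ∧
      m'.reg 6 = v ∧ Away v False m m')
    ⟨by simpa using hB, h6, fun _ _ _ _ => rfl⟩ ?_ ?_
  · unfold giveAll Prog.block
    refine Prog.Runs.mono (T' := 200 + 200 * (B (2 * w)).card)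
      ((hfe.and_exec (Q' := fun m' => m'.Bdd W ∧ m'.reg 8 = w ∧
        Bags m' (Function.update B (2 * v) (B (2 * v) ∪ B (2 * w))) ∧
        m'.reg 6 = v ∧ Away v False m m') fun t m' he _ hq =>
        ⟨he.bdd hm, by rw [he.reg_eq (by decide), h8], hq.1, hq.2.1, hq.2.2⟩).seq
        (T' := 100) fun m₁ ⟨hb₁, h8₁, hB₁, h6₁, ha₁⟩ => ?_) (by omega) fun _ h => h
    have hc := callRemove_runs (x := 8) (by decide) hMW hb₁ hB₁
      (be := .add (.mul (.const 2) (.reg 6)) (.const 1)) (b := 2 * v + 1) (a := w)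
      (twice_fits hMW hb₁ (by omega)).2 (by simp [WExp.eval, h6₁]) h8₁ (by omega)
      (by simpa using hM _) (by simpa using hn)
    refine Prog.Runs.mono (T := 85 + 1) (hc.seq fun m₂ h => ⟨_, _, .skip _, le_rfl, ?_⟩) (by omega)
      fun _ h => h
    refine ⟨by simpa using h.1, fun b' i h₁ h₂ => ?_⟩
    rw [h.2 b' i (h₂ trivial), ha₁ b' i h₁ (fun h => h.elim)]
  · rintro D m' x c hx ⟨h₁, h₂, h₄⟩
    refine ⟨h₁.congr rfl rfl rfl, ?_, h₄⟩
    rcases hx with rfl | rfl <;> simp [h₂]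
  · rintro D a m' hb hr8 - - hD ha haD ⟨hB', h6', haw⟩ h21
    have haM : a < M := Finset.mem_range.1 (hM _ ha)
    have hc := callInsert_runs (x := 21) (by decide) hMW hb hB'
      (be := .mul (.const 2) (.reg 6)) (b := 2 * v) (a := a)
      (twice_fits hMW hb (by omega)).1 (by simp [WExp.eval, h6']) h21 (by omega) haM
      (by simpa using Finset.union_subset (hM (2 * v)) (hD.trans (hM (2 * w))))
      (by
        simp only [Function.update_self, Finset.mem_union, not_or]
        exact ⟨fun h => Finset.disjoint_left.1 hdis h ha, haD⟩)
    refine (hc.and_exec (Q' := fun m'' => (Bags m'' _ ∧ _) ∧ m''.reg 6 = m'.reg 6 ∧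
      m''.reg 8 = m'.reg 8) fun t m'' he _ hq =>
      ⟨hq, he.reg_eq (by decide), he.reg_eq (by decide)⟩).mono
      (by simp only [WExp.time]; omega) ?_
    rintro m'' ⟨⟨hB'', h5⟩, e6, e8⟩
    have he : insert a (B (2 * v) ∪ D) = B (2 * v) ∪ insert a D := by
      ext x
      simp only [Finset.mem_insert, Finset.mem_union]
      tauto
    simp only [Function.update_self, Function.update_idem, he] at hB''
    refine ⟨⟨hB'', e6.trans h6', fun b' i h₁ h₂ => ?_⟩, e8.trans hr8, ?_, ?_⟩
    · rw [h5 b' i h₁, haw b' i h₁ h₂]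
    · exact update_card_eq hB hB'' (by simp [hne])
    · intro i
      rw [h5 _ i (by omega)]
      exact haw _ _ (by omega) (fun h => h.elim)

theorem moveOne_runs (hMW : (4 * M + 4) ^ 2 < W) (hm : m.Bdd W) (hB : Bags m B)
    (hM : ∀ b, B b ⊆ Finset.range M) (h6 : m.reg 6 = v) (h2 : m.reg 2 = j) {ins : Bool}
    (h1 : m.reg 1 = (!ins).toNat)
    (hv : v < M) (hj : j < M) (hi : ins = true → j ∉ B (2 * v)) (he : ins = false → j ∈ B (2 * v)) :
    moveOne.Runs W m 100 fun m' =>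
      Bags m' (Function.update B (2 * v) (if ins then insert j (B (2 * v)) else (B (2 * v)).erase j))
        ∧ Away v False m m' := by
  refine Prog.Runs.mono (T := 3 + 90) (Prog.Runs.ite ⟨hm.1 _, Nat.zero_le _⟩ ?_ ?_) (by omega)
    fun _ h => h
  · intro h
    have hins : ins = true := by
      cases ins
      · have : m.reg 1 = 0 := h
        simp [h1] at this
      · rfl
    refine (callInsert_runs (x := 2) (by decide) hMW hm hB
      (be := .mul (.const 2) (.reg 6)) (b := 2 * v) (a := j)
      (twice_fits hMW hm (by omega)).1 (by simp [WExp.eval, h6]) h2 (by omega) hj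
      (hM _) (hi hins)).mono (by simp only [WExp.time]; omega) fun m' hm' => ⟨?_, ?_⟩
    · simpa [hins] using hm'.1
    · exact fun b' i h₁ _ => hm'.2 b' i h₁
  · intro h
    have hins : ins = false := by
      cases ins
      · rfl
      · exact (h (by simp [Test.Holds, WExp.eval, h1])).elim
    refine (callRemove_runs (x := 2) (by decide) hMW hm hB
      (be := .mul (.const 2) (.reg 6)) (b := 2 * v) (a := j)
      (twice_fits hMW hm (by omega)).1 (by simp [WExp.eval, h6]) h2 (by omega)
      (hM _) (he hins)).mono (by simp only [WExp.time]; omega) fun m' hm' => ⟨?_, ?_⟩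
    · simpa [hins] using hm'.1
    · exact fun b' i h₁ _ => hm'.2 b' i h₁

/-- The hypotheses `hi`, `he`, `hg` and `hl` are the preconditions of the bag operations for the
four combinations of old and new mark of the child. The bag of marked children is touched only if
the mark changes, which keeps `fk` in the other cases. -/
theorem relist_runs {s : St} {om nm ins : Bool} (hMW : (4 * M + 4) ^ 2 < W) (hm : m.Bdd W)
    (hB : Bags m s.B) (hM : ∀ b, s.B b ⊆ Finset.range M) (h6 : m.reg 6 = v) (h2 : m.reg 2 = j)
    (h1 : m.reg 1 = (!ins).toNat) (h9 : m.reg 9 = om.toNat) (h10 : m.reg 10 = nm.toNat)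
    (hv : v < M) (hj : j < M) (h8 : om ≠ nm → m.reg 8 = w ∧ w < M ∧ w ≠ v)
    (hi : om = false → nm = false → ins = true → j ∉ s.R v)
    (he : om = false → nm = false → ins = false → j ∈ s.R v)
    (hg : om = false → nm = true → (s.R w).erase j ⊆ s.R v ∧ w ∉ s.K v)
    (hl : om = true → nm = false → Disjoint (s.R v) (s.R w) ∧ w ∈ s.K v) :
    relist.Runs W m (250 + 200 * rounds s om nm w) fun m' =>
      Bags m' (Function.update (Function.update s.B (2 * v) (s.newR j ins om nm w v))
        (2 * v + 1) (s.newK om nm w v)) ∧ Away v (om ≠ nm) m m' := by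
  have hz : (Test.eq (.reg 9) (.const 0)).Fits W m := ⟨hm.1 _, Nat.zero_le _⟩
  have h9t : (Test.eq (.reg 9) (.const 0)).Holds m ↔ om = false := by
    cases om <;> simp [Test.Holds, WExp.eval, h9]
  have heq : (Test.eq (.reg 9) (.reg 10)).Holds m ↔ om = nm := by
    cases om <;> cases nm <;> simp [Test.Holds, WExp.eval, h9, h10]
  refine Prog.Runs.mono (T := 3 + (3 + (200 + 200 * rounds s om nm w)))
    (Prog.Runs.ite ⟨hm.1 _, hm.1 _⟩ (fun hon => Prog.Runs.ite hz (fun ho => ?_) fun ho => ?_)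
      (fun hon => Prog.Runs.ite hz (fun ho => ?_) fun ho => ?_)) (by omega) fun _ h => h
  · rw [heq] at hon
    rw [h9t] at ho
    subst ho
    obtain rfl : nm = false := hon.symm
    refine (moveOne_runs hMW hm hB hM h6 h2 h1 hv hj (hi rfl rfl) (he rfl rfl)).mono (by omega) ?_
    rintro m' ⟨h₁, h₂⟩
    refine ⟨?_, fun b' i h _ => h₂ b' i h (fun h => h.elim)⟩
    simp only [St.newR, St.newK, if_true, Bool.false_eq_true, if_false]
    rwa [Function.update_eq_self_iff.2]
    simp
  · rw [heq] at hon
    rw [h9t] at ho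
    subst hon
    have ho : om = true := by simpa using ho
    subst ho
    refine ⟨_, _, .skip _, by omega, ?_, fun _ _ _ _ => rfl⟩
    simpa [St.newR, St.newK] using hB
  · rw [heq] at hon
    rw [h9t] at ho
    subst ho
    have hnm : nm = true := by cases nm <;> simp_all
    subst hnm
    obtain ⟨h8, hw, hne⟩ := h8 (by decide)
    refine (takeAll_runs hMW hm hB hM h6 h8 h2 hv hw hne (hg rfl rfl).1 (hg rfl rfl).2).mono
      (by simp [rounds]) ?_
    rintro m' ⟨h₁, h₂⟩
    exact ⟨by simpa [St.newR, St.newK] using h₁, fun b' i h h' => h₂ b' i h fun _ => h' (by decide)⟩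
  · rw [heq] at hon
    rw [h9t] at ho
    have ho : om = true := by simpa using ho
    subst ho
    have hnm : nm = false := by cases nm <;> simp_all
    subst hnm
    obtain ⟨h8, hw, hne⟩ := h8 (by decide)
    refine (giveAll_runs hMW hm hB hM h6 h8 hv hw hne (hl rfl rfl).1 (hl rfl rfl).2).mono
      (by simp [rounds]) ?_
    rintro m' ⟨h₁, h₂⟩
    exact ⟨by simpa [St.newR, St.newK] using h₁, fun b' i h h' => h₂ b' i h fun _ => h' (by decide)⟩

end

/-! ### Opening and closing -/

/-- The number of residual clients of the vertex in register `6`. -/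
def cntE : WExp := .read 4 (.mul (.const 2) (.reg 6))

/-- Opens a facility for the vertex in register `6`. -/
def openP : Prog := .block [
  .setArr 12 (.reg 6) (.const 1),
  .setReg 15 (.read 9 (.reg 6)),
  .setArr 3 (.reg 15) (.add (.read 3 (.reg 15)) (.const 1)),
  .setReg 11 (.const 1)]

/-- Closes the facility of the vertex in register `6`. -/
def closeP : Prog := .block [
  .setArr 12 (.reg 6) (.const 0),
  .setReg 15 (.read 9 (.reg 6)),
  .setArr 3 (.reg 15) (.sub (.read 3 (.reg 15)) (.const 1)),
  .setReg 11 (.const 1)]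

/-- Whether the vertex in register `6` has enough clients for a facility. -/
def enough (n : ℕ) : Test := .and (.lt (.const 0) cntE)
  (.not (.costLt (.word (.mul (.mul (.const n) cntE) (.read 8 (.reg 6)))) (.read 1 (.reg 6))))

/-- Opens or closes the vertex in register `6` if its number of residual clients requires it. -/
def toggle : Prog := .ite (.eq (.read 12 (.reg 6)) (.const 0))
  (.block [.ite (enough 1) openP .skip, .setArr 10 (.reg 6) (.reg 11)])
  (.ite (enough 4) (.setArr 10 (.reg 6) (.const 0))
    (.block [closeP, .setArr 10 (.reg 6) (.const 1)]))

/-- Costs can only be compared, so the threshold is multiplied out to put a word on one side. For an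
integer `c` the 1 in the maximum says no more than 0 < c. -/
theorem enough_iff {c i n : ℕ} (hn : 0 < n) {G : ℝ} :
    (0 < c ∧ ¬ ((n * c * 2 ^ i : ℕ) : ℝ) < G) ↔ max G 1 / 2 ^ i / n ≤ c := by
  have hn' : (0 : ℝ) < n := by exact_mod_cast hn
  rw [div_div, div_le_iff₀ (by positivity), max_le_iff, not_lt]
  have e : ((n * c * 2 ^ i : ℕ) : ℝ) = c * (2 ^ i * n) := by push_cast; ring
  rw [← e, and_comm]
  refine and_congr_right fun _ => ?_
  rw [Nat.one_le_cast, Nat.one_le_iff_ne_zero, Nat.pos_iff_ne_zero]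
  simp [hn.ne']

/-- The owners in `O` and the numbers of owners of each facility are stored in memory. -/
structure Owners (m : Mem) (O : Finset ℕ) (fac : ℕ → ℕ) : Prop where
  own : ∀ u, m.arr 12 u = if u ∈ O then 1 else 0
  ref : ∀ y, m.arr 3 y = (O.filter fun u => fac u = y).card

section

variable {W M v i c : ℕ} {m : Mem} {O : Finset ℕ} {fac : ℕ → ℕ}

/-- One facility may be the cheapest in several nested classes. Therefore array `3` counts owners
instead of storing a flag, and a facility is open as long as its count is positive. -/
theorem openP_runs (hm : m.Bdd W) (hW : M + 1 ≤ W) (hO : Owners m O fac) (hOM : O ⊆ Finset.range M)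
    (h6 : m.reg 6 = v) (hf : m.arr 9 v = fac v) (hv : v ∉ O) :
    openP.Runs W m 20 fun m' => Owners m' (insert v O) fac ∧ m'.reg 11 = 1 := by
  refine Prog.wp.runs ?_ (by decide)
  have hcard : ∀ y, m.arr 3 y + 1 ≤ W := by
    intro y
    rw [hO.ref]
    have := Finset.card_le_card ((Finset.filter_subset (fun u => fac u = y) O).trans hOM)
    rw [Finset.card_range] at this
    omega
  have h1 : 1 ≤ W := by omega
  refine ⟨hm.1 _, h1, ⟨?_, ?_⟩, ?_, ⟨⟨?_, ?_⟩, h1, ?_⟩, h1, ?_, ?_⟩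
  all_goals simp [WExp.eval, WExp.Fits, h6, hf]
  · exact h6 ▸ hm.1 6
  · exact hf ▸ hm.2 9 v
  · exact hf ▸ hm.2 9 v
  · exact hf ▸ hm.2 9 v
  · exact hm.2 _ _
  · exact hcard _
  · constructor
    · intro u
      by_cases hu : u = v
      · simp [hu]
      · simp [hu, hO.own]
    · intro y
      by_cases hy : y = fac v
      · subst hy
        rw [Finset.filter_insert, if_pos rfl, Finset.card_insert_of_notMem (by simp [hv])]
        simp [hO.ref]
      · rw [Finset.filter_insert, if_neg (Ne.symm hy)]
        simp [hO.ref, hy]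

theorem closeP_runs (hm : m.Bdd W) (h1 : 1 ≤ W) (hO : Owners m O fac)
    (h6 : m.reg 6 = v) (hf : m.arr 9 v = fac v) (hv : v ∈ O) :
    closeP.Runs W m 20 fun m' => Owners m' (O.erase v) fac ∧ m'.reg 11 = 1 := by
  refine Prog.wp.runs ?_ (by decide)
  refine ⟨hm.1 _, Nat.zero_le _, ⟨?_, ?_⟩, ?_, ⟨⟨?_, ?_⟩, h1⟩, h1, ?_, ?_⟩
  all_goals simp [WExp.eval, WExp.Fits, h6, hf]
  · exact h6 ▸ hm.1 6
  · exact hf ▸ hm.2 9 v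
  · exact hf ▸ hm.2 9 v
  · exact hf ▸ hm.2 9 v
  · exact hm.2 _ _
  · constructor
    · intro u
      by_cases hu : u = v
      · simp [hu]
      · simp [hu, hO.own]
    · intro y
      by_cases hy : y = fac v
      · subst hy
        rw [Finset.filter_erase, Finset.card_erase_of_mem (by simp [hv])]
        simp [hO.ref]
      · rw [Finset.filter_erase, Finset.erase_eq_of_notMem (by simp [Ne.symm hy])]
        simp [hO.ref, hy]

theorem enough_fits {n : ℕ} (hn : n ≤ 4) (hMW : (4 * M + 4) ^ 2 < W) (hm : m.Bdd W)
    (h6 : m.reg 6 = v) (hv : v < M) (hc : m.arr 4 (2 * v) = c) (hcM : c ≤ M)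
    (hp : m.arr 8 v ≤ M) : (enough n).Fits W m := by
  have hW : 4 * M + 4 < W := lt_of_le_of_lt (Nat.le_self_pow (by norm_num) _) hMW
  have hcf : cntE.Fits W m := ⟨(twice_fits hMW hm (by omega)).1, hm.2 _ _⟩
  have hce : cntE.eval m = c := by simp [cntE, WExp.eval, h6, hc]
  have hn4 : n * c ≤ 4 * M := Nat.mul_le_mul hn hcM
  refine ⟨⟨Nat.zero_le _, hcf⟩, ⟨⟨?_, hcf, ?_⟩, ⟨hm.1 _, hm.2 _ _⟩, ?_⟩, hm.1 _⟩
  · show n ≤ W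
    omega
  · simp only [WExp.eval, hce]
    omega
  · simp only [WExp.eval, hce, h6]
    calc n * c * m.arr 8 v ≤ 4 * M * M := Nat.mul_le_mul hn4 hp
      _ ≤ W := by nlinarith

theorem enough_holds {n : ℕ} (hn : 0 < n) (h6 : m.reg 6 = v) (hc : m.arr 4 (2 * v) = c)
    (hp : m.arr 8 v = 2 ^ i) :
    (enough n).Holds m ↔ max (m.cost 1 v) 1 / 2 ^ i / n ≤ c := by
  rw [← enough_iff hn]
  simp only [enough, Test.Holds, CExp.eval, WExp.eval, cntE, h6, hc, hp]

theorem toggle_runs {s : St} {tog : Bool} {h : ℝ} (hMW : (4 * M + 4) ^ 2 < W) (hm : m.Bdd W)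
    (hO : Owners m s.O fac) (hOM : s.O ⊆ Finset.range M) (h6 : m.reg 6 = v) (hv : v < M)
    (h11 : m.reg 11 = tog.toNat) (hc : m.arr 4 (2 * v) = c) (hcM : c ≤ M)
    (hp : m.arr 8 v = 2 ^ i) (hpM : 2 ^ i ≤ M) (hf : m.arr 9 v = fac v)
    (hh : h = max (m.cost 1 v) 1 / 2 ^ i) :
    toggle.Runs W m 100 fun m' => Owners m' (s.newO v h c) fac ∧
      m'.reg 11 = (tog || decide ¬ (v ∈ s.O ↔ v ∈ s.newO v h c)).toNat ∧
      ∀ u, m'.arr 10 u = if u = v then (needs (v ∈ s.O) (v ∈ s.newO v h c) tog).toNat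
        else m.arr 10 u := by
  have hW : 4 * M + 4 < W := lt_of_le_of_lt (Nat.le_self_pow (by norm_num) _) hMW
  have h1 : 1 ≤ W := by omega
  have he1 := enough_holds (n := 1) one_pos h6 hc hp
  have he4 := enough_holds (n := 4) (by norm_num) h6 hc hp
  rw [← hh] at he1 he4
  simp only [Nat.cast_one, div_one, Nat.cast_ofNat] at he1 he4
  refine Prog.Runs.mono (T := 4 + 60) (Prog.Runs.ite ⟨⟨hm.1 _, hm.2 _ _⟩, Nat.zero_le _⟩
    (fun ho => ?_) fun ho => ?_) (by omega) fun _ h => h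
  · have ho : v ∉ s.O := by
      simp only [Test.Holds, WExp.eval, h6, hO.own] at ho
      intro hv
      simp [hv] at ho
    refine Prog.Runs.mono (T := 41 + (3 + 1)) (Prog.Runs.seq
      (Q := fun m' => m'.Bdd W ∧ m'.reg 6 = v ∧ Owners m' (s.newO v h c) fac ∧
        m'.reg 11 = (tog || decide ¬ (v ∈ s.O ↔ v ∈ s.newO v h c)).toNat ∧ m'.arr 10 = m.arr 10)
      ?_ ?_) (by omega) fun _ h => h
    · refine Prog.Runs.mono (T := 21 + 20) ?_ (by omega) fun _ h => h
      refine (Prog.Runs.ite (enough_fits (n := 1) (by norm_num) hMW hm h6 hv hc hcM (hp ▸ hpM)) (fun hb => ?_)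
        fun hb => ?_)
      · rw [he1] at hb
        have hn : s.newO v h c = insert v s.O := by rw [St.newO, if_neg ho, if_pos hb]
        rw [hn]
        refine (openP_runs hm (by omega) hO hOM h6 hf ho).and_exec fun t m' he _ hq => ?_
        exact ⟨he.bdd hm, by rw [he.reg_eq (by decide), h6], hq.1, by rw [hq.2]; simp [ho],
          he.arr_eq (by decide)⟩
      · rw [he1] at hb
        have hn : s.newO v h c = s.O := by rw [St.newO, if_neg ho, if_neg hb]
        rw [hn]
        exact ⟨_, _, .skip _, by omega, hm, h6, hO, by simp [h11], rfl⟩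
    · rintro m' ⟨hb', h6', hO', h11', h10'⟩
      refine ⟨_, _, .seq (.setArr _ _ _ _ (hb'.1 _) (hb'.1 _)) (.skip _), le_rfl, ?_, ?_, ?_⟩
      · exact ⟨by simpa using hO'.own, by simpa using hO'.ref⟩
      · simpa using h11'
      · intro u
        simp only [WExp.eval, h6', h11', Mem.setArr_arr, true_and, h10', needs, if_neg ho]
        simp only [ho, false_iff, not_not]
  · have ho : v ∈ s.O := by
      simp only [Test.Holds, WExp.eval, h6, hO.own] at ho
      by_contra hv
      simp [hv] at ho
    refine Prog.Runs.mono (T := 21 + 30) ?_ (by omega) fun _ h => h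
    refine (Prog.Runs.ite (enough_fits (n := 4) (by norm_num) hMW hm h6 hv hc hcM (hp ▸ hpM)) (fun hb => ?_)
      fun hb => ?_)
    · rw [he4] at hb
      have hn : s.newO v h c = s.O := by rw [St.newO, if_pos ho, if_neg (not_lt.2 hb)]
      rw [hn]
      refine ⟨_, _, .setArr _ _ _ _ (hm.1 _) (Nat.zero_le _), ?_, ?_, ?_, ?_⟩
      · simp only [WExp.time]
        omega
      · exact ⟨by simpa using hO.own, by simpa using hO.ref⟩
      · simp [h11]
      · intro u
        simp [WExp.eval, h6, needs, ho]
    · rw [he4] at hb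
      have hn : s.newO v h c = s.O.erase v := by rw [St.newO, if_pos ho, if_pos (not_le.1 hb)]
      rw [hn]
      refine Prog.Runs.mono (T := 20 + (3 + 1)) (((closeP_runs hm h1 hO h6 hf ho).and_exec
        (Q' := fun m' => m'.Bdd W ∧ m'.reg 6 = v ∧ Owners m' (s.O.erase v) fac ∧
        m'.reg 11 = 1 ∧ m'.arr 10 = m.arr 10) fun t m' he _ hq => ⟨he.bdd hm,
          by rw [he.reg_eq (by decide), h6], hq.1, hq.2, he.arr_eq (by decide)⟩).seq ?_)
          (by omega) fun _ h => h
      rintro m' ⟨hb', h6', hO', h11', h10'⟩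
      refine ⟨_, _, .seq (.setArr _ _ _ _ (hb'.1 _) h1) (.skip _), le_rfl, ?_, ?_, ?_⟩
      · exact ⟨by simpa using hO'.own, by simpa using hO'.ref⟩
      · simp [h11', ho]
      · intro u
        simp [WExp.eval, h6', h10', needs, ho]

end

/-! ### The first pass -/

/-- The hierarchy is stored in memory. -/
structure TreeMem {X : Type} (m : Mem) (H : Hier X) (fac : ℕ → ℕ) : Prop where
  top : m.reg 4 = H.L
  par : ∀ x, ∀ i < H.L, m.arr 7 (H.anc x i) = H.anc x (i + 1)
  pow : ∀ x, ∀ i ≤ H.L, m.arr 8 (H.anc x i) = 2 ^ i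
  fac : ∀ x, ∀ i ≤ H.L, m.arr 9 (H.anc x i) = fac (H.anc x i)
  worth : ∀ x, ∀ i ≤ H.L, H.h (H.anc x i) = max (m.cost 1 (H.anc x i)) 1 / 2 ^ i

theorem TreeMem.congr {X : Type} {m m' : Mem} {H : Hier X} {fac : ℕ → ℕ} (h : TreeMem m H fac)
    (h4 : m'.reg 4 = m.reg 4) (h7 : m'.arr 7 = m.arr 7) (h8 : m'.arr 8 = m.arr 8)
    (h9 : m'.arr 9 = m.arr 9) (hc : m'.cost 1 = m.cost 1) : TreeMem m' H fac :=
  ⟨h4 ▸ h.top, h7 ▸ h.par, h8 ▸ h.pow, h9 ▸ h.fac, hc ▸ h.worth⟩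

/-- The numbers of the vertices and the words that occur are small. -/
structure SmallHier {X : Type} (H : Hier X) (M W : ℕ) : Prop where
  lt : (4 * M + 4) ^ 2 < W
  ids : ∀ v ∈ H.ids, v < M
  pow : 2 ^ H.L ≤ M

theorem SmallHier.level {X : Type} {H : Hier X} {M W : ℕ} (h : SmallHier H M W) : H.L < M :=
  (Nat.lt_two_pow_self).trans_le h.pow

theorem SmallHier.word {X : Type} {H : Hier X} {M W : ℕ} (h : SmallHier H M W) : 4 * M + 4 < W :=
  lt_of_le_of_lt (Nat.le_self_pow (by norm_num) _) h.lt

/-- The state `s` is stored in memory. -/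
structure Abs (m : Mem) (s : St) (fac : ℕ → ℕ) (M : ℕ) : Prop where
  bags : Bags m s.B
  owners : Owners m s.O fac
  fk : ∀ v, s.fk v = m.arr 5 (pr (2 * v + 1) 0)
  bound : ∀ b, s.B b ⊆ Finset.range M

theorem Owners.congr {m m' : Mem} {O : Finset ℕ} {fac : ℕ → ℕ} (h : Owners m O fac)
    (h12 : m'.arr 12 = m.arr 12) (h3 : m'.arr 3 = m.arr 3) : Owners m' O fac :=
  ⟨h12 ▸ h.own, h3 ▸ h.ref⟩

theorem Abs.congr {m m' : Mem} {s : St} {fac : ℕ → ℕ} {M : ℕ} (h : Abs m s fac M)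
    (h3 : m'.arr 3 = m.arr 3) (h4 : m'.arr 4 = m.arr 4) (h5 : m'.arr 5 = m.arr 5)
    (h6 : m'.arr 6 = m.arr 6) (h12 : m'.arr 12 = m.arr 12) : Abs m' s fac M :=
  ⟨h.bags.congr h4 h5 h6, h.owners.congr h12 h3, fun v => by rw [h5]; exact h.fk v, h.bound⟩

/-- `fk` is by definition what stands at position 0 of the bag of marked children, even if the bag
is empty; it means something as soon as the bag is not. -/
theorem Abs.firstKid {m : Mem} {s : St} {fac : ℕ → ℕ} {M : ℕ} (h : Abs m s fac M) :
    FirstKid s := fun v hv => by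
  rw [h.fk]
  exact (h.bags.item _ 0 (Finset.card_pos.2 hv)).1

/-- An expression which is positive if and only if the vertex in register `r` is marked. -/
def markE (r : ℕ) : WExp :=
  .add (.read 12 (.reg r)) (.read 4 (.add (.mul (.const 2) (.reg r)) (.const 1)))

section

variable {W M v r : ℕ} {m : Mem} {s : St} {fac : ℕ → ℕ}

theorem Abs.card_le (h : Abs m s fac M) (b : ℕ) : (s.B b).card ≤ M := by
  simpa using Finset.card_le_card (h.bound b)

theorem Abs.markE_eval (h : Abs m s fac M) (hr : m.reg r = v) :
    (markE r).eval m = (if v ∈ s.O then 1 else 0) + (s.K v).card := by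
  simp [markE, WExp.eval, hr, h.owners.own, h.bags.card]

theorem Abs.markE_pos (h : Abs m s fac M) (hr : m.reg r = v) :
    0 < (markE r).eval m ↔ s.Marked v := by
  rw [h.markE_eval hr, St.Marked, ← Finset.card_pos]
  split_ifs with hv <;> simp [hv]

theorem Abs.markE_le (h : Abs m s fac M) (hr : m.reg r = v) : (markE r).eval m ≤ M + 1 := by
  rw [h.markE_eval hr]
  have : (s.K v).card ≤ M := h.card_le (2 * v + 1)
  split_ifs <;> omega

theorem Abs.markE_fits (h : Abs m s fac M) (hMW : (4 * M + 4) ^ 2 < W) (hm : m.Bdd W)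
    (hr : m.reg r = v) (hv : v < M) : (markE r).Fits W m := by
  have hW : 4 * M + 4 < W := lt_of_le_of_lt (Nat.le_self_pow (by norm_num) _) hMW
  refine ⟨⟨hm.1 _, hm.2 _ _⟩, ⟨(twice_fits hMW hm (by omega)).2, hm.2 _ _⟩, ?_⟩
  have := h.markE_le hr
  simp only [markE, WExp.eval] at this ⊢
  omega

end

theorem St.newR_subset {s : St} {M j w v : ℕ} {ins om nm : Bool}
    (h : ∀ b, s.B b ⊆ Finset.range M) (hj : j < M) : s.newR j ins om nm w v ⊆ Finset.range M := by
  have h₁ := h (2 * v)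
  have h₂ := h (2 * w)
  unfold St.newR
  split_ifs
  · exact h₁
  · exact Finset.insert_subset (Finset.mem_range.2 hj) h₁
  · exact (Finset.erase_subset _ _).trans h₁
  · exact Finset.sdiff_subset.trans h₁
  · exact Finset.union_subset h₁ h₂

theorem St.newK_subset {s : St} {M w v : ℕ} {om nm : Bool}
    (h : ∀ b, s.B b ⊆ Finset.range M) (hw : om ≠ nm → w < M) :
    s.newK om nm w v ⊆ Finset.range M := by
  have h₁ := h (2 * v + 1)
  unfold St.newK
  split_ifs with h₂
  · exact h₁
  · exact Finset.insert_subset (Finset.mem_range.2 (hw h₂)) h₁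
  · exact (Finset.erase_subset _ _).trans h₁

/-- Goes on to the parent of the vertex in register `6`. -/
def advance : Prog := .block [
  .setReg 9 (.sub (.const 1) (.sub (.const 1) (.reg 12))),
  .setReg 10 (.sub (.const 1) (.sub (.const 1) (markE 6))),
  .setReg 8 (.reg 6),
  .setReg 6 (.read 7 (.reg 6)),
  .setReg 7 (.add (.reg 7) (.const 1))]

/-- One step of the first pass. -/
def stepUp : Prog := .block [.setReg 12 (markE 6), relist, toggle, advance]

/-- The first pass: updates the vertices above the leaf in register `3`. -/
def passOne : Prog := .block [
  .setReg 6 (.reg 3), .setReg 7 (.const 0), .setReg 9 (.const 0), .setReg 10 (.const 0),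
  .setReg 11 (.const 0),
  .loop (.lt (.reg 7) (.add (.reg 4) (.const 1))) stepUp]

/-- The memory during the first pass. -/
structure PassMem {X : Type} (H : Hier X) (fac : ℕ → ℕ) (x₀ : X) (j : ℕ) (ins : Bool) (M W : ℕ)
    (asg : ℕ → ℕ) (l : ℕ) (m : Mem) (s : St) (om nm tog : Bool) (TG : ℕ → Bool) : Prop where
  bdd : m.Bdd W
  tree : TreeMem m H fac
  abs : Abs m s fac M
  r1 : m.reg 1 = (!ins).toNat
  r2 : m.reg 2 = j
  r7 : m.reg 7 = l
  r6 : l ≤ H.L → m.reg 6 = H.anc x₀ l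
  r8 : ∀ i, l = i + 1 → m.reg 8 = H.anc x₀ i
  r9 : m.reg 9 = om.toNat
  r10 : m.reg 10 = nm.toNat
  r11 : m.reg 11 = tog.toNat
  tg : ∀ i < l, m.arr 10 (H.anc x₀ i) = (TG i).toNat
  asg : m.arr 2 = asg

section

variable {X : Type} {H : Hier X} {P : Finset ℕ} {home : ℕ → X} {s₀ s : St} {x₀ : X} {j : ℕ}
  {ins : Bool} {l : ℕ} {om nm tog : Bool} {TG : ℕ → Bool} {X₁ : ℕ} {fac asg : ℕ → ℕ} {M W : ℕ}
  {m : Mem}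

/-- The program realises an abstract `St.IsStep`, so the mathematical part is `PassInv.step`; the
rest is bookkeeping of registers and arrays. Only `rounds` is not bounded by a constant, and `X₁`
counts it. -/
theorem stepUp_runs (hS : SmallHier H M W) (hc : Consistent H P home s₀) (hj : home j = x₀)
    (hP : ins = true → j ∉ P) (hP' : ins = false → j ∈ P) (hjM : j < M) (hl : l ≤ H.L)
    (hI : PassInv H P home s₀ x₀ j ins l s om nm tog TG X₁)
    (hm : PassMem H fac x₀ j ins M W asg l m s om nm tog TG) :
    ∃ w, stepUp.Runs W m (450 + 200 * rounds s om nm w) fun m' => ∃ s' om' nm' tog' TG',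
      PassInv H P home s₀ x₀ j ins (l + 1) s' om' nm' tog' TG' (X₁ + rounds s om nm w) ∧
      PassMem H fac x₀ j ins M W asg (l + 1) m' s' om' nm' tog' TG' := by
  classical
  set v := H.anc x₀ l with hvdef
  -- At level 0 there is no child and this register holds an arbitrary value. Both mark flags are
  -- then false, so the lists of `w` play no role.
  set w := m.reg 8 with hwdef
  have hw : ∀ i, l = i + 1 → w = H.anc x₀ i := hm.r8
  have hMW := hS.lt
  have hWM := hS.word
  have h6 : m.reg 6 = v := hm.r6 hl
  have hvM : v < M := hS.ids _ (H.anc_mem _ _ hl)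
  have hw' : om ≠ nm → w < M ∧ w ≠ v := by
    intro h
    cases l with
    | zero =>
      obtain ⟨h₁, h₂, -⟩ := hI.zero rfl
      exact absurd (h₁.trans h₂.symm) h
    | succ l =>
      rw [hw l rfl]
      exact ⟨hS.ids _ (H.anc_mem _ _ (by omega)),
        (PassInv.path_ne hl l (Nat.lt_succ_self l)).symm⟩
  refine ⟨w, ?_⟩
  set h := H.h v with hh
  set B' := Function.update (Function.update s.B (2 * v) (s.newR j ins om nm w v))
    (2 * v + 1) (s.newK om nm w v) with hB'
  have hbm := hm.abs.markE_fits hMW hm.bdd h6 hvM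
  have hmk := hm.abs.markE_le h6
  set m₁ := m.setReg 12 ((markE 6).eval m) with hm₁
  have hb₁ : m₁.Bdd W := hm.bdd.setReg (by omega)
  have hrel := relist_runs (W := W) (M := M) (m := m₁) (s := s) (v := v) (w := w) (j := j)
    (om := om) (nm := nm) (ins := ins) hMW hb₁ (hm.abs.bags.congr rfl rfl rfl) hm.abs.bound
    (by simp [hm₁, h6]) (by simp [hm₁, hm.r2]) (by simp [hm₁, hm.r1]) (by simp [hm₁, hm.r9])
    (by simp [hm₁, hm.r10]) hvM hjM (fun h => ⟨by simp [hm₁, hwdef], hw' h⟩)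
    (fun _ _ hi => hI.notMem_of_insert hc hP hl hi)
    (fun ho _ hi => hI.mem_of_erase hc hj hP' hl hi ho)
    (fun ho hn => hI.gain_subset hc hl hw ho hn)
    (fun ho _ => hI.loss_disjoint hc hl hw ho)
  unfold stepUp Prog.block
  refine Prog.Runs.mono (T := 10 + (250 + 200 * rounds s om nm w + (100 + (70 + 1))))
    (Prog.Runs.seq (Q := fun m' => m' = m₁) ⟨_, _, .setReg _ _ _ hbm, le_rfl, rfl⟩ ?_) (by omega)
    fun _ h => h
  rintro _ rfl
  refine Prog.Runs.seq (hrel.and_exec (Q' := fun m₂ => m₂.Bdd W ∧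
    (∀ x ∉ relist.regs, m₂.reg x = m₁.reg x) ∧ (∀ a ∉ relist.arrs, m₂.arr a = m.arr a) ∧
    m₂.cost 1 = m.cost 1 ∧ Bags m₂ B' ∧ Away v (om ≠ nm) m m₂) fun t m₂ he _ hq =>
    ⟨he.bdd hb₁, fun x hx => he.reg_eq hx, fun a ha => he.arr_eq ha, he.cost_eq (by decide),
      hq.1, hq.2⟩) ?_
  rintro m₂ ⟨hb₂, hreg₂, harr₂, hcost₂, hB₂, haw₂⟩
  have hOM : s.O ⊆ Finset.range M := by
    intro u hu
    obtain ⟨x, i, hi, rfl⟩ := hI.owner u hu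
    exact Finset.mem_range.2 (hS.ids _ (H.anc_mem _ _ hi))
  have hR : s.newR j ins om nm w v ⊆ Finset.range M := St.newR_subset hm.abs.bound hjM
  have hK : s.newK om nm w v ⊆ Finset.range M := St.newK_subset hm.abs.bound fun h => (hw' h).1
  have hc₂ : m₂.arr 4 (2 * v) = (s.newR j ins om nm w v).card := by
    rw [hB₂.card, hB', Function.update_of_ne (by omega), Function.update_self]
  have h6₂ : m₂.reg 6 = v := by rw [hreg₂ 6 (by decide)]; simp [hm₁, h6]
  have htog := toggle_runs (W := W) (M := M) (m := m₂) (s := s) (v := v) (fac := fac) (tog := tog)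
    (i := l) (c := (s.newR j ins om nm w v).card) (h := h) hMW hb₂
    (hm.abs.owners.congr (harr₂ 12 (by decide)) (harr₂ 3 (by decide))) hOM h6₂ hvM
    (by rw [hreg₂ 11 (by decide)]; simp [hm₁, hm.r11]) hc₂
    (by simpa using Finset.card_le_card hR)
    (by rw [harr₂ 8 (by decide)]; exact hm.tree.pow x₀ l hl)
    ((Nat.pow_le_pow_right (by norm_num) hl).trans hS.pow)
    (by rw [harr₂ 9 (by decide)]; exact hm.tree.fac x₀ l hl)
    (by rw [hcost₂]; exact hm.tree.worth x₀ l hl)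
  refine Prog.Runs.seq (htog.and_exec (Q' := fun m₃ => m₃.Bdd W ∧
    (∀ x ∉ toggle.regs, m₃.reg x = m₂.reg x) ∧ (∀ a ∉ toggle.arrs, m₃.arr a = m₂.arr a) ∧
    m₃.cost 1 = m.cost 1 ∧ Owners m₃ _ fac ∧ m₃.reg 11 = _ ∧ _) fun t m₃ he _ hq =>
    ⟨he.bdd hb₂, fun x hx => he.reg_eq hx, fun a ha => he.arr_eq ha,
      (he.cost_eq (by decide)).trans hcost₂, hq.1, hq.2.1, hq.2.2⟩) ?_
  rintro m₃ ⟨hb₃, hreg₃, harr₃, hcost₃, hO₃, h11₃, h10₃⟩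
  -- `fk` is read off the memory; that it changes only at this vertex, and only together with the
  -- mark of the child, follows from `Away`.
  set s' : St := ⟨B', s.newO v h (s.newR j ins om nm w v).card,
    fun u => m₃.arr 5 (pr (2 * u + 1) 0)⟩ with hs'
  have hB₃ : Bags m₃ B' := hB₂.congr (harr₃ 4 (by decide)) (harr₃ 5 (by decide))
    (harr₃ 6 (by decide))
  have habs : Abs m₃ s' fac M := by
    refine ⟨hB₃, hO₃, fun _ => rfl, fun b => ?_⟩
    simp only [hs', hB', Function.update_apply]
    split_ifs
    · exact hK
    · exact hR
    · exact hm.abs.bound b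
  have hstep : s.IsStep j ins om nm w v h s' := by
    refine ⟨?_, ?_, fun u hu => ⟨?_, ?_⟩, rfl, fun u hu => ?_, fun hon => ?_⟩
    · simp only [hs', hB', St.R]
      rw [Function.update_of_ne (by omega), Function.update_self]
    · simp only [hs', hB', St.K, Function.update_self]
    · simp only [hs', hB', St.R]
      rw [Function.update_of_ne (by omega), Function.update_of_ne (by omega)]
    · simp only [hs', hB', St.K]
      rw [Function.update_of_ne (by omega), Function.update_of_ne (by omega)]
    · rw [hm.abs.fk, hs', harr₃ 5 (by decide)]
      exact haw₂ _ _ (by omega) (fun _ => by omega)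
    · rw [hm.abs.fk, hs', harr₃ 5 (by decide)]
      exact haw₂ _ _ (by omega) (fun h => absurd hon h)
  have h6₃ : m₃.reg 6 = v := by rw [hreg₃ 6 (by decide), h6₂]
  have h12₃ : m₃.reg 12 = (markE 6).eval m := by
    rw [hreg₃ 12 (by decide), hreg₂ 12 (by decide)]
    simp [hm₁]
  have h7₃ : m₃.reg 7 = l := by
    rw [hreg₃ 7 (by decide), hreg₂ 7 (by decide)]
    simp [hm₁, hm.r7]
  have hmark₃ := habs.markE_fits hMW hb₃ h6₃ hvM
  -- With truncated subtraction, 1 - (1 - n) is 1 for positive n and 0 for n = 0.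
  have hflag : ∀ {n : ℕ} {p : Prop} [Decidable p], (0 < n ↔ p) → 1 - (1 - n) = (decide p).toNat := by
    intro n p _ h
    by_cases hp : p
    · have := h.2 hp
      simp only [hp, decide_true, Bool.toNat_true]
      omega
    · have := mt h.1 hp
      simp only [hp, decide_false, Bool.toNat_false]
      omega
  set om' := decide (s.Marked v) with hom'
  set nm' := decide (s'.Marked v) with hnm'
  set tog' := (tog || decide ¬ (v ∈ s.O ↔ v ∈ s'.O)) with htog'
  set TG' : ℕ → Bool := fun i => if i = l then needs (v ∈ s.O) (v ∈ s'.O) tog else TG i with hTG'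
  have hI' := hI.step (s' := s') hc hj hP hP' hl hw hstep (om' := om') (nm' := nm') (tog' := tog')
    (TG' := TG') (by simp [hom', hvdef]) (by simp [hnm', hvdef]) rfl
    (fun i hi => by simp [hTG', hi.ne]) (by rw [hTG']; exact if_pos rfl)
  have hlM := hS.level
  have h1 : 1 ≤ W := by omega
  refine Prog.Runs.seq (T := 70) (Q := fun m₄ => ∃ s' om' nm' tog' TG',
      PassInv H P home s₀ x₀ j ins (l + 1) s' om' nm' tog' TG' (X₁ + rounds s om nm w) ∧
      PassMem H fac x₀ j ins M W asg (l + 1) m₄ s' om' nm' tog' TG') (Prog.Runs.and_exec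
      (Q := fun m₄ => m₄.reg 9 = om'.toNat ∧ m₄.reg 10 = nm'.toNat ∧ m₄.reg 8 = v ∧
        m₄.reg 6 = m₃.arr 7 v ∧ m₄.reg 7 = l + 1) (Prog.wp.runs ?_ (by decide)) ?_)
    fun m₄ h => ⟨_, _, .skip _, le_rfl, h⟩
  · refine ⟨⟨h1, h1, hb₃.1 _⟩, ⟨h1, h1, ?_⟩, ?_, ⟨?_, ?_⟩, ⟨?_, h1, ?_⟩, ?_⟩
    · exact Abs.markE_fits (m := m₃.setReg 9 (1 - (1 - m₃.reg 12)))
        (habs.congr rfl rfl rfl rfl rfl) hMW (hb₃.setReg ((Nat.sub_le _ _).trans h1))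
        (by simp [h6₃]) hvM
    · simpa [WExp.Fits] using hb₃.1 _
    · simpa [WExp.Fits] using hb₃.1 _
    · simpa [WExp.eval] using hb₃.2 _ _
    · simpa [WExp.Fits] using hb₃.1 _
    · simp [WExp.eval, h7₃]
      omega
    · have e : (markE 6).eval (m₃.setReg 9 (1 - (1 - m₃.reg 12))) = (markE 6).eval m₃ := by
        simp [markE, WExp.eval]
      simp only [WExp.eval, Mem.setReg_reg, e]
      simp only [h12₃, hflag (hm.abs.markE_pos h6), hflag (habs.markE_pos h6₃), h7₃, h6₃]
      refine ⟨?_, ?_, ?_, ?_, ?_⟩ <;> simp [hom', hnm', h6₃]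
  · rintro t m₄ he - ⟨h9₄, h10₄, h8₄, h6₄, h7₄⟩
    refine ⟨s', om', nm', tog', TG', hI', ?_⟩
    have harr₄ : m₄.arr = m₃.arr := funext fun a => he.arr_eq (by simp [advance, Prog.block, Prog.arrs])
    have hreg : ∀ x, x ∉ advance.regs → x ∉ toggle.regs → x ∉ relist.regs → x ≠ 12 →
        m₄.reg x = m.reg x := by
      intro x h₁ h₂ h₃ h₄
      rw [he.reg_eq h₁, hreg₃ x h₂, hreg₂ x h₃]
      simp [hm₁, h₄]
    have harr : ∀ a, a ∉ toggle.arrs → a ∉ relist.arrs → m₄.arr a = m.arr a := by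
      intro a h₁ h₂
      rw [harr₄, harr₃ a h₁, harr₂ a h₂]
    refine ⟨he.bdd hb₃, hm.tree.congr (hreg 4 (by decide) (by decide) (by decide) (by decide))
      (harr 7 (by decide) (by decide)) (harr 8 (by decide) (by decide))
      (harr 9 (by decide) (by decide)) ((he.cost_eq (by decide)).trans hcost₃),
      habs.congr (by rw [harr₄]) (by rw [harr₄]) (by rw [harr₄]) (by rw [harr₄]) (by rw [harr₄]),
      (hreg 1 (by decide) (by decide) (by decide) (by decide)).trans hm.r1,
      (hreg 2 (by decide) (by decide) (by decide) (by decide)).trans hm.r2,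
      h7₄, fun hl' => ?_, fun i hi => ?_, h9₄, h10₄, ?_, fun i hi => ?_,
      (harr 2 (by decide) (by decide)).trans hm.asg⟩
    · rw [h6₄, harr₃ 7 (by decide), harr₂ 7 (by decide)]
      exact hm.tree.par x₀ l hl'
    · rw [h8₄, hvdef, show i = l by omega]
    · rw [he.reg_eq (by decide), h11₃]
    · rw [harr₄, h10₃]
      by_cases hil : i = l
      · subst hil
        simp [hTG', hvdef, hs']
      · rw [if_neg (PassInv.path_ne hl i (by omega)).symm, harr₂ 10 (by decide), hm.tg i (by omega)]
        simp [hTG', hil]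

end

/-! ### The second pass -/

theorem Mem.setReg_setReg (m : Mem) (x u v : ℕ) : (m.setReg x u).setReg x v = m.setReg x v := by
  simp [Mem.setReg]

/-- Finds the owner that serves the vertex in register `6` and stores its facility in register
`16`. -/
def find : Prog := .block [
  .setReg 15 (.reg 6),
  .loop (.eq (markE 15) (.const 0)) (.setReg 15 (.read 7 (.reg 15))),
  .loop (.eq (.read 12 (.reg 15)) (.const 0))
    (.setReg 15 (.read 5 (prE (.add (.mul (.const 2) (.reg 15)) (.const 1)) (.const 0)))),
  .setReg 16 (.read 9 (.reg 15))]

/-- Renews the assignment of the residual clients of the vertex in register `6`. -/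
def renew : Prog :=
  .ite (.and (.not (.eq (.read 10 (.reg 6)) (.const 0))) (.lt (.const 0) cntE))
    (.block [find, forEach 6 (.setArr 2 (.reg 21) (.reg 16))]) .skip

/-- The second pass: renews the assignments along the path of the leaf in register `3`. -/
def passTwo : Prog := .block [
  .setReg 6 (.reg 3), .setReg 7 (.const 0),
  .loop (.lt (.reg 7) (.add (.reg 4) (.const 1)))
    (.block [renew, .setReg 6 (.read 7 (.reg 6)), .setReg 7 (.add (.reg 7) (.const 1))])]

section

variable {X : Type} {H : Hier X} {P : Finset ℕ} {home : ℕ → X} {s₀ s : St} {x₀ : X} {j : ℕ}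
  {ins : Bool} {l : ℕ} {om nm tog : Bool} {TG : ℕ → Bool} {X₁ : ℕ} {fac asg : ℕ → ℕ} {M W : ℕ}
  {m : Mem}

theorem passOne_runs (hS : SmallHier H M W) (hc : Consistent H P home s) (hj : home j = x₀)
    (hP : ins = true → j ∉ P) (hP' : ins = false → j ∈ P) (hjM : j < M)
    (hb : m.Bdd W) (ht : TreeMem m H fac) (ha : Abs m s fac M) (h1 : m.reg 1 = (!ins).toNat)
    (h2 : m.reg 2 = j) (h3 : m.reg 3 = H.anc x₀ 0) :
    ∃ T, passOne.Runs W m T fun m' => ∃ s' om nm tog TG X₁,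
      PassInv H P home s x₀ j ins (H.L + 1) s' om nm tog TG X₁ ∧
      PassMem H fac x₀ j ins M W (m.arr 2) (H.L + 1) m' s' om nm tog TG ∧
      T ≤ 460 * (H.L + 2) + 200 * X₁ := by
  set m₁ := ((((m.setReg 6 (m.reg 3)).setReg 7 0).setReg 9 0).setReg 10 0).setReg 11 0 with hm₁
  have hb₁ : m₁.Bdd W := ((((hb.setReg (hb.1 3)).setReg (Nat.zero_le _)).setReg
    (Nat.zero_le _)).setReg (Nat.zero_le _)).setReg (Nat.zero_le _)
  have hWM := hS.word
  have hLM := hS.level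
  obtain ⟨t, t₁, m₂, he, ht₁, s', om, nm, tog, TG, X₁, hI, hm, hX⟩ := Prog.loop_runs (W := W)
    (m := m₁) (b := .lt (.reg 7) (.add (.reg 4) (.const 1))) (p := stepUp)
    (fun l t m' => ∃ s' om nm tog TG X₁,
      PassInv H P home s x₀ j ins l s' om nm tog TG X₁ ∧
      PassMem H fac x₀ j ins M W (m.arr 2) l m' s' om nm tog TG ∧
      t ≤ 460 * l + 200 * X₁) (H.L + 1)
    ⟨s, false, false, false, fun _ => false, 0, PassInv.start hc hj, {
      bdd := hb₁
      tree := ht.congr (by simp [hm₁]) rfl rfl rfl rfl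
      abs := ha.congr rfl rfl rfl rfl rfl
      r1 := by simp [hm₁, h1]
      r2 := by simp [hm₁, h2]
      r7 := by simp [hm₁]
      r6 := fun _ => by simp [hm₁, h3]
      r8 := fun i hi => by omega
      r9 := by simp [hm₁]
      r10 := by simp [hm₁]
      r11 := by simp [hm₁]
      tg := fun i hi => by omega
      asg := rfl }, by omega⟩
    (by
      rintro l t m' hl ⟨s', om, nm, tog, TG, X₁, hI, hm, ht⟩
      have h4 := hm.tree.top
      refine ⟨⟨hm.bdd.1 _, hm.bdd.1 _, ?_, ?_⟩, ?_, ?_⟩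
      · show 1 ≤ W
        omega
      · simp only [WExp.eval, h4]
        omega
      · simpa only [Test.Holds, WExp.eval, h4, hm.r7] using hl
      · obtain ⟨w, hw⟩ := stepUp_runs hS hc hj hP hP' hjM (by omega) hI hm
        refine ⟨_, hw.mono le_rfl ?_⟩
        rintro m'' ⟨s'', om', nm', tog', TG', hI', hm'⟩
        refine ⟨s'', om', nm', tog', TG', _, hI', hm', ?_⟩
        simp only [Test.time, WExp.time]
        linarith)
    (by
      rintro t m' ⟨s', om, nm, tog, TG, X₁, hI, hm, ht⟩
      have h4 := hm.tree.top
      refine ⟨⟨hm.bdd.1 _, hm.bdd.1 _, ?_, ?_⟩, ?_⟩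
      · show 1 ≤ W
        omega
      · simp only [WExp.eval, h4]
        omega
      · simp only [Test.Holds, WExp.eval, h4, hm.r7]
        exact lt_irrefl _)
  refine ⟨t + 20, _, m₂, .seq (.setReg _ _ _ (hb.1 _)) (.seq (.setReg _ _ _ (Nat.zero_le _))
    (.seq (.setReg _ _ _ (Nat.zero_le _)) (.seq (.setReg _ _ _ (Nat.zero_le _))
    (.seq (.setReg _ _ _ (Nat.zero_le _)) (.seq he (.skip _)))))), ?_, s', om, nm, tog, TG, X₁,
    hI, hm, ?_⟩
  · simp only [Test.time, WExp.time] at ht₁ ⊢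
    omega
  · linarith

/-- The loop follows the recursion of `rep` one level at a time. Position 0 of the list of marked
children holds a genuine child whenever the current vertex is marked and not an owner. -/
theorem descend_runs (hS : SmallHier H M W) (hc : Consistent H P home s) (ha : Abs m s fac M)
    (hb : m.Bdd W) :
    ∀ i (x : X), i ≤ H.L → s.Marked (H.anc x i) →
    (Prog.loop (.eq (.read 12 (.reg 15)) (.const 0)) (.setReg 15 (.read 5
      (prE (.add (.mul (.const 2) (.reg 15)) (.const 1)) (.const 0))))).Runs W
      (m.setReg 15 (H.anc x i)) (4 + 30 * i)
      fun m' => ∃ y, ∃ i' ≤ H.L, m' = m.setReg 15 (H.anc y i') ∧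
        rep fac s i (H.anc x i) = fac (H.anc y i') := by
  have hmem : ∀ x i, i ≤ H.L → (m.setReg 15 (H.anc x i)).Bdd W := fun x i hi =>
    hb.setReg (by have := hS.ids _ (H.anc_mem x i hi); have := hS.word; omega)
  have hfit : ∀ x i, i ≤ H.L → (Test.eq (.read 12 (.reg 15)) (.const 0)).Fits W
      (m.setReg 15 (H.anc x i)) := fun x i hi => 
    ⟨⟨(hmem x i hi).1 _, hb.2 _ _⟩, Nat.zero_le _⟩
  have hhold : ∀ x i, (Test.eq (.read 12 (.reg 15)) (.const 0)).Holds
      (m.setReg 15 (H.anc x i)) ↔ H.anc x i ∉ s.O := by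
    intro x i
    simp [Test.Holds, WExp.eval, ha.owners.own]
  have hdone : ∀ i (x : X), i ≤ H.L → H.anc x i ∈ s.O →
      (Prog.loop (.eq (.read 12 (.reg 15)) (.const 0)) (.setReg 15 (.read 5
      (prE (.add (.mul (.const 2) (.reg 15)) (.const 1)) (.const 0))))).Runs W
      (m.setReg 15 (H.anc x i)) (4 + 30 * i)
      fun m' => ∃ y, ∃ i' ≤ H.L, m' = m.setReg 15 (H.anc y i') ∧
        rep fac s i (H.anc x i) = fac (H.anc y i') := by
    intro i x hi ho
    exact ⟨_, _, .loopFalse _ (hfit x i hi) (mt (hhold x i).1 (not_not.2 ho)),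
      by simp only [Test.time, WExp.time]; omega, x, i, hi, rfl, rep_of_mem ho i⟩
  intro i
  induction i with
  | zero =>
    rintro x hi (ho | ⟨w, hw⟩)
    · exact hdone 0 x hi ho
    · obtain ⟨y, i', h₁, -⟩ := (hc.kids x 0 hi w).1 hw
      omega
  | succ i ih =>
    intro x hi hm
    by_cases ho : H.anc x (i + 1) ∈ s.O
    · exact hdone _ x hi ho
    have hk := ha.firstKid _ (hm.resolve_left ho)
    obtain ⟨y, i', h₁, h₂, h₃, h₄⟩ := (hc.kids x (i + 1) hi _).1 hk
    obtain rfl : i = i' := by omega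
    have hfk : m.arr 5 (pr (2 * H.anc x (i + 1) + 1) 0) = H.anc y i := by rw [← ha.fk, h₂]
    rw [h₂] at h₄
    obtain ⟨t, m', he, ht, z, i', hi', hm', hz⟩ := ih y (by omega) h₄
    have hvM := hS.ids _ (H.anc_mem x (i + 1) hi)
    have hWM := hS.word
    refine ⟨_, m', .loopTrue (hfit x _ hi) ((hhold x _).2 ho) (.setReg _ _ _ ?_)
      (t' := t) ?_, ?_, z, i', hi', hm', ?_⟩
    · refine ⟨prE_fits (twice_fits hS.lt (hmem x _ hi) ?_).2 (Nat.zero_le _) ?_, hb.2 _ _⟩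
      · simpa using hvM
      · simp only [WExp.eval, Mem.setReg_reg, if_true]
        exact (pr_le (N := M) (by omega) (Nat.zero_le _)).trans hS.lt.le
    · simp only [WExp.eval, prE_eval, Mem.setReg_reg, if_true, Mem.setReg_arr, hfk,
        Mem.setReg_setReg]
      exact he
    · simp only [Test.time, WExp.time, prE]
      omega
    · rw [rep, if_neg ho, h₂]
      exact hz

/-- Two walks of at most L steps: upwards to the first marked vertex, then downwards to an owner. -/
theorem find_runs (hS : SmallHier H M W) (hc : Consistent H P home s) (ha : Abs m s fac M)
    (ht : TreeMem m H fac) (hb : m.Bdd W) {x : X} {k i : ℕ} (hk : k ≤ i) (hi : i ≤ H.L)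
    (h6 : m.reg 6 = H.anc x k) (hm : s.Marked (H.anc x i))
    (hn : ∀ i', k ≤ i' → i' < i → ¬ s.Marked (H.anc x i')) :
    find.Runs W m (60 * (H.L + 1)) fun m' => m'.reg 16 = rep fac s i (H.anc x i) := by
  have hmem : ∀ x i, i ≤ H.L → (m.setReg 15 (H.anc x i)).Bdd W := fun x i hi =>
    hb.setReg (by have := hS.ids _ (H.anc_mem x i hi); have := hS.word; omega)
  have hfit : ∀ x i, i ≤ H.L → (Test.eq (markE 15) (.const 0)).Fits W
      (m.setReg 15 (H.anc x i)) := fun x i hi =>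
    ⟨Abs.markE_fits (m := m.setReg 15 (H.anc x i)) (ha.congr rfl rfl rfl rfl rfl) hS.lt
      (hmem x i hi) (by simp) (hS.ids _ (H.anc_mem x i hi)), Nat.zero_le _⟩
  have hhold : ∀ x i, (Test.eq (markE 15) (.const 0)).Holds
      (m.setReg 15 (H.anc x i)) ↔ ¬ s.Marked (H.anc x i) := by
    intro x i
    rw [← (ha.congr (m' := m.setReg 15 (H.anc x i)) rfl rfl rfl rfl rfl).markE_pos (r := 15)
      (by simp), Nat.pos_iff_ne_zero, not_not]
    rfl
  obtain ⟨t, t₁, m₁, he₁, ht₁, rfl, htk⟩ := Prog.loop_runs (W := W) (m := m.setReg 15 (m.reg 6))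
    (b := .eq (markE 15) (.const 0)) (p := .setReg 15 (.read 7 (.reg 15)))
    (fun d t m' => m' = m.setReg 15 (H.anc x (k + d)) ∧ t = 14 * d) (i - k)
    ⟨by rw [h6, Nat.add_zero], rfl⟩
    (by
      rintro d t m' hd ⟨rfl, rfl⟩
      refine ⟨hfit x _ (by omega), (hhold x _).2 (hn _ (by omega) (by omega)), 3, ?_⟩
      refine ⟨_, _, .setReg _ _ _ ⟨(hmem x _ (by omega)).1 _, hb.2 _ _⟩, le_rfl, ?_, ?_⟩
      · simp only [WExp.eval, Mem.setReg_reg, if_true, Mem.setReg_arr, Mem.setReg_setReg]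
        rw [ht.par x _ (by omega)]
        rfl
      · simp only [Test.time, WExp.time, markE]
        ring)
    (by
      rintro t m' ⟨rfl, -⟩
      rw [Nat.add_sub_cancel' hk]
      exact ⟨hfit x i hi, mt (hhold x i).1 (not_not.2 hm)⟩)
  rw [Nat.add_sub_cancel' hk] at he₁
  obtain ⟨t₂, m₂, he₂, ht₂, y, i', hi', rfl, hrep⟩ := descend_runs hS hc ha hb i x hi hm
  refine ⟨_, _, .seq (.setReg _ _ _ (hb.1 _)) (.seq he₁ (.seq he₂ (.seq (.setReg _ _ _
    ⟨(hmem y i' hi').1 _, hb.2 _ _⟩) (.skip _)))), ?_, ?_⟩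
  · simp only [Test.time, WExp.time, markE] at ht₁ ⊢
    omega
  · simp [WExp.eval, hrep, ht.fac y i' hi']

/-- The memory during the second pass. -/
structure RenewMem (H : Hier X) (home : ℕ → X) (fac : ℕ → ℕ) (s : St) (x₀ : X) (M W : ℕ)
    (asg : ℕ → ℕ) (TG : ℕ → Bool) (l : ℕ) (m : Mem) : Prop where
  bdd : m.Bdd W
  tree : TreeMem m H fac
  abs : Abs m s fac M
  r7 : m.reg 7 = l
  r6 : l ≤ H.L → m.reg 6 = H.anc x₀ l
  tg : ∀ i ≤ H.L, m.arr 10 (H.anc x₀ i) = (TG i).toNat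
  asg : ∀ a, (m.arr 2 a = asg a ∧ ∀ i < l, TG i = true → a ∉ s.R (H.anc x₀ i)) ∨
    Serves H fac s (home a) (m.arr 2 a)

/-- All residual clients of a vertex have the same lowest marked ancestor: nothing on their paths is
marked below level `l`, and from level `l` on the paths coincide. So a single search serves the
whole list. -/
theorem renew_runs (hS : SmallHier H M W) (hc : Consistent H P home s) (hl : l ≤ H.L)
    (hm : RenewMem H home fac s x₀ M W asg TG l m) :
    renew.Runs W m (60 * (H.L + 2) + if TG l then 43 * (s.R (H.anc x₀ l)).card else 0) fun m' =>
      RenewMem H home fac s x₀ M W asg TG l m' ∧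
      ∀ a, (m'.arr 2 a = asg a ∧ ∀ i < l + 1, TG i = true → a ∉ s.R (H.anc x₀ i)) ∨
        Serves H fac s (home a) (m'.arr 2 a) := by
  have h6 := hm.r6 hl
  have hvM := hS.ids _ (H.anc_mem x₀ l hl)
  set v := H.anc x₀ l with hv
  have hcf : cntE.Fits W m := ⟨(twice_fits hS.lt hm.bdd (by omega)).1, hm.bdd.2 _ _⟩
  have hce : cntE.eval m = (s.R v).card := by simp [cntE, WExp.eval, h6, hm.abs.bags.card]
  have htg : m.arr 10 v = (TG l).toNat := hm.tg l hl
  refine Prog.Runs.mono (T := 12 + (60 * (H.L + 1) + ((20 +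
    if TG l then 43 * (s.R v).card else 0) + 1)))
    (Prog.Runs.ite ⟨⟨⟨hm.bdd.1 _, hm.bdd.2 _ _⟩, Nat.zero_le _⟩, Nat.zero_le _, hcf⟩ ?_ ?_)
    (by omega) fun _ h => h
  · rintro ⟨h₁, h₂⟩
    have hT : TG l = true := by
      cases h : TG l
      · exact (h₁ (by simp [WExp.eval, h6, htg, h, Test.Holds])).elim
      · rfl
    have hpos : 0 < (s.R v).card := by rw [← hce]; exact h₂
    -- A residual client proves that some client is present, so a marked vertex exists and the
    -- search ends. This is why `renew` tests for a nonempty list.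
    obtain ⟨a₀, ha₀⟩ := Finset.card_pos.1 hpos
    obtain ⟨haP, hanc₀, hnm₀⟩ := (hc.resid x₀ l hl a₀).1 ha₀
    obtain ⟨i, hi, hmi, hni⟩ := hc.exists_low ⟨a₀, haP⟩ (home a₀)
    have hli : l ≤ i := by
      by_contra h
      exact hnm₀ i (by omega) hmi
    have hup : ∀ a ∈ s.R v, ∀ i', l ≤ i' → i' ≤ H.L → H.anc (home a) i' = H.anc x₀ i' :=
      fun a ha i' h₁ h₂ => H.anc_mono h₁ h₂ ((hc.resid x₀ l hl a).1 ha).2.1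
    have hserve : ∀ a ∈ s.R v, Serves H fac s (home a) (rep fac s i (H.anc x₀ i)) := by
      intro a ha
      refine ⟨i, hi, ?_, fun i' hi' => ?_, by rw [hup a ha i hli hi]⟩
      · rw [hup a ha i hli hi, ← hup a₀ ha₀ i hli hi]
        exact hmi
      · by_cases h : i' < l
        · exact ((hc.resid x₀ l hl a).1 ha).2.2 i' h
        · rw [hup a ha i' (by omega) (by omega), ← hup a₀ ha₀ i' (by omega) (by omega)]
          exact hni i' hi'
    refine ((find_runs hS hc hm.abs hm.tree hm.bdd hli hi h6 (x := x₀)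
      (by rw [← hup a₀ ha₀ i hli hi]; exact hmi) (fun i' h₁ h₂ => by
        rw [← hup a₀ ha₀ i' h₁ (by omega)]; exact hni i' h₂)).and_exec
      (Q' := fun m₁ => m₁.Bdd W ∧ (∀ x ∉ find.regs, m₁.reg x = m.reg x) ∧ m₁.arr = m.arr ∧
        m₁.cost = m.cost ∧ m₁.reg 16 = rep fac s i (H.anc x₀ i)) fun t m₁ he _ hq =>
        ⟨he.bdd hm.bdd, fun x hx => he.reg_eq hx, funext fun a => he.arr_eq (by
          simp [find, Prog.block, Prog.arrs]), funext fun a => he.cost_eq (by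
          simp [find, Prog.block, Prog.costs]), hq⟩).seq ?_
    rintro m₁ ⟨hb₁, hreg₁, harr₁, hcost₁, h16⟩
    rw [if_pos hT]
    have hfe := forEach_runs (r := 6) (T := 3) (W := W) (M := M) (m₀ := m₁) (B := s.B) (v := v)
      (by decide) (by decide) (p := .setArr 2 (.reg 21) (.reg 16)) (by decide) hS.lt hb₁
      (hm.abs.bags.congr (by rw [harr₁]) (by rw [harr₁]) (by rw [harr₁])) hvM
      (by rw [hreg₁ 6 (by decide)]; exact h6) (hm.abs.bound _)
      (fun D m' => m'.reg 16 = m₁.reg 16 ∧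
        ∀ a, m'.arr 2 a = if a ∈ D then m₁.reg 16 else m₁.arr 2 a)
      ⟨rfl, by simp⟩ ?_ ?_
    · refine (hfe.and_exec (Q' := fun m₂ => RenewMem H home fac s x₀ M W asg TG l m₂ ∧
        ∀ a, (m₂.arr 2 a = asg a ∧ ∀ i < l + 1, TG i = true → a ∉ s.R (H.anc x₀ i)) ∨
        Serves H fac s (home a) (m₂.arr 2 a)) ?_).seq (T' := 1)
        (fun m₂ h => ⟨_, _, .skip _, le_rfl, h⟩) |>.mono (by simp only [St.R]; omega) fun _ h => h
      rintro t m₂ he - ⟨-, hasg⟩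
      have hasg' : ∀ a, (m₂.arr 2 a = asg a ∧ ∀ i < l + 1, TG i = true → a ∉ s.R (H.anc x₀ i)) ∨
          Serves H fac s (home a) (m₂.arr 2 a) := by
        intro a
        rw [hasg a]
        split_ifs with ha
        · rw [h16]
          exact Or.inr (hserve a ha)
        · rw [harr₁]
          refine (hm.asg a).imp (fun h => ⟨h.1, fun i hi => ?_⟩) id
          rcases Nat.lt_succ_iff_lt_or_eq.1 hi with hi | rfl
          · exact h.2 i hi
          · exact fun _ => ha
      have hreg : ∀ x, x ∉ find.regs → x ∉ (forEach 6 (.setArr 2 (.reg 21) (.reg 16))).regs →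
          m₂.reg x = m.reg x := fun x h₁ h₂ => by rw [he.reg_eq h₂, hreg₁ x h₁]
      have harr : ∀ a, a ∉ (forEach 6 (.setArr 2 (.reg 21) (.reg 16))).arrs →
          m₂.arr a = m.arr a := fun a h₂ => by rw [he.arr_eq h₂, harr₁]
      refine ⟨⟨he.bdd hb₁, hm.tree.congr (hreg 4 (by decide) (by decide)) (harr 7 (by decide))
        (harr 8 (by decide)) (harr 9 (by decide)) (by rw [he.cost_eq (by decide), hcost₁]),
        hm.abs.congr (harr 3 (by decide)) (harr 4 (by decide)) (harr 5 (by decide))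
        (harr 6 (by decide)) (harr 12 (by decide)), ?_, ?_, ?_, ?_⟩, hasg'⟩
      · rw [hreg 7 (by decide) (by decide), hm.r7]
      · intro hl
        rw [hreg 6 (by decide) (by decide), hm.r6 hl]
      · rw [harr 10 (by decide)]
        exact hm.tg
      · exact fun a => (hasg' a).imp (fun h => ⟨h.1, fun i hi => h.2 i (by omega)⟩) id
    · rintro D m' x c hx ⟨h₁, h₂⟩
      refine ⟨?_, h₂⟩
      rcases hx with rfl | rfl <;> simp [h₁]
    · rintro D a m' hb' hr6 h4 h5 hD ha haD ⟨h₁, h₂⟩ h21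
      refine ⟨_, _, .setArr _ _ _ _ (hb'.1 _) (hb'.1 _), le_rfl, ⟨by simp [h₁], fun b => ?_⟩,
        by simpa using hr6, by simpa using h4, by simpa using h5⟩
      simp only [WExp.eval, Mem.setArr_arr, true_and, h21, h₁, h₂, Finset.mem_insert]
      by_cases hba : b = a <;> simp [hba]
  · intro h
    refine ⟨_, _, .skip _, by omega, hm, fun a => (hm.asg a).imp (fun h' => ⟨h'.1, fun i hi => ?_⟩) id⟩
    rcases Nat.lt_succ_iff_lt_or_eq.1 hi with hi | rfl
    · exact h'.2 i hi
    · intro hT ha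
      refine h ⟨?_, ?_⟩
      · simp [Test.Holds, WExp.eval, h6, htg, hT]
      · simp only [Test.Holds, hce]
        exact Finset.card_pos.2 ⟨a, ha⟩

/-- A search of length O(L) at up to L + 1 vertices gives the quadratic term; the sum counts
rewritten assignments and is paid by the potential. -/
theorem passTwo_runs (hS : SmallHier H M W) (hc : Consistent H P home s) (hb : m.Bdd W)
    (ht : TreeMem m H fac) (ha : Abs m s fac M) (h3 : m.reg 3 = H.anc x₀ 0)
    (htg : ∀ i ≤ H.L, m.arr 10 (H.anc x₀ i) = (TG i).toNat) :
    passTwo.Runs W m (80 * (H.L + 2) ^ 2 +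
      43 * ∑ i ∈ Finset.range (H.L + 1), if TG i then (s.R (H.anc x₀ i)).card else 0) fun m' =>
      RenewMem H home fac s x₀ M W (m.arr 2) TG (H.L + 1) m' := by
  have hWM := hS.word
  have hLM := hS.level
  set m₁ := (m.setReg 6 (m.reg 3)).setReg 7 0 with hm₁
  have hb₁ : m₁.Bdd W := (hb.setReg (hb.1 3)).setReg (Nat.zero_le _)
  obtain ⟨t, t₁, m₂, he, ht₁, hm, hX⟩ := Prog.loop_runs (W := W)
    (m := m₁) (b := .lt (.reg 7) (.add (.reg 4) (.const 1)))
    (p := .block [renew, .setReg 6 (.read 7 (.reg 6)), .setReg 7 (.add (.reg 7) (.const 1))])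
    (fun l t m' => RenewMem H home fac s x₀ M W (m.arr 2) TG l m' ∧
      t = l * (60 * (H.L + 2) + 13) +
        43 * ∑ i ∈ Finset.range l, if TG i then (s.R (H.anc x₀ i)).card else 0) (H.L + 1)
    ⟨{
      bdd := hb₁
      tree := ht.congr (by simp [hm₁]) rfl rfl rfl rfl
      abs := ha.congr rfl rfl rfl rfl rfl
      r7 := by simp [hm₁]
      r6 := fun _ => by simp [hm₁, h3]
      tg := htg
      asg := fun a => Or.inl ⟨rfl, fun i hi => by omega⟩ }, by simp⟩
    (by
      rintro l t m' hl ⟨hm, ht⟩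
      have h4 := hm.tree.top
      refine ⟨⟨hm.bdd.1 _, hm.bdd.1 _, ?_, ?_⟩, ?_, ?_⟩
      · show 1 ≤ W
        omega
      · simp only [WExp.eval, h4]
        omega
      · simpa only [Test.Holds, WExp.eval, h4, hm.r7] using hl
      · refine ⟨_, (renew_runs hS hc (by omega) hm).seq (T' := 8) ?_⟩
        rintro m'' ⟨hm'', hasg⟩
        refine ⟨_, _, .seq (.setReg _ _ _ ⟨hm''.bdd.1 _, hm''.bdd.2 _ _⟩) (.seq (.setReg _ _ _
          ⟨?_, ?_, ?_⟩) (.skip _)), le_rfl, ⟨?_, ?_, ?_, ?_, ?_, ?_, ?_⟩, ?_⟩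
        · simpa [WExp.Fits] using hm''.bdd.1 _
        · show 1 ≤ W
          omega
        · simp [WExp.eval, hm''.r7]
          omega
        · exact (hm''.bdd.setReg (hm''.bdd.2 _ _)).setReg (by simp [WExp.eval, hm''.r7]; omega)
        · exact hm''.tree.congr (by simp) rfl rfl rfl rfl
        · exact hm''.abs.congr rfl rfl rfl rfl rfl
        · simp [WExp.eval, hm''.r7]
        · intro hl
          simp [WExp.eval, hm''.r6 (by omega), hm''.tree.par x₀ l (by omega)]
        · exact hm''.tg
        · exact hasg
        · rw [ht, Finset.sum_range_succ]
          simp only [Test.time, WExp.time]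
          split_ifs <;> ring)
    (by
      rintro t m' ⟨hm, ht⟩
      have h4 := hm.tree.top
      refine ⟨⟨hm.bdd.1 _, hm.bdd.1 _, ?_, ?_⟩, ?_⟩
      · show 1 ≤ W
        omega
      · simp only [WExp.eval, h4]
        omega
      · simp only [Test.Holds, WExp.eval, h4, hm.r7]
        exact lt_irrefl _)
  refine ⟨_, m₂, .seq (.setReg _ _ _ (hb.1 _)) (.seq (.setReg _ _ _ (Nat.zero_le _))
    (.seq he (.skip _))), ?_, hm⟩
  simp only [Test.time, WExp.time] at ht₁ ⊢
  nlinarith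

end

/-! ### Handling a request -/

/-- Finds the facility for the arrived client. -/
def settle : Prog := .block [.setReg 6 (.reg 3), find, .setArr 2 (.reg 2) (.reg 16)]

/-- Handles a request. -/
def serve : Prog := .block [
  .ite (.eq (.reg 1) (.const 0)) (.setArr 13 (.reg 2) (.reg 3)) (.setReg 3 (.read 13 (.reg 2))),
  passOne, passTwo, .ite (.eq (.reg 1) (.const 0)) settle .skip]

/-- The memory between two requests. -/
structure Ready {X : Type} (H : Hier X) (fac : ℕ → ℕ) (M : ℕ) (P : Finset ℕ) (home : ℕ → X)
    (m : Mem) (s : St) : Prop where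
  tree : TreeMem m H fac
  abs : Abs m s fac M
  cons : Consistent H P home s
  asg : ∀ a ∈ P, Serves H fac s (home a) (m.arr 2 a)
  home : ∀ a ∈ P, m.arr 13 a = H.anc (home a) 0

section

variable {X : Type} {H : Hier X} {P : Finset ℕ} {home home' : ℕ → X} {s : St} {x₀ : X} {j : ℕ}
  {ins : Bool} {fac : ℕ → ℕ} {M W : ℕ} {m : Mem}

theorem Consistent.congr (h : Consistent H P home s) (hh : ∀ a ∈ P, home' a = home a) :
    Consistent H P home' s where
  resid x i hi a := by
    rw [h.resid x i hi a]
    refine and_congr_right fun ha => ?_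
    rw [hh a ha]
  kids := h.kids
  thresh := h.thresh
  owner := h.owner

theorem Ready.congr (h : Ready H fac M P home m s) (hh : ∀ a ∈ P, home' a = home a) :
    Ready H fac M P home' m s :=
  ⟨h.tree, h.abs, h.cons.congr hh, fun a ha => hh a ha ▸ h.asg a ha,
    fun a ha => hh a ha ▸ h.home a ha⟩

/-- An arriving client has no earlier assignment to keep and need not be residual at any flagged
vertex, so it gets a search of its own. -/
theorem settle_runs (hS : SmallHier H M W) (hc : Consistent H P home s) (hjP : j ∈ P)
    (hx : home j = x₀) (hb : m.Bdd W) (ht : TreeMem m H fac) (ha : Abs m s fac M)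
    (h2 : m.reg 2 = j) (h3 : m.reg 3 = H.anc x₀ 0) :
    settle.Runs W m (60 * (H.L + 2)) fun m' => Serves H fac s x₀ (m'.arr 2 j) ∧
      ∀ a, a ≠ j → m'.arr 2 a = m.arr 2 a := by
  obtain ⟨i, hi, hm, hn⟩ := hc.exists_low ⟨j, hjP⟩ x₀
  refine Prog.Runs.mono (T := 2 + (60 * (H.L + 1) + 4)) (Prog.Runs.seq
    (Q := fun m₁ => m₁ = m.setReg 6 (m.reg 3)) ⟨_, _, .setReg _ _ _ (hb.1 _), le_rfl, rfl⟩ ?_)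
    (by omega) fun _ h => h
  rintro _ rfl
  have hb₁ : (m.setReg 6 (m.reg 3)).Bdd W := hb.setReg (hb.1 _)
  refine ((find_runs (m := m.setReg 6 (m.reg 3)) (k := 0) hS hc (ha.congr rfl rfl rfl rfl rfl)
    (ht.congr (by simp) rfl rfl rfl rfl) hb₁ (Nat.zero_le i) hi (x := x₀) (by simp [h3]) hm
    fun i' _ h => hn i' h).and_exec (Q' := fun m₂ => m₂.Bdd W ∧ m₂.reg 2 = j ∧
      m₂.arr 2 = m.arr 2 ∧ m₂.reg 16 = rep fac s i (H.anc x₀ i)) fun t m₂ he _ hq =>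
      ⟨he.bdd hb₁, by rw [he.reg_eq (by decide)]; simp [h2], he.arr_eq (by decide), hq⟩).seq ?_
  rintro m₂ ⟨hb₂, h2₂, harr, h16⟩
  refine ⟨_, _, .seq (.setArr _ _ _ _ (hb₂.1 _) (hb₂.1 _)) (.skip _), le_rfl, ?_, ?_⟩
  · simp only [WExp.eval, Mem.setArr_arr, h2₂, and_self, if_true, h16]
    exact ⟨i, hi, hm, hn, rfl⟩
  · intro a ha
    simp [WExp.eval, h2₂, ha, harr]

/-- Each unit of `X₁` costs 200 and each renewal 43. With `PassInv.pot_le` this yields the factor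
200 · 24 = 4800 for the potential and 200 · 60 (L + 1) of time; the two passes and the final search
raise the latter to at most 14000 (L + 1)². -/
theorem serve_runs (hS : SmallHier H M W) (hR : Ready H fac M P home m s) (hx : home j = x₀)
    (hP : ins = true → j ∉ P) (hP' : ins = false → j ∈ P) (hjM : j < M)
    (hb : m.Bdd W) (h1 : m.reg 1 = (!ins).toNat) (h2 : m.reg 2 = j)
    (h3 : ins = true → m.reg 3 = H.anc x₀ 0) :
    ∃ T, serve.Runs W m T fun m' => ∃ s', Ready H fac M (change P j ins) home m' s' ∧
      (T : ℝ) + 4800 * s'.pot H ≤ 14000 * ((H.L : ℝ) + 1) ^ 2 + 4800 * s.pot H := by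
  have htest : (Test.eq (.reg 1) (.const 0)).Holds m ↔ ins = true := by
    cases ins <;> simp [Test.Holds, WExp.eval, h1]
  have hpre : (Prog.ite (.eq (.reg 1) (.const 0)) (.setArr 13 (.reg 2) (.reg 3))
      (.setReg 3 (.read 13 (.reg 2)))).Runs W m (3 + 4) fun m₁ => m₁.Bdd W ∧
      m₁.reg 3 = H.anc x₀ 0 ∧ (∀ x ≠ 3, m₁.reg x = m.reg x) ∧ (∀ a ≠ 13, m₁.arr a = m.arr a) ∧
      m₁.cost = m.cost ∧ ∀ a ∈ change P j ins, m₁.arr 13 a = H.anc (home a) 0 := by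
    refine Prog.Runs.ite ⟨hb.1 _, Nat.zero_le _⟩ (fun h => ?_) fun h => ?_
    · have hi := htest.1 h
      refine ⟨_, _, .setArr _ _ _ _ (hb.1 _) (hb.1 _), by simp only [WExp.time]; omega,
        hb.setArr (hb.1 _), h3 hi, fun _ _ => rfl, fun a ha => ?_, rfl, fun a ha => ?_⟩
      · funext b
        simp [ha]
      · simp only [WExp.eval, Mem.setArr_arr, h2, true_and]
        split_ifs with haj
        · rw [haj, hx, h3 hi]
        · refine hR.home a ?_
          rw [change, if_pos hi, Finset.mem_insert] at ha
          exact ha.resolve_left haj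
    · have hi : ins = false := by simpa using mt htest.2 h
      refine ⟨_, _, .setReg _ _ _ ⟨hb.1 _, hb.2 _ _⟩, by simp only [WExp.time]; omega,
        hb.setReg (hb.2 _ _), ?_, fun x hx => by simp [hx], fun _ _ => rfl, rfl, fun a ha => ?_⟩
      · simp [WExp.eval, h2, hR.home j (hP' hi), hx]
      · refine hR.home a ?_
        rw [change, hi] at ha
        simp only [Bool.false_eq_true, if_false] at ha
        exact Finset.mem_of_mem_erase ha
  obtain ⟨t₁, m₁, he₁, ht₁, hb₁, h3₁, hreg₁, harr₁, hcost₁, hhome₁⟩ := hpre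
  have ht : TreeMem m₁ H fac := hR.tree.congr (hreg₁ 4 (by decide)) (harr₁ 7 (by decide))
    (harr₁ 8 (by decide)) (harr₁ 9 (by decide)) (by rw [hcost₁])
  have ha : Abs m₁ s fac M := hR.abs.congr (harr₁ 3 (by decide)) (harr₁ 4 (by decide))
    (harr₁ 5 (by decide)) (harr₁ 6 (by decide)) (harr₁ 12 (by decide))
  obtain ⟨T, t₂, m₂, he₂, ht₂, s', om, nm, tog, TG, X₁, hI, hm, hT⟩ := passOne_runs hS hR.cons hx
    hP hP' hjM hb₁ ht ha ((hreg₁ 1 (by decide)).trans h1) ((hreg₁ 2 (by decide)).trans h2) h3₁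
  have hc' := hI.finish
  have h3₂ : m₂.reg 3 = H.anc x₀ 0 := by rw [he₂.reg_eq (by decide), h3₁]
  obtain ⟨t₃, m₃, he₃, ht₃, hm₃⟩ := passTwo_runs (TG := TG) hS hc' hm.bdd hm.tree hm.abs h3₂
    fun i hi => hm.tg i (by omega)
  have h3₃ : m₃.reg 3 = H.anc x₀ 0 := by rw [he₃.reg_eq (by decide), h3₂]
  have h2₃ : m₃.reg 2 = j := by
    rw [he₃.reg_eq (by decide), he₂.reg_eq (by decide), hreg₁ 2 (by decide), h2]
  have h1₃ : m₃.reg 1 = (!ins).toNat := by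
    rw [he₃.reg_eq (by decide), he₂.reg_eq (by decide), hreg₁ 1 (by decide), h1]
  have h13₃ : m₃.arr 13 = m₁.arr 13 := by rw [he₃.arr_eq (by decide), he₂.arr_eq (by decide)]
  have hasg₂ : m₂.arr 2 = m.arr 2 := by rw [he₂.arr_eq (by decide), harr₁ 2 (by decide)]
  have hold : ∀ a ∈ P, a ∈ change P j ins → Serves H fac s' (home a) (m₃.arr 2 a) := by
    intro a haP haP'
    rcases hm₃.asg a with ⟨h, hno⟩ | h
    · rw [h, hasg₂]
      exact hI.serves hR.cons hm.abs.firstKid haP haP' (hR.asg a haP)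
        fun i hi => hno i (by omega)
    · exact h
  have htest₃ : (Test.eq (.reg 1) (.const 0)).Holds m₃ ↔ ins = true := by
    cases ins <;> simp [Test.Holds, WExp.eval, h1₃]
  have hlast : (Prog.ite (.eq (.reg 1) (.const 0)) settle .skip).Runs W m₃
      (3 + 60 * (H.L + 2)) fun m₄ => ∀ a ∈ change P j ins,
        Serves H fac s' (home a) (m₄.arr 2 a) := by
    refine Prog.Runs.ite ⟨hm₃.bdd.1 _, Nat.zero_le _⟩ (fun h => ?_) fun h => ?_
    · have hi := htest₃.1 h
      refine (settle_runs hS hc' (j := j) (by simp [change, hi]) hx hm₃.bdd hm₃.tree hm₃.abs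
        h2₃ h3₃).mono le_rfl ?_
      rintro m₄ ⟨h₁, h₂⟩ a ha
      by_cases haj : a = j
      · rw [haj, hx]
        exact h₁
      · rw [h₂ a haj]
        refine hold a ?_ ha
        rw [change, if_pos hi, Finset.mem_insert] at ha
        exact ha.resolve_left haj
    · have hi : ins = false := by simpa using mt htest₃.2 h
      refine ⟨_, _, .skip _, by omega, fun a ha => hold a ?_ ha⟩
      rw [change, hi] at ha
      simp only [Bool.false_eq_true, if_false] at ha
      exact Finset.mem_of_mem_erase ha
  obtain ⟨t₄, m₄, he₄, ht₄, hasg₄⟩ := hlast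
  refine ⟨t₁ + (t₂ + (t₃ + (t₄ + 1))), _, m₄, .seq he₁ (.seq he₂ (.seq he₃ (.seq he₄ (.skip _)))),
    le_rfl, s', ⟨?_, ?_, hc', hasg₄, fun a ha => ?_⟩, ?_⟩
  · exact hm₃.tree.congr (he₄.reg_eq (by decide)) (he₄.arr_eq (by decide))
      (he₄.arr_eq (by decide)) (he₄.arr_eq (by decide)) (he₄.cost_eq (by decide))
  · exact hm₃.abs.congr (he₄.arr_eq (by decide)) (he₄.arr_eq (by decide)) (he₄.arr_eq (by decide))
      (he₄.arr_eq (by decide)) (he₄.arr_eq (by decide))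
  · rw [he₄.arr_eq (by decide), h13₃]
    exact hhome₁ a ha
  · have hpot := hI.pot_le
    have h₁ : (t₁ + (t₂ + (t₃ + (t₄ + 1))) : ℕ) ≤ 7 + (460 * (H.L + 2) + 200 * X₁) +
        (80 * (H.L + 2) ^ 2 + 43 * ∑ i ∈ Finset.range (H.L + 1),
          if TG i then (s'.R (H.anc x₀ i)).card else 0) + (3 + 60 * (H.L + 2)) + 1 := by
      omega
    have h₂ : ((t₁ + (t₂ + (t₃ + (t₄ + 1))) : ℕ) : ℝ) ≤ 7 + (460 * (H.L + 2) + 200 * X₁) +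
        (80 * ((H.L : ℝ) + 2) ^ 2 + 43 * ∑ i ∈ Finset.range (H.L + 1),
          if TG i then ((s'.R (H.anc x₀ i)).card : ℝ) else 0) + (3 + 60 * (H.L + 2)) + 1 := by
      exact_mod_cast h₁
    have h₃ : 0 ≤ ∑ i ∈ Finset.range (H.L + 1),
        (if TG i then ((s'.R (H.anc x₀ i)).card : ℝ) else 0) :=
      Finset.sum_nonneg fun i _ => by split_ifs <;> positivity
    have h₄ : (0 : ℝ) ≤ H.L := Nat.cast_nonneg _
    nlinarith

end

/-! ### Reading the tree -/

/-- Registers a facility, whose number is in register `30`, at the vertex in register `34`. -/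
def enter : Prog := .block [
  .setArr 8 (.reg 34) (.reg 33),
  .ite (.and (.eq (.read 11 (.reg 34)) (.const 1))
      (.not (.costLt (.read 0 (.reg 30)) (.read 1 (.reg 34))))) .skip
    (.block [.setCost 1 (.reg 34) (.read 0 (.reg 30)), .setArr 9 (.reg 34) (.reg 30),
      .setArr 11 (.reg 34) (.const 1)])]

/-- Goes on to the next level. -/
def climb : Prog := .ite (.eq (.read 1 (.reg 31)) (.reg 0))
  (.block [.setReg 35 (.const 0), .setReg 4 (.reg 32), .setReg 36 (.reg 34)])
  (.block [.setReg 32 (.add (.reg 32) (.const 1)), .setReg 33 (.mul (.const 2) (.reg 33)),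
    .ite (.eq (.read 0 (.read 1 (.reg 31))) (.reg 32)) (.setReg 31 (.read 1 (.reg 31))) .skip,
    .setReg 37 (.add (.reg 31) (.mul (.reg 0) (.reg 32))), .setArr 7 (.reg 34) (.reg 37),
    .setReg 34 (.reg 37)])

/-- Registers a facility at all its ancestors. -/
def visit : Prog := .block [
  .setReg 31 (.reg 30), .setReg 32 (.const 0), .setReg 33 (.const 1), .setReg 34 (.reg 30),
  .setReg 35 (.const 1),
  .loop (.eq (.reg 35) (.const 1)) (.block [enter, climb])]

/-- Computes the hierarchy. -/
def build : Prog := .block [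
  .setReg 30 (.const 0),
  .loop (.lt (.reg 30) (.reg 0)) (.block [
    .ite (.eq (.read 0 (.reg 30)) (.const 0)) visit .skip,
    .setReg 30 (.add (.reg 30) (.const 1))]),
  .setCost 1 (.reg 36) (.word (.const 0)),
  .setReg 5 (.const 1)]

/-- The tree is stored in memory: `num` numbers the facilities, and `top x i` is the number of the
highest listed vertex above the facility `x` up to level `i`. -/
structure TreeInput {X : Type} (m : Mem) (H : Hier X) (num : X → ℕ) (top : X → ℕ → ℕ) (k : ℕ)
    (f : X → ℝ) : Prop where
  size : m.reg 0 = k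
  lt : ∀ x i, i ≤ H.L → top x i < k
  zero : ∀ x, top x 0 = num x
  leaf : ∀ i < k, m.arr 0 i = 0 ↔ ∃ x, num x = i
  cost : ∀ x, m.cost 0 (num x) = f x
  anc : ∀ x i, i ≤ H.L → H.anc x i = top x i + k * i
  next : ∀ x, ∀ i < H.L, m.arr 1 (top x i) < k
  last : ∀ x, m.arr 1 (top x H.L) = k
  step : ∀ x, ∀ i < H.L, top x (i + 1) =
    if m.arr 0 (m.arr 1 (top x i)) = i + 1 then m.arr 1 (top x i) else top x i

/-- The part of the hierarchy that consists of the pairs in `S` has been computed. -/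
structure Built {X : Type} (m : Mem) (H : Hier X) (num : X → ℕ) (f : X → ℝ) (S : X → ℕ → Prop) :
    Prop where
  pow : ∀ x i, i ≤ H.L → S x i → m.arr 8 (H.anc x i) = 2 ^ i
  par : ∀ x i, i < H.L → S x i → m.arr 7 (H.anc x i) = H.anc x (i + 1)
  seen : ∀ x i, i ≤ H.L → S x i → m.arr 11 (H.anc x i) = 1
  best : ∀ x i, i ≤ H.L → m.arr 11 (H.anc x i) = 1 → ∃ y, S y i ∧ H.anc y i = H.anc x i ∧
    m.arr 9 (H.anc x i) = num y ∧ m.cost 1 (H.anc x i) = f y ∧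
    ∀ z, S z i → H.anc z i = H.anc x i → f y ≤ f z
  root : ∀ x, S x H.L → m.reg 4 = H.L ∧ m.reg 36 = H.anc x H.L

section

variable {X : Type} {H : Hier X} {num : X → ℕ} {top : X → ℕ → ℕ} {k : ℕ} {f : X → ℝ} {M W : ℕ}
  {m : Mem} {S : X → ℕ → Prop} {x : X} {l : ℕ}

theorem TreeInput.congr {m' : Mem} (h : TreeInput m H num top k f) (h₀ : m'.reg 0 = m.reg 0)
    (h₁ : m'.arr 0 = m.arr 0) (h₂ : m'.arr 1 = m.arr 1) (h₃ : m'.cost 0 = m.cost 0) :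
    TreeInput m' H num top k f :=
  ⟨h₀ ▸ h.size, h.lt, h.zero, h₁ ▸ h.leaf, h₃ ▸ h.cost, h.anc, h₂ ▸ h.next, h₂ ▸ h.last,
    by rw [h₁, h₂]; exact h.step⟩

theorem Built.congr {m' : Mem} (h : Built m H num f S) (h4 : m'.reg 4 = m.reg 4)
    (h36 : m'.reg 36 = m.reg 36) (h7 : m'.arr 7 = m.arr 7) (h8 : m'.arr 8 = m.arr 8)
    (h9 : m'.arr 9 = m.arr 9) (h11 : m'.arr 11 = m.arr 11) (h1 : m'.cost 1 = m.cost 1) :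
    Built m' H num f S :=
  ⟨h8 ▸ h.pow, h7 ▸ h.par, h11 ▸ h.seen, by rw [h11, h9, h1]; exact h.best,
    by rw [h4, h36]; exact h.root⟩

/-- Array `11` distinguishes a registered cost from the initial content of memory. Either the
registered facility is at least as cheap and stays, or the new one takes its place. -/
theorem enter_runs (hb : m.Bdd W) (h1 : 1 ≤ W) {v x₀ : ℕ} (h34 : m.reg 34 = v)
    (h30 : m.reg 30 = x₀) :
    enter.Runs W m 40 fun m' => (∀ u, m'.arr 8 u = if u = v then m.reg 33 else m.arr 8 u) ∧
      ((m.arr 11 v = 1 ∧ ¬ m.cost 0 x₀ < m.cost 1 v ∧ m'.arr 11 = m.arr 11 ∧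
        m'.arr 9 = m.arr 9 ∧ m'.cost 1 = m.cost 1) ∨
      ((m.arr 11 v = 1 → m.cost 0 x₀ < m.cost 1 v) ∧
        (∀ u, m'.arr 11 u = if u = v then 1 else m.arr 11 u) ∧
        (∀ u, m'.arr 9 u = if u = v then x₀ else m.arr 9 u) ∧
        ∀ u, m'.cost 1 u = if u = v then m.cost 0 x₀ else m.cost 1 u)) := by
  refine Prog.wp.runs ?_ (by decide)
  subst h34 h30
  refine ⟨hb.1 _, hb.1 _, ⟨⟨⟨hb.1 _, ?_⟩, h1⟩, hb.1 _, hb.1 _⟩, fun h => ?_, fun h => ?_⟩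
  · simpa [WExp.eval] using hb.2 _ _
  · simp only [Test.Holds, WExp.eval, CExp.eval, Mem.setArr_arr, Mem.setArr_reg] at h
    refine ⟨fun u => by simp [WExp.eval], Or.inl ⟨by simpa using h.1, by simpa using h.2, ?_, ?_, ?_⟩⟩
    · funext u; simp
    · funext u; simp
    · funext u; simp
  · simp only [Test.Holds, WExp.eval, CExp.eval, Mem.setArr_arr, Mem.setArr_reg] at h
    refine ⟨hb.1 _, hb.1 _, hb.1 _, hb.1 _, hb.1 _, h1, fun u => ?_, Or.inr ⟨?_, fun u => ?_, fun u => ?_, fun u => ?_⟩⟩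
    · simp [WExp.eval]
    · simpa using h
    · simp [WExp.eval]
    · simp [WExp.eval]
    · simp [WExp.eval, CExp.eval]


/-- The memory when the facility `x` is about to be registered at level `l`. -/
structure VisitMem (m : Mem) (H : Hier X) (num : X → ℕ) (top : X → ℕ → ℕ) (x : X) (l : ℕ) :
    Prop where
  r30 : m.reg 30 = num x
  r31 : m.reg 31 = top x l
  r32 : m.reg 32 = l
  r33 : m.reg 33 = 2 ^ l
  r34 : m.reg 34 = H.anc x l
  r35 : m.reg 35 = 1

theorem climb_last_runs (hb : m.Bdd W) (hS : SmallHier H M W) (ht : TreeInput m H num top k f)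
    (hv : VisitMem m H num top x H.L) :
    climb.Runs W m 60 fun m' => m'.reg 35 = 0 ∧ m'.reg 4 = H.L ∧ m'.reg 36 = H.anc x H.L ∧
      m'.reg 30 = m.reg 30 ∧ m'.reg 0 = m.reg 0 ∧ m'.arr = m.arr ∧ m'.cost = m.cost := by
  refine Prog.wp.runs ?_ (by decide)
  refine ⟨⟨⟨hb.1 _, hb.2 _ _⟩, hb.1 _⟩, fun _ => ?_, fun h => ?_⟩
  · refine ⟨Nat.zero_le _, ?_, ?_, ?_⟩
    · simpa [WExp.Fits] using hb.1 _
    · simpa [WExp.Fits] using hb.1 _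
    · simp [WExp.eval, hv.r32, hv.r34, Prog.wp, Prog.block]
  · refine (h ?_).elim
    simp only [Test.Holds, WExp.eval, hv.r31, ht.last, ht.size]

/-- An ancestor at level i is numbered by the highest listed vertex up to that level plus k · i, so
unlisted vertices get numbers without being part of the input. The listed vertex advances exactly
when the level recorded for the next one is reached. -/
theorem climb_runs (hb : m.Bdd W) (hS : SmallHier H M W) (ht : TreeInput m H num top k f)
    (hv : VisitMem m H num top x l) (hl : l < H.L) :
    climb.Runs W m 60 fun m' => VisitMem m' H num top x (l + 1) ∧
      (∀ u, m'.arr 7 u = if u = H.anc x l then H.anc x (l + 1) else m.arr 7 u) ∧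
      m'.reg 4 = m.reg 4 ∧ m'.reg 36 = m.reg 36 ∧ m'.reg 0 = m.reg 0 := by
  have hWM := hS.word
  have hLM := hS.level
  have h1 : 1 ≤ W := by omega
  have hnext := ht.next x l hl
  have hM := hS.ids _ (H.anc_mem x (l + 1) hl)
  have hanc := ht.anc x (l + 1) hl
  have hkl : k * (l + 1) ≤ W := by omega
  have hpow : 2 * 2 ^ l ≤ M := by
    rw [← pow_succ']
    exact (Nat.pow_le_pow_right (by norm_num) hl).trans hS.pow
  have hstep := ht.step x l hl
  refine Prog.Runs.mono (T := 4 + 50) (Prog.Runs.ite ⟨⟨hb.1 _, hb.2 _ _⟩, hb.1 _⟩ (fun h => ?_)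
    fun _ => ?_) (by omega) fun _ h => h
  · simp only [Test.Holds, WExp.eval, hv.r31, ht.size] at h
    omega
  set m₁ := (m.setReg 32 (l + 1)).setReg 33 (2 * 2 ^ l) with hm₁
  have hb₁ : m₁.Bdd W := (hb.setReg (by omega)).setReg (by omega)
  have hnW : m.arr 1 (top x l) ≤ W := hb.2 _ _
  have hite : (Prog.ite (.eq (.read 0 (.read 1 (.reg 31))) (.reg 32))
      (.setReg 31 (.read 1 (.reg 31))) .skip).Runs W m₁ 10
      fun m₂ => m₂ = m₁.setReg 31 (top x (l + 1)) := by
    refine Prog.wp.runs ?_ (by decide)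
    refine ⟨⟨⟨⟨hb₁.1 _, hb₁.2 _ _⟩, hb₁.2 _ _⟩, hb₁.1 _⟩, fun h => ?_, fun h => ?_⟩
    · refine ⟨⟨hb₁.1 _, hb₁.2 _ _⟩, ?_⟩
      have h' : m.arr 0 (m.arr 1 (top x l)) = l + 1 := by
        simpa [Test.Holds, WExp.eval, hm₁, hv.r31] using h
      rw [hstep, if_pos h']
      simp [WExp.eval, hm₁, hv.r31]
    · have h' : ¬ m.arr 0 (m.arr 1 (top x l)) = l + 1 := by
        simpa [Test.Holds, WExp.eval, hm₁, hv.r31] using h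
      rw [hstep, if_neg h']
      show m₁ = _
      have h31 : m₁.reg 31 = top x l := by simp [hm₁, hv.r31]
      rw [← h31]
      simp [Mem.setReg]
  have hfirst : (Prog.setReg 32 (.add (.reg 32) (.const 1))).Runs W m 4
      fun m' => m' = m.setReg 32 (l + 1) :=
    ⟨_, _, .setReg _ _ _ ⟨hb.1 _, h1, by simp only [WExp.eval, hv.r32]; omega⟩, le_rfl,
      by simp [WExp.eval, hv.r32]⟩
  refine Prog.Runs.mono (T := 4 + (4 + (10 + 20))) (hfirst.seq ?_) (by omega) fun _ h => h
  rintro _ rfl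
  have hsecond : (Prog.setReg 33 (.mul (.const 2) (.reg 33))).Runs W (m.setReg 32 (l + 1)) 4
      fun m' => m' = m₁ := by
    refine ⟨_, _, .setReg _ _ _ ⟨?_, ?_, ?_⟩, le_rfl, ?_⟩
    · show 2 ≤ W
      omega
    · simpa [WExp.Fits] using hb.1 _
    · simp only [WExp.eval, Mem.setReg_reg]
      norm_num only [if_false]
      rw [hv.r33]
      omega
    · simp [hm₁, WExp.eval, hv.r33]
  refine hsecond.seq ?_
  rintro _ rfl
  refine hite.seq ?_
  rintro _ rfl
  refine Prog.wp.runs ?_ (by decide)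
  have htop := ht.lt x (l + 1) hl
  have hk : k ≤ W := ht.size ▸ hb.1 0
  have e : top x (l + 1) + k * (l + 1) = H.anc x (l + 1) := hanc.symm
  refine ⟨⟨?_, ⟨?_, ?_, ?_⟩, ?_⟩, ?_, ?_, ?_, ?_, ?_⟩
  · simp [WExp.Fits]
    omega
  · simpa [WExp.Fits, hm₁] using hb.1 _
  · simp [WExp.Fits, hm₁]
    omega
  · simpa [WExp.eval, hm₁, ht.size] using hkl
  · simp [WExp.eval, hm₁, ht.size, e]
    omega
  · simpa [WExp.Fits, hm₁] using hb.1 _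
  · simp [WExp.Fits, WExp.eval, hm₁, ht.size, e]
    omega
  · simp [WExp.Fits, WExp.eval, hm₁, ht.size, e]
    omega
  · constructor <;> simp [WExp.eval, hm₁, ht.size, e, hv.r30, hv.r35, pow_succ']
  · refine ⟨fun u => ?_, ?_, ?_, ?_⟩ <;> simp [WExp.eval, hm₁, ht.size, e, hv.r34]

/-- Registering `x` at level `l` enlarges the set of treated pairs by one. A parent pointer may be
overwritten by a visit from another facility, but with the same value, because equal classes have
equal parents. -/
theorem round_runs (hb : m.Bdd W) (hS : SmallHier H M W) (ht : TreeInput m H num top k f)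
    (hB : Built m H num f S) (hv : VisitMem m H num top x l) (hl : l ≤ H.L) :
    (Prog.block [enter, climb]).Runs W m 101 fun m' => m'.Bdd W ∧ TreeInput m' H num top k f ∧
      Built m' H num f (fun z i => S z i ∨ z = x ∧ i = l) ∧ m'.reg 30 = num x ∧
      (l < H.L → VisitMem m' H num top x (l + 1)) ∧ (l = H.L → m'.reg 35 = 0) := by
  have h1 : 1 ≤ W := by have := hS.word; omega
  set v := H.anc x l with hvdef
  have hlev : ∀ {z i}, i ≤ H.L → H.anc z i = v → i = l := fun hi h => H.anc_level _ _ _ _ hi hl h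
  have hnum : m.cost 0 (num x) = f x := ht.cost x
  refine Prog.Runs.mono (T := 40 + (60 + 1)) (((enter_runs hb h1 hv.r34 hv.r30).and_exec
    (Q' := fun m₁ => m₁.Bdd W ∧ m₁.reg = m.reg ∧ (∀ a ∉ enter.arrs, m₁.arr a = m.arr a) ∧
      m₁.cost 0 = m.cost 0 ∧ _) fun t m₁ he _ hq => ⟨he.bdd hb,
        funext fun x => he.reg_eq (by simp [enter, Prog.block, Prog.regs]),
        fun a ha => he.arr_eq ha, he.cost_eq (by decide), hq⟩).seq ?_) (by omega) fun _ h => h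
  rintro m₁ ⟨hb₁, hreg₁, harr₁, hcost₁, h8, hcase⟩
  rw [hnum] at hcase
  have ht₁ : TreeInput m₁ H num top k f := ht.congr (by rw [hreg₁]) (harr₁ 0 (by decide))
    (harr₁ 1 (by decide)) hcost₁
  have hv₁ : VisitMem m₁ H num top x l := by
    constructor <;> rw [hreg₁]
    exacts [hv.r30, hv.r31, hv.r32, hv.r33, hv.r34, hv.r35]
  have hpow₁ : ∀ z i, i ≤ H.L → S z i ∨ z = x ∧ i = l → m₁.arr 8 (H.anc z i) = 2 ^ i := by
    intro z i hi h
    rw [h8]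
    split_ifs with he
    · rw [hv.r33, hlev hi he]
    · rcases h with h | ⟨rfl, rfl⟩
      · exact hB.pow z i hi h
      · exact absurd rfl he
  have hseen₁ : ∀ z i, i ≤ H.L → S z i ∨ z = x ∧ i = l → m₁.arr 11 (H.anc z i) = 1 := by
    intro z i hi h
    rcases hcase with ⟨h11, -, e, -, -⟩ | ⟨-, e, -, -⟩
    · rw [e]
      rcases h with h | ⟨rfl, rfl⟩
      · exact hB.seen z i hi h
      · exact h11
    · rw [e]
      split_ifs with he
      · rfl
      · rcases h with h | ⟨rfl, rfl⟩
        · exact hB.seen z i hi h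
        · exact absurd rfl he
  have hbest₁ : ∀ z i, i ≤ H.L → m₁.arr 11 (H.anc z i) = 1 → ∃ y, (S y i ∨ y = x ∧ i = l) ∧
      H.anc y i = H.anc z i ∧ m₁.arr 9 (H.anc z i) = num y ∧ m₁.cost 1 (H.anc z i) = f y ∧
      ∀ z', (S z' i ∨ z' = x ∧ i = l) → H.anc z' i = H.anc z i → f y ≤ f z' := by
    intro z i hi h
    rcases hcase with ⟨-, hle, e11, e9, e1⟩ | ⟨hlt, e11, e9, e1⟩
    · rw [e11] at h
      obtain ⟨y, h₁, h₂, h₃, h₄, h₅⟩ := hB.best z i hi h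
      refine ⟨y, Or.inl h₁, h₂, by rw [e9, h₃], by rw [e1, h₄], ?_⟩
      rintro z' (h' | ⟨rfl, rfl⟩) he
      · exact h₅ z' h' he
      · rw [← h₄, ← he]
        exact not_lt.1 hle
    · rw [e11] at h
      by_cases he : H.anc z i = v
      · obtain rfl := hlev hi he
        refine ⟨x, Or.inr ⟨rfl, rfl⟩, he.symm, by rw [e9, if_pos he], by rw [e1, if_pos he], ?_⟩
        rintro z' (h' | ⟨rfl, -⟩) he'
        · have hs := hB.seen z' i hi h'
          obtain ⟨y, -, -, -, h₄, h₅⟩ := hB.best z' i hi hs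
          rw [he', he] at hs h₄
          exact (hlt hs).le.trans (h₄ ▸ h₅ z' h' rfl)
        · exact le_rfl
      · rw [if_neg he] at h
        obtain ⟨y, h₁, h₂, h₃, h₄, h₅⟩ := hB.best z i hi h
        refine ⟨y, Or.inl h₁, h₂, by rw [e9, if_neg he, h₃], by rw [e1, if_neg he, h₄], ?_⟩
        rintro z' (h' | ⟨rfl, rfl⟩) he'
        · exact h₅ z' h' he'
        · exact absurd he'.symm he
  have hpar₁ : ∀ z i, i < H.L → S z i → m₁.arr 7 (H.anc z i) = H.anc z (i + 1) := by
    rw [harr₁ 7 (by decide)]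
    exact hB.par
  have hroot₁ : ∀ z, S z H.L → m₁.reg 4 = H.L ∧ m₁.reg 36 = H.anc z H.L := by
    rw [hreg₁]
    exact hB.root
  rcases hl.lt_or_eq with hl' | rfl
  · refine ((climb_runs hb₁ hS ht₁ hv₁ hl').and_exec (Q' := fun m' => m'.Bdd W ∧
      TreeInput m' H num top k f ∧ Built m' H num f (fun z i => S z i ∨ z = x ∧ i = l) ∧
      m'.reg 30 = num x ∧ (l < H.L → VisitMem m' H num top x (l + 1)) ∧
      (l = H.L → m'.reg 35 = 0)) ?_).seq fun m' h => ⟨_, _, .skip _, le_rfl, h⟩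
    rintro t m₂ he - ⟨hv₂, h7, h4, h36, h0⟩
    have harr : ∀ a ∉ climb.arrs, m₂.arr a = m₁.arr a := fun a ha => he.arr_eq ha
    have hcost : m₂.cost = m₁.cost := funext fun a => he.cost_eq (by
      simp [climb, Prog.block, Prog.costs])
    refine ⟨he.bdd hb₁, ht₁.congr h0 (harr 0 (by decide)) (harr 1 (by decide)) (by rw [hcost]), ?_,
      hv₂.r30, fun _ => hv₂, fun h => absurd h hl'.ne⟩
    refine ⟨by rw [harr 8 (by decide)]; exact hpow₁, ?_, by rw [harr 11 (by decide)]; exact hseen₁,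
      ?_, ?_⟩
    · rintro z i hi h
      rw [h7]
      split_ifs with he'
      · obtain rfl := hlev hi.le he'
        exact H.anc_succ _ _ _ hi he'.symm
      · rcases h with h | ⟨rfl, rfl⟩
        · exact hpar₁ z i hi h
        · exact absurd rfl he'
    · rw [harr 11 (by decide), harr 9 (by decide), hcost]
      exact hbest₁
    · rintro z (h | ⟨-, h⟩)
      · rw [h4, h36]
        exact hroot₁ z h
      · exact absurd h hl'.ne'
  · refine ((climb_last_runs hb₁ hS ht₁ hv₁).and_exec (Q' := fun m' => m'.Bdd W ∧
      TreeInput m' H num top k f ∧ Built m' H num f (fun z i => S z i ∨ z = x ∧ i = H.L) ∧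
      m'.reg 30 = num x ∧ (H.L < H.L → VisitMem m' H num top x (H.L + 1)) ∧
      (H.L = H.L → m'.reg 35 = 0)) ?_).seq fun m' h => ⟨_, _, .skip _, le_rfl, h⟩
    rintro t m₂ he - ⟨h35, h4, h36, h30, h0, harr, hcost⟩
    refine ⟨he.bdd hb₁, ht₁.congr h0 (by rw [harr]) (by rw [harr]) (by rw [hcost]), ?_,
      h30.trans hv₁.r30, fun h => absurd h (lt_irrefl _), fun _ => h35⟩
    refine ⟨by rw [harr]; exact hpow₁, ?_, by rw [harr]; exact hseen₁, ?_, fun z _ => ⟨h4, ?_⟩⟩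
    · rintro z i hi (h | ⟨-, rfl⟩)
      · rw [harr]
        exact hpar₁ z i hi h
      · exact absurd hi (lt_irrefl _)
    · rw [harr, hcost]
      exact hbest₁
    · rw [h36]
      exact H.anc_top _ _

end

/-- The hierarchy has been computed; the facilities are numbered by `num` and have costs `f`. -/
structure Prepared {X : Type} (m : Mem) (H : Hier X) (num : X → ℕ) (f : X → ℝ) : Prop where
  top : m.reg 4 = H.L
  par : ∀ x, ∀ i < H.L, m.arr 7 (H.anc x i) = H.anc x (i + 1)
  pow : ∀ x, ∀ i ≤ H.L, m.arr 8 (H.anc x i) = 2 ^ i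
  best : ∀ x, ∀ i ≤ H.L, ∃ y, H.anc y i = H.anc x i ∧ m.arr 9 (H.anc x i) = num y ∧
    (∀ z, H.anc z i = H.anc x i → f y ≤ f z) ∧ (i < H.L → m.cost 1 (H.anc x i) = f y)
  root : ∀ x, m.cost 1 (H.anc x H.L) = 0

section

variable {X : Type} {H : Hier X} {num : X → ℕ} {top : X → ℕ → ℕ} {k : ℕ} {f : X → ℝ} {M W : ℕ}
  {m : Mem} {S S' : X → ℕ → Prop} {x : X} {l : ℕ}

theorem Built.of_iff (h : Built m H num f S) (hS : ∀ z i, i ≤ H.L → (S z i ↔ S' z i)) :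
    Built m H num f S' where
  pow x i hi h' := h.pow x i hi ((hS x i hi).2 h')
  par x i hi h' := h.par x i hi ((hS x i hi.le).2 h')
  seen x i hi h' := h.seen x i hi ((hS x i hi).2 h')
  best x i hi h' := by
    obtain ⟨y, h₁, h₂, h₃, h₄, h₅⟩ := h.best x i hi h'
    exact ⟨y, (hS y i hi).1 h₁, h₂, h₃, h₄, fun z hz => h₅ z ((hS z i hi).2 hz)⟩
  root x h' := h.root x ((hS x _ le_rfl).2 h')

theorem visit_runs (hb : m.Bdd W) (hS : SmallHier H M W) (ht : TreeInput m H num top k f)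
    (hB : Built m H num f S) (h30 : m.reg 30 = num x) :
    visit.Runs W m (104 * (H.L + 1) + 20) fun m' => m'.Bdd W ∧ TreeInput m' H num top k f ∧
      Built m' H num f (fun z i => S z i ∨ z = x) ∧ m'.reg 30 = num x := by
  have h1 : 1 ≤ W := by have := hS.word; omega
  set m₁ := ((((m.setReg 31 (num x)).setReg 32 0).setReg 33 1).setReg 34 (num x)).setReg 35 1
    with hm₁
  have hn : num x ≤ W := h30 ▸ hb.1 30
  have hb₁ : m₁.Bdd W := ((((hb.setReg hn).setReg (Nat.zero_le _)).setReg h1).setReg hn).setReg h1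
  have hpre : ∀ {t m'}, Exec W (.block [.loop (.eq (.reg 35) (.const 1)) (.block [enter, climb])])
      m₁ t m' → Exec W visit m (2 + (2 + (2 + (2 + (2 + t))))) m' := by
    intro t m' he
    refine .seq (.setReg _ _ _ (hb.1 _)) (.seq (.setReg _ _ _ (Nat.zero_le _)) (.seq
      (.setReg _ _ _ h1) (.seq (.setReg _ _ _ ?_) (.seq (.setReg _ _ _ h1) ?_))))
    · simpa [WExp.Fits] using hb.1 _
    · simpa [WExp.eval, h30] using he
  obtain ⟨t, t₁, m₂, he, ht₁, hI, hX⟩ := Prog.loop_runs (W := W) (m := m₁)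
    (b := .eq (.reg 35) (.const 1)) (p := .block [enter, climb])
    (fun d t m' => (m'.Bdd W ∧ TreeInput m' H num top k f ∧
      Built m' H num f (fun z i => S z i ∨ z = x ∧ i < d) ∧ m'.reg 30 = num x ∧
      (d ≤ H.L → VisitMem m' H num top x d) ∧ (d = H.L + 1 → m'.reg 35 = 0)) ∧ t = 104 * d)
    (H.L + 1)
    ⟨⟨hb₁, ht.congr (by simp [hm₁]) rfl rfl rfl,
      (hB.congr (m' := m₁) (by simp [hm₁]) (by simp [hm₁]) rfl rfl rfl rfl rfl).of_iff (by simp),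
      by simp [hm₁, h30], fun _ => ⟨by simp [hm₁, h30], by simp [hm₁, ht.zero], by simp [hm₁],
        by simp [hm₁], by simp [hm₁, ht.anc, ht.zero], by simp [hm₁]⟩, by simp⟩, rfl⟩
    (by
      rintro d t m' hd ⟨⟨hb, ht, hB, h30, hv, -⟩, htt⟩
      have hv := hv (by omega)
      refine ⟨⟨hb.1 _, h1⟩, hv.r35, 101, (round_runs hb hS ht hB hv (by omega)).mono le_rfl ?_⟩
      rintro m'' ⟨hb', ht', hB', h30', hv', h35'⟩
      refine ⟨⟨hb', ht', hB'.of_iff fun z i _ => ?_, h30', fun h => hv' h,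
        fun h => h35' (by omega)⟩, ?_⟩
      · rw [Nat.lt_succ_iff_lt_or_eq]
        tauto
      · simp only [Test.time, WExp.time]
        omega)
    (by
      rintro t m' ⟨⟨hb, ht, hB, h30, -, h35⟩, htt⟩
      refine ⟨⟨hb.1 _, h1⟩, ?_⟩
      simp [Test.Holds, WExp.eval, h35 rfl])
  refine ⟨_, m₂, hpre (.seq he (.skip _)), ?_, hI.1, hI.2.1, hI.2.2.1.of_iff fun z i hi => ?_,
    hI.2.2.2.1⟩
  · simp only [Test.time, WExp.time] at ht₁
    omega
  · have : i < H.L + 1 := by omega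
    simp [this]

/-- Each facility visits its L + 1 ancestors. In the end the cost registered at the top is replaced
by 0, so that the top is worth at most one client. -/
theorem build_runs [Fintype X] [Nonempty X] (hnum : Function.Injective num) (hb : m.Bdd W)
    (hS : SmallHier H M W) (ht : TreeInput m H num top k f)
    (h11 : ∀ u, m.arr 11 u = 0) :
    build.Runs W m (20 * k + Fintype.card X * (104 * (H.L + 1) + 20) + 20) fun m' =>
      Prepared m' H num f ∧ m'.reg 5 = 1 := by
  classical
  have h1 : 1 ≤ W := by have := hS.word; omega
  have hk : k ≤ W := ht.size ▸ hb.1 0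
  set cnt : ℕ → ℕ := fun i => (Finset.univ.filter fun x : X => num x < i).card with hcnt
  obtain ⟨t, t₁, m₁, he, ht₁, hb₁, ht', -, hB, htt⟩ := Prog.loop_runs (W := W)
    (m := m.setReg 30 0) (b := .lt (.reg 30) (.reg 0))
    (p := .block [.ite (.eq (.read 0 (.reg 30)) (.const 0)) visit .skip,
      .setReg 30 (.add (.reg 30) (.const 1))])
    (fun i t m' => m'.Bdd W ∧ TreeInput m' H num top k f ∧ m'.reg 30 = i ∧
      Built m' H num f (fun z _ => num z < i) ∧
      t ≤ 20 * i + cnt i * (104 * (H.L + 1) + 20)) k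
    ⟨hb.setReg (Nat.zero_le _), ht.congr (by simp) rfl rfl rfl, by simp,
      ⟨by simp, by simp, by simp, fun x i _ h => by simp [h11] at h, by simp⟩, by simp⟩
    (by
      rintro i t m' hi ⟨hb, ht, h30, hB, htt⟩
      refine ⟨⟨hb.1 _, hb.1 _⟩, ?_, ?_⟩
      · simpa only [Test.Holds, WExp.eval, ht.size, h30] using hi
      have hfin : ∀ {m''}, m''.Bdd W → m''.reg 30 = i →
          (Prog.block [.setReg 30 (.add (.reg 30) (.const 1))]).Runs W m'' 5
          fun m₃ => m₃ = m''.setReg 30 (i + 1) := by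
        intro m'' hb'' h30''
        refine ⟨_, _, .seq (.setReg _ _ _ ⟨hb''.1 _, h1, ?_⟩) (.skip _), le_rfl, ?_⟩
        · simp only [WExp.eval, h30'']
          omega
        · simp only [WExp.eval, h30'']
      have hf : (Test.eq (.read 0 (.reg 30)) (.const 0)).Fits W m' :=
        ⟨⟨hb.1 _, hb.2 _ _⟩, Nat.zero_le _⟩
      by_cases h0 : m'.arr 0 i = 0
      · obtain ⟨x, hx⟩ := (ht.leaf i hi).1 h0
        have hc : cnt (i + 1) = cnt i + 1 := by
          simp only [hcnt]
          rw [← Finset.card_insert_of_notMem (a := x) (by simp [hx])]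
          congr 1
          ext z
          simp only [Finset.mem_filter, Finset.mem_univ, true_and, Finset.mem_insert,
            Nat.lt_succ_iff_lt_or_eq]
          rw [← hx, hnum.eq_iff]
          tauto
        refine ⟨4 + (104 * (H.L + 1) + 20) + 5, Prog.Runs.seq (Prog.Runs.ite hf (fun _ =>
          visit_runs hb hS ht hB (h30.trans hx.symm)) fun h => ?_) ?_⟩
        · exact (h (by simp [Test.Holds, WExp.eval, h30, h0])).elim
        rintro m'' ⟨hb'', ht'', hB'', h30''⟩
        refine (hfin hb'' (h30''.trans hx)).mono le_rfl ?_
        rintro _ rfl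
        refine ⟨hb''.setReg (by omega), ht''.congr (by simp) rfl rfl rfl, by simp,
          (hB''.congr (m' := m''.setReg 30 (i + 1)) (by simp) (by simp) rfl rfl rfl rfl rfl).of_iff fun z _ _ => ?_, ?_⟩
        · rw [Nat.lt_succ_iff_lt_or_eq, ← hx, hnum.eq_iff]
        · rw [hc]
          simp only [Test.time, WExp.time]
          linarith
      · have hne : ∀ z, num z ≠ i := fun z hz => h0 ((ht.leaf i hi).2 ⟨z, hz⟩)
        have hc : cnt (i + 1) = cnt i := by
          simp only [hcnt]
          congr 1
          ext z
          simp only [Finset.mem_filter, Finset.mem_univ, true_and, Nat.lt_succ_iff_lt_or_eq]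
          simp [hne]
        refine ⟨4 + 1 + 5, Prog.Runs.seq (Q := fun m'' => m'' = m') (Prog.Runs.ite hf
          (fun h => ?_) fun _ => ⟨_, _, .skip _, le_rfl, rfl⟩) ?_⟩
        · simp [Test.Holds, WExp.eval, h30, h0] at h
        rintro _ rfl
        refine (hfin hb h30).mono le_rfl ?_
        rintro _ rfl
        refine ⟨hb.setReg (by omega), ht.congr (by simp) rfl rfl rfl, by simp,
          (Built.congr (m' := Mem.setReg _ 30 (i + 1)) hB (by simp) (by simp) rfl rfl rfl rfl rfl).of_iff fun z _ _ => ?_, ?_⟩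
        · rw [Nat.lt_succ_iff_lt_or_eq]
          simp [hne]
        · rw [hc]
          simp only [Test.time, WExp.time]
          linarith)
    (by
      rintro t m' ⟨hb, ht, h30, hB, htt⟩
      refine ⟨⟨hb.1 _, hb.1 _⟩, ?_⟩
      simp [Test.Holds, WExp.eval, ht.size, h30])
  have hlt : ∀ x, num x < k := fun x => by rw [← ht.zero]; exact ht.lt x 0 (Nat.zero_le _)
  obtain ⟨x₁⟩ := ‹Nonempty X›
  obtain ⟨h4, h36⟩ := hB.root x₁ (hlt x₁)
  refine ⟨_, (m₁.setCost 1 (m₁.reg 36) 0).setReg 5 1, .seq (.setReg _ _ _ (Nat.zero_le _))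
    (.seq he (.seq (by
      simpa [CExp.eval, WExp.eval] using Exec.setCost m₁ 1 (.reg 36) (.word (.const 0)) (hb₁.1 _)
        (Nat.zero_le W)) (.seq (.setReg _ _ _ h1) (.skip _)))), ?_, ⟨?_, ?_, ?_, ?_, ?_⟩, ?_⟩
  · have hc : cnt k ≤ Fintype.card X := Finset.card_le_univ _
    have := Nat.mul_le_mul_right (104 * (H.L + 1) + 20) hc
    simp only [Test.time, WExp.time, CExp.time] at ht₁ ⊢
    linarith
  · simp [h4]
  · exact fun x i hi => hB.par x i hi (hlt x)
  · exact fun x i hi => hB.pow x i hi (hlt x)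
  · intro x i hi
    obtain ⟨y, -, h₂, h₃, h₄, h₅⟩ := hB.best x i hi (hB.seen x i hi (hlt x))
    refine ⟨y, h₂, h₃, fun z hz => h₅ z (hlt z) hz, fun hi' => ?_⟩
    have : H.anc x i ≠ H.anc x₁ H.L := fun h => hi'.ne (H.anc_level _ _ _ _ hi le_rfl h)
    simp [h36, this, h₄]
  · intro x
    simp [h36, H.anc_top x x₁]
  · simp

end

/-! ### Trees -/

namespace HST

variable {V : Type} (T : HST V)

/-- The `n`-th ancestor. -/
def up (n : ℕ) (v : V) : V := (fun u => (T.parent u).getD T.root)^[n] v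

theorem up_zero (v : V) : T.up 0 v = v := rfl

theorem up_succ (n : ℕ) (v : V) : T.up (n + 1) v = (T.parent (T.up n v)).getD T.root := by
  simp [up, Function.iterate_succ_apply']

theorem up_add (n n' : ℕ) (v : V) : T.up (n + n') v = T.up n (T.up n' v) :=
  Function.iterate_add_apply _ _ _ _

/-- A vertex which has to be listed. -/
def Ess (v : V) : Prop := T.level v = 0 ∨ ∃ a b, a ≠ b ∧ T.parent a = some v ∧ T.parent b = some v

theorem exists_leaf (v : V) : ∃ x : T.Leaf, T.up (T.level v) x.1 = v := by
  obtain ⟨n, hn⟩ : ∃ n, T.level v = n := ⟨_, rfl⟩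
  rw [hn]
  induction n generalizing v with
  | zero => exact ⟨⟨v, hn⟩, rfl⟩
  | succ n ih =>
    obtain ⟨u, hu⟩ := T.exists_child v (by omega)
    have := T.level_parent u v hu
    obtain ⟨x, hx⟩ := ih u (by omega)
    exact ⟨x, by rw [up_succ, hx, hu]; rfl⟩

instance : Nonempty T.Leaf := ⟨(T.exists_leaf T.root).choose⟩

variable [Fintype V]

/-- A vertex of maximal level cannot have a parent, so it is the root. -/
theorem level_le_root (v : V) : T.level v ≤ T.level T.root := by
  obtain ⟨w, -, hw⟩ := Finset.exists_max_image Finset.univ T.level ⟨v, Finset.mem_univ v⟩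
  have h : T.parent w = none := by
    rcases h : T.parent w with _ | u
    · rfl
    · have := T.level_parent w u h
      have := hw u (Finset.mem_univ u)
      omega
  rw [← (T.parent_eq_none w).1 h]
  exact hw v (Finset.mem_univ v)

variable {T}

theorem parent_of_lt {v : V} (h : T.level v < T.level T.root) :
    T.parent v = some (T.up 1 v) := by
  rw [up_succ, up_zero]
  rcases hp : T.parent v with _ | u
  · rw [(T.parent_eq_none v).1 hp] at h
    exact absurd h (lt_irrefl _)
  · rfl

theorem eq_root_of_level {v : V} (h : T.level v = T.level T.root) : v = T.root := by
  rw [← T.parent_eq_none]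
  rcases hp : T.parent v with _ | u
  · rfl
  · have := T.level_parent v u hp
    have := T.level_le_root u
    omega

/-- The bound on `n` is needed because `up` stays at the root once it has reached it. -/
theorem level_up {v : V} {n : ℕ} (h : T.level v + n ≤ T.level T.root) :
    T.level (T.up n v) = T.level v + n := by
  induction n with
  | zero => rfl
  | succ n ih =>
    have h' := ih (by omega)
    rw [add_comm n 1, up_add, T.level_parent _ _ (parent_of_lt (v := T.up n v) (by omega)), h']
    omega

theorem parent_up {v : V} {n : ℕ} (h : T.level v + n < T.level T.root) :
    T.parent (T.up n v) = some (T.up (n + 1) v) := by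
  rw [add_comm n 1, up_add]
  exact parent_of_lt (by rw [level_up h.le]; exact h)

theorem above_iff {v u : V} : T.Above v u ↔
    ∃ n, 0 < n ∧ T.level v + n ≤ T.level T.root ∧ T.up n v = u := by
  constructor
  · intro h
    induction h with
    | single h =>
      rename_i b
      refine ⟨1, one_pos, ?_, ?_⟩
      · rw [← T.level_parent _ _ h]
        exact T.level_le_root _
      · rw [up_succ, up_zero, h]
        rfl
    | tail _ h ih =>
      rename_i b c _
      obtain ⟨n, hn, hle, rfl⟩ := ih
      refine ⟨n + 1, by omega, ?_, ?_⟩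
      · have := T.level_le_root c
        rw [T.level_parent _ _ h, level_up hle] at this
        omega
      · rw [up_succ, h]
        rfl
  · rintro ⟨n, hn, hle, rfl⟩
    induction n, hn using Nat.le_induction with
    | base => exact .single (parent_of_lt (by omega))
    | succ n _ ih => exact .tail (ih (by omega)) (parent_up (by omega))

section Leaves

variable {x y : T.Leaf} {i j : ℕ}

theorem level_up_leaf (x : T.Leaf) (hi : i ≤ T.level T.root) : T.level (T.up i x.1) = i := by
  rw [level_up (by rw [x.2]; omega), x.2, Nat.zero_add]

theorem up_mono (hij : i ≤ j) (h : T.up i x.1 = T.up i y.1) : T.up j x.1 = T.up j y.1 := by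
  obtain ⟨d, rfl⟩ := Nat.exists_eq_add_of_le' hij
  rw [up_add, up_add, h]

/-- Two different children would make their common parent a listed vertex. -/
theorem up_eq_of_not_ess (hi : i < T.level T.root) (h : T.up (i + 1) x.1 = T.up (i + 1) y.1)
    (he : ¬ T.Ess (T.up (i + 1) x.1)) : T.up i x.1 = T.up i y.1 := by
  by_contra hne
  refine he (Or.inr ⟨_, _, hne, parent_up (by rw [x.2]; omega), ?_⟩)
  rw [h]
  exact parent_up (by rw [y.2]; omega)

variable (T) in
open Classical in
/-- The level of the highest listed vertex. -/
noncomputable def height : ℕ := Finset.univ.sup fun v : V => if T.Ess v then T.level v else 0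

theorem le_height {v : V} (h : T.Ess v) : T.level v ≤ T.height := by
  classical
  have := Finset.le_sup (f := fun v : V => if T.Ess v then T.level v else 0) (Finset.mem_univ v)
  rw [if_pos h] at this
  exact this

theorem height_le : T.height ≤ T.level T.root := by
  classical
  refine Finset.sup_le fun v _ => ?_
  split_ifs
  · exact T.level_le_root v
  · exact Nat.zero_le _

theorem exists_height : ∃ v, T.Ess v ∧ T.level v = T.height := by
  classical
  obtain ⟨v, -, hv⟩ := Finset.exists_mem_eq_sup Finset.univ ⟨T.root, Finset.mem_univ _⟩
    fun v : V => if T.Ess v then T.level v else 0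
  change T.height = _ at hv
  split_ifs at hv with h
  · exact ⟨v, h, hv.symm⟩
  · obtain ⟨x⟩ : Nonempty T.Leaf := inferInstance
    exact ⟨x.1, Or.inl x.2, by rw [x.2, hv]⟩

/-- Above the highest listed vertex nothing branches; descending from the root, all leaves keep a
common ancestor as far as that level. -/
theorem up_height (x y : T.Leaf) : T.up T.height x.1 = T.up T.height y.1 := by
  suffices h : ∀ d i, i + d = T.level T.root → T.height ≤ i → T.up i x.1 = T.up i y.1 by
    obtain ⟨d, hd⟩ := Nat.exists_eq_add_of_le (height_le (T := T))
    exact h d _ hd.symm le_rfl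
  intro d
  induction d with
  | zero =>
    rintro i hi -
    rw [eq_root_of_level (v := T.up i x.1), eq_root_of_level (v := T.up i y.1)] <;>
      rw [level_up_leaf _ (by omega)] <;> omega
  | succ d ih =>
    intro i hi hh
    refine up_eq_of_not_ess (by omega) (ih (i + 1) (by omega) (by omega)) fun he => ?_
    have := le_height he
    rw [level_up_leaf _ (by omega)] at this
    omega

theorem ess_up_height (x : T.Leaf) : T.Ess (T.up T.height x.1) := by
  obtain ⟨v, hv, hl⟩ := exists_height (T := T)
  obtain ⟨y, hy⟩ := T.exists_leaf v
  rw [hl] at hy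
  rw [up_height x y, hy]
  exact hv

open Classical in
/-- The highest listed vertex above `x` up to level `i`. -/
noncomputable def eAnc (x : T.Leaf) : ℕ → T.Essential
  | 0 => x.toEssential
  | i + 1 => if h : T.Ess (T.up (i + 1) x.1) then ⟨_, h⟩ else eAnc x i

theorem eAnc_spec (x : T.Leaf) (i : ℕ) : ∃ n ≤ i, (eAnc x i).1 = T.up n x.1 ∧
    ∀ i', n < i' → i' ≤ i → ¬ T.Ess (T.up i' x.1) := by
  induction i with
  | zero => exact ⟨0, le_rfl, rfl, fun i' h₁ h₂ => by omega⟩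
  | succ i ih =>
    rw [eAnc]
    split_ifs with h
    · exact ⟨i + 1, le_rfl, rfl, fun i' h₁ h₂ => by omega⟩
    · obtain ⟨n, hn, he, hne⟩ := ih
      refine ⟨n, by omega, he, fun i' h₁ h₂ => ?_⟩
      rcases Nat.le_succ_iff.1 h₂ with h₂ | rfl
      · exact hne i' h₁ h₂
      · exact h

/-- Going down from a vertex there is no choice until a listed vertex is met. With the converse
`up_eq_of_eAnc`, classes of level `i` correspond to the values of `eAnc · i`, which justifies
numbering them by listed vertices. -/
theorem eAnc_congr (hi : i ≤ T.level T.root) (h : T.up i x.1 = T.up i y.1) :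
    eAnc x i = eAnc y i := by
  induction i with
  | zero => exact Subtype.ext h
  | succ i ih =>
    rw [eAnc, eAnc]
    by_cases he : T.Ess (T.up (i + 1) x.1)
    · rw [dif_pos he, dif_pos (h ▸ he)]
      exact Subtype.ext h
    · rw [dif_neg he, dif_neg (h ▸ he)]
      exact ih (by omega) (up_eq_of_not_ess (by omega) h he)

theorem up_eq_of_eAnc (hi : i ≤ T.level T.root) (h : eAnc x i = eAnc y i) :
    T.up i x.1 = T.up i y.1 := by
  obtain ⟨n, hn, hx, -⟩ := eAnc_spec x i
  obtain ⟨n', hn', hy, -⟩ := eAnc_spec y i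
  have e : T.up n x.1 = T.up n' y.1 := by rw [← hx, ← hy, h]
  have e' := congrArg T.level e
  rw [level_up_leaf _ (by omega), level_up_leaf _ (by omega)] at e'
  subst e'
  exact up_mono hn e

theorem exists_isNext (hi : i < T.height) : ∃ u, T.IsNext (eAnc x i) u := by
  classical
  obtain ⟨n, hn, hx, -⟩ := eAnc_spec x i
  have hh := height_le (T := T)
  have hex : ∃ i', n < i' ∧ T.Ess (T.up i' x.1) := ⟨T.height, by omega, ess_up_height x⟩
  have hle : Nat.find hex ≤ T.height := Nat.find_min' hex ⟨by omega, ess_up_height x⟩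
  obtain ⟨h₁, h₂⟩ := Nat.find_spec hex
  have hlev : T.level (T.up n x.1) = n := level_up_leaf _ (by omega)
  refine ⟨⟨_, h₂⟩, ?_, fun w hw => ?_⟩
  · rw [hx, above_iff]
    refine ⟨Nat.find hex - n, by omega, by omega, ?_⟩
    rw [← up_add, Nat.sub_add_cancel h₁.le]
  · rw [hx, above_iff] at hw
    obtain ⟨d, hd, hle', he⟩ := hw
    rw [← up_add] at he
    have : Nat.find hex ≤ d + n := Nat.find_min' hex ⟨by omega, he ▸ w.2⟩
    change T.level (T.up (Nat.find hex) x.1) ≤ _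
    rw [level_up_leaf _ (by omega), ← he, level_up_leaf _ (by omega)]
    exact this

/-- The next listed vertex lies above level `i`, so it is the ancestor at level `i + 1` precisely if
its recorded level says so. This is the test made by `climb`. -/
theorem isNext_level {u : T.Essential} (hi : i < T.height) (h : T.IsNext (eAnc x i) u) :
    eAnc x (i + 1) = if T.level u.1 = i + 1 then u else eAnc x i := by
  obtain ⟨n, hn, hx, hne⟩ := eAnc_spec x i
  have hh := height_le (T := T)
  have hlev : T.level (T.up n x.1) = n := level_up_leaf _ (by omega)
  obtain ⟨hab, hmin⟩ := h
  rw [hx, above_iff] at hab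
  obtain ⟨d, hd, hle, he⟩ := hab
  rw [← up_add] at he
  have hlu : T.level u.1 = d + n := by rw [← he, level_up_leaf _ (by omega)]
  have hlt : i < d + n := by
    by_contra hc
    exact hne (d + n) (by omega) (by omega) (he ▸ u.2)
  rw [eAnc]
  by_cases hE : T.Ess (T.up (i + 1) x.1)
  · rw [dif_pos hE]
    have hmin' := hmin ⟨_, hE⟩ (by
      rw [hx, above_iff]
      exact ⟨i + 1 - n, by omega, by omega, by rw [← up_add, Nat.sub_add_cancel (by omega)]⟩)
    change _ ≤ T.level (T.up (i + 1) x.1) at hmin'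
    rw [level_up_leaf _ (by omega), hlu] at hmin'
    rw [if_pos (by omega)]
    refine Subtype.ext ?_
    rw [← he, show d + n = i + 1 by omega]
  · rw [dif_neg hE, if_neg]
    intro h
    rw [hlu] at h
    rw [h] at he
    exact hE (he ▸ u.2)

theorem not_isNext_height (u : T.Essential) : ¬ T.IsNext (eAnc x T.height) u := by
  rintro ⟨hab, -⟩
  have hh := height_le (T := T)
  have he : (eAnc x T.height).1 = T.up T.height x.1 := by
    obtain ⟨n, hn, hx, hne⟩ := eAnc_spec x T.height
    rcases hn.lt_or_eq with h | rfl
    · exact absurd (ess_up_height x) (hne _ h le_rfl)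
    · exact hx
  rw [he, above_iff] at hab
  obtain ⟨d, hd, hle, he'⟩ := hab
  rw [level_up_leaf _ hh] at hle
  rw [← up_add] at he'
  have h₁ := le_height (T := T) u.2
  rw [← he', level_up_leaf _ (by omega)] at h₁
  omega

end Leaves

/-! ### Distances -/

/-- The weights 2^l of the edges passed form a geometric sum; moving its lower end to the left
avoids subtraction. -/
theorem exists_walk_up {v y : V} {n : ℕ} (hn : T.level v + n ≤ T.level T.root)
    (p : T.graph.Walk (T.up n v) y) :
    ∃ q : T.graph.Walk v y, T.walkWeight q + 2 ^ T.level v = T.walkWeight p + 2 ^ (T.level v + n) := by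
  induction n with
  | zero => exact ⟨p, rfl⟩
  | succ n ih =>
    have hp := parent_up (T := T) (v := v) (n := n) (by omega)
    have hl := level_up (T := T) (v := v) (n := n) (by omega)
    have hl' := level_up (T := T) (v := v) (n := n + 1) hn
    have hne : T.up n v ≠ T.up (n + 1) v := fun h => by
      rw [h] at hl
      omega
    have hadj : T.graph.Adj (T.up n v) (T.up (n + 1) v) := by
      rw [graph, SimpleGraph.fromRel_adj]
      exact ⟨hne, Or.inl hp⟩
    obtain ⟨q, hq⟩ := ih (by omega) (.cons hadj p)
    refine ⟨q, hq.trans ?_⟩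
    rw [walkWeight, hl, hl', min_eq_left (by omega), ← add_assoc, pow_succ 2 (T.level v + n)]
    ring

theorem exists_walk_down (v : V) {n : ℕ} (hn : T.level v + n ≤ T.level T.root) :
    ∃ q : T.graph.Walk (T.up n v) v, T.walkWeight q + 2 ^ T.level v = 2 ^ (T.level v + n) := by
  induction n with
  | zero => exact ⟨.nil, by simp [walkWeight]⟩
  | succ n ih =>
    have hp := parent_up (T := T) (v := v) (n := n) (by omega)
    have hl := level_up (T := T) (v := v) (n := n) (by omega)
    have hl' := level_up (T := T) (v := v) (n := n + 1) hn
    have hne : T.up (n + 1) v ≠ T.up n v := fun h => by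
      rw [← h] at hl
      omega
    have hadj : T.graph.Adj (T.up (n + 1) v) (T.up n v) := by
      rw [graph, SimpleGraph.fromRel_adj]
      exact ⟨hne, Or.inr hp⟩
    obtain ⟨q, hq⟩ := ih (by omega)
    refine ⟨.cons hadj q, ?_⟩
    rw [walkWeight, hl, hl', min_eq_right (by omega), add_assoc, hq, ← add_assoc,
      pow_succ 2 (T.level v + n)]
    ring

theorem exists_walk {x y : T.Leaf} {i : ℕ} (hi : i ≤ T.level T.root)
    (h : T.up i x.1 = T.up i y.1) : ∃ p : T.graph.Walk x.1 y.1, T.walkWeight p ≤ 2 * 2 ^ i := by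
  have hx := x.2
  have hy := y.2
  obtain ⟨q, hq⟩ : ∃ q : T.graph.Walk (T.up i x.1) y.1, T.walkWeight q + 2 ^ T.level y.1 =
      2 ^ (T.level y.1 + i) := by
    rw [h]
    exact exists_walk_down y.1 (by omega)
  obtain ⟨p, hp⟩ := exists_walk_up (v := x.1) (n := i) (by omega) q
  refine ⟨p, ?_⟩
  rw [hx, Nat.zero_add] at hp
  rw [hy, Nat.zero_add] at hq
  omega

theorem dist_self (v : V) : T.dist v v = 0 :=
  Nat.eq_zero_of_le_zero (Nat.sInf_le ⟨SimpleGraph.Walk.nil, rfl⟩)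

theorem dist_le {x y : T.Leaf} {i : ℕ} (hi : i ≤ T.level T.root)
    (h : T.up i x.1 = T.up i y.1) : T.dist x.1 y.1 ≤ 2 * 2 ^ i := by
  obtain ⟨p, hp⟩ := exists_walk hi h
  have h' : T.dist x.1 y.1 ≤ T.walkWeight p := Nat.sInf_le ⟨p, rfl⟩
  exact h'.trans hp

/-- A walk that starts below `w` and ends elsewhere must use the edge from `w` to its parent, of
weight 2^i. The induction follows the walk as long as it stays below `w`. -/
theorem le_walkWeight {i : ℕ} {w : V} (hw : T.level w = i) {u y : V} (p : T.graph.Walk u y) :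
    (∃ n, T.level u + n = i ∧ T.up n u = w) →
    (¬ ∃ n, T.level y + n = i ∧ T.up n y = w) → 2 ^ i ≤ T.walkWeight p := by
  induction p with
  | nil => exact fun h h' => absurd h h'
  | cons hadj p ih =>
    rename_i u u' y
    rintro ⟨n, hn, hu⟩ hy
    rw [graph, SimpleGraph.fromRel_adj] at hadj
    rw [walkWeight]
    rcases hadj.2 with hp | hp
    · have hl := T.level_parent _ _ hp
      cases n with
      | zero =>
        rw [min_eq_left (by omega)]
        rw [← hn]
        exact Nat.le_add_right _ _
      | succ n =>
        refine (ih ⟨n, by omega, ?_⟩ hy).trans (Nat.le_add_left _ _)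
        rw [up_add, up_succ T 0, up_zero, hp] at hu
        exact hu
    · have hl := T.level_parent _ _ hp
      refine (ih ⟨n + 1, by omega, ?_⟩ hy).trans (Nat.le_add_left _ _)
      rw [up_add, up_succ T 0, up_zero, hp]
      exact hu

theorem le_dist {x y : T.Leaf} {i : ℕ} (hi : i ≤ T.level T.root)
    (h : T.up i x.1 ≠ T.up i y.1) : 2 ^ i ≤ T.dist x.1 y.1 := by
  have hroot : T.up (T.level T.root) x.1 = T.up (T.level T.root) y.1 :=
    up_mono height_le (up_height x y)
  obtain ⟨p₀, -⟩ := exists_walk le_rfl hroot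
  obtain ⟨p, hp⟩ := Nat.sInf_mem (s := {c | ∃ p : T.graph.Walk x.1 y.1, T.walkWeight p = c})
    ⟨_, p₀, rfl⟩
  change T.walkWeight p = T.dist x.1 y.1 at hp
  rw [← hp]
  refine le_walkWeight (w := T.up i x.1) (level_up_leaf x hi) p ⟨i, by rw [x.2]; omega, rfl⟩ ?_
  rintro ⟨n, hn, hy⟩
  rw [y.2, Nat.zero_add] at hn
  rw [hn] at hy
  exact h hy.symm

theorem dist_le_diam (x y : T.Leaf) : T.dist x.1 y.1 ≤ T.diam :=
  Finset.le_sup (f := fun p : T.Leaf × T.Leaf => T.dist p.1 p.2) (Finset.mem_univ (x, y))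

/-- If the highest listed vertex is not a leaf, two of its children have different leaves below
them, at distance at least half of 2^height. Hence the hierarchy has logarithmically many levels
even if the tree is much higher. -/
theorem two_pow_height_le : 2 ^ T.height ≤ 2 * (T.diam + 2) := by
  obtain ⟨v, hv, hl⟩ := exists_height (T := T)
  rcases hv with h0 | ⟨a, b, hab, ha, hb⟩
  · rw [← hl, h0]
    omega
  · have hla := T.level_parent _ _ ha
    have hlb := T.level_parent _ _ hb
    obtain ⟨x, hx⟩ := T.exists_leaf a
    obtain ⟨y, hy⟩ := T.exists_leaf b
    have hr := T.level_le_root a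
    have h := le_dist (x := x) (y := y) (i := T.level a) hr (by
      rw [hx, show T.level a = T.level b by omega, hy]
      exact hab)
    have := dist_le_diam x y
    rw [← hl, hla, pow_succ]
    omega

/-- A vertex is determined by any leaf below it and its level. The logarithmic loss in this crude
count is harmless, since `build` takes that much time anyway. -/
theorem card_essential_le {k : ℕ} (e : Fin k ≃ T.Essential) :
    k ≤ Fintype.card T.Leaf * (T.height + 1) := by
  classical
  choose g hg using T.exists_leaf
  have hinj : Function.Injective fun i : Fin k =>
      ((g (e i).1, ⟨T.level (e i).1, Nat.lt_succ_of_le (le_height (e i).2)⟩) :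
        T.Leaf × Fin (T.height + 1)) := by
    intro i i' h
    simp only [Prod.mk.injEq, Fin.mk.injEq] at h
    apply e.injective
    apply Subtype.ext
    rw [← hg (e i).1, ← hg (e i').1, h.1, h.2]
  simpa using Fintype.card_le_of_injective _ hinj

end HST

/-! ### The hierarchy of a tree and its numbering -/

namespace HST

variable {V : Type} {T : HST V} {k : ℕ} {e : Fin k ≃ T.Essential}

theorem nextIdx_of_isNext {p : T.Essential} (h : ∃ u, T.IsNext p u) :
    ∃ u, T.IsNext p u ∧ T.nextIdx e (e.symm p) = e.symm u := by
  classical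
  have hex : ∃ j, T.IsNext (e (e.symm p)) (e j) := by
    obtain ⟨u, hu⟩ := h
    exact ⟨e.symm u, by simpa using hu⟩
  refine ⟨e hex.choose, by simpa using hex.choose_spec, ?_⟩
  rw [nextIdx, dif_pos hex, Equiv.symm_apply_apply]

theorem nextIdx_of_not {p : T.Essential} (h : ∀ u, ¬ T.IsNext p u) :
    T.nextIdx e (e.symm p) = k := by
  rw [nextIdx, dif_neg]
  rintro ⟨j, hj⟩
  rw [Equiv.apply_symm_apply] at hj
  exact h _ hj

theorem idx_injective : Function.Injective (T.idx e) := by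
  intro x y h
  have h' : x.toEssential = y.toEssential := e.symm.injective (Fin.ext h)
  exact Subtype.ext (congrArg (fun v : T.Essential => v.1) h')

variable (e) in
/-- The number of the highest listed vertex above `x` up to level `i`. -/
noncomputable def topIdx (x : T.Leaf) (i : ℕ) : ℕ := (e.symm (eAnc x i) : ℕ)

variable (e) in
/-- The number of the ancestor of `x` at level `i`. -/
noncomputable def ancIdx (x : T.Leaf) (i : ℕ) : ℕ := topIdx e x i + k * i

theorem topIdx_lt (x : T.Leaf) (i : ℕ) : topIdx e x i < k := (e.symm (eAnc x i)).2

/-- Numbers of listed vertices are below `k`, so the level is the quotient by `k`. Numbers on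
different levels are therefore different, and `hier` can recover the level from the number alone. -/
theorem ancIdx_div (x : T.Leaf) (i : ℕ) : ancIdx e x i / k = i := by
  have h := topIdx_lt (e := e) x i
  rw [ancIdx, Nat.add_mul_div_left _ _ (by omega), Nat.div_eq_of_lt h, Nat.zero_add]

variable [Fintype V]

theorem ancIdx_eq_iff {x y : T.Leaf} {i : ℕ} (hi : i ≤ T.height) :
    ancIdx e x i = ancIdx e y i ↔ T.up i x.1 = T.up i y.1 := by
  have hr := hi.trans height_le
  rw [ancIdx, ancIdx, Nat.add_right_cancel_iff, topIdx, topIdx, ← Fin.ext_iff,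
    e.symm.injective.eq_iff]
  exact ⟨up_eq_of_eAnc hr, eAnc_congr hr⟩

variable (e) in
/-- The least cost of a facility below a vertex, and `0` for the top. -/
noncomputable def leastCost (f : T.Leaf → ℝ) (v : ℕ) : ℝ :=
  if v / k = T.height then 0 else sInf (f '' {x | ancIdx e x (v / k) = v})

theorem leastCost_eq {f : T.Leaf → ℝ} {x y : T.Leaf} {i : ℕ} (hi : i ≠ T.height)
    (hy : ancIdx e y i = ancIdx e x i) (hmin : ∀ z, ancIdx e z i = ancIdx e x i → f y ≤ f z) :
    leastCost e f (ancIdx e x i) = f y := by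
  rw [leastCost, ancIdx_div, if_neg hi]
  refine IsLeast.csInf_eq ⟨⟨y, hy, rfl⟩, ?_⟩
  rintro _ ⟨z, hz, rfl⟩
  exact hmin z hz

theorem exists_leastCost (f : T.Leaf → ℝ) (x : T.Leaf) (i : ℕ) :
    ∃ y, ancIdx e y i = ancIdx e x i ∧ ∀ z, ancIdx e z i = ancIdx e x i → f y ≤ f z := by
  classical
  obtain ⟨y, hy, hmin⟩ := Finset.exists_min_image
    (Finset.univ.filter fun y => ancIdx e y i = ancIdx e x i) f ⟨x, by simp⟩
  simp only [Finset.mem_filter, Finset.mem_univ, true_and] at hy hmin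
  exact ⟨y, hy, hmin⟩

theorem leastCost_height (f : T.Leaf → ℝ) (x : T.Leaf) :
    leastCost e f (ancIdx e x T.height) = 0 := by
  rw [leastCost, ancIdx_div, if_pos rfl]

variable (e) in
/-- The hierarchy of a tree. -/
noncomputable def hier {f : T.Leaf → ℝ} (hf : ∀ x, 0 ≤ f x) : Hier T.Leaf where
  L := T.height
  anc := ancIdx e
  ids := Finset.range (k * (T.height + 1))
  h v := max (leastCost e f v) 1 / 2 ^ (v / k)
  anc_mem x i hi := by
    rw [Finset.mem_range, ancIdx]
    calc topIdx e x i + k * i < k + k * i := Nat.add_lt_add_right (topIdx_lt x i) _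
      _ = k * (i + 1) := by ring
      _ ≤ k * (T.height + 1) := Nat.mul_le_mul_left k (by omega)
  anc_level x y i j _ _ h := by rw [← ancIdx_div (e := e) x i, h, ancIdx_div]
  anc_succ x y i hi h := by
    rw [ancIdx_eq_iff (by omega)] at h ⊢
    exact up_mono (Nat.le_succ i) h
  anc_top x y := (ancIdx_eq_iff le_rfl).2 (up_height x y)
  h_pos x i _ := by positivity
  h_half x i hi := by
    rw [ancIdx_div, ancIdx_div]
    obtain ⟨y, hy, hmin⟩ := exists_leastCost (e := e) f x i
    -- The larger class contains the cheapest facility of the smaller one; at the top the cost 0 is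
    -- below every opening cost. The power of two in the denominator then gives the factor 2.
    have h₁ : leastCost e f (ancIdx e x (i + 1)) ≤ f y := by
      by_cases h : i + 1 = T.height
      · rw [h, leastCost_height]
        exact hf y
      · obtain ⟨y', hy', hmin'⟩ := exists_leastCost (e := e) f x (i + 1)
        rw [leastCost_eq h hy' hmin']
        refine hmin' y ?_
        rw [ancIdx_eq_iff (by omega)] at hy ⊢
        exact up_mono (Nat.le_succ i) hy
    rw [leastCost_eq hi.ne hy hmin]
    have h₂ : max (leastCost e f (ancIdx e x (i + 1))) 1 ≤ max (f y) 1 := max_le_max_right 1 h₁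
    rw [pow_succ, mul_div_assoc', mul_comm ((2 : ℝ) ^ i), mul_div_mul_left _ _ two_ne_zero]
    gcongr
  h_top x := by
    rw [ancIdx_div, leastCost_height, max_eq_right zero_le_one]
    exact div_le_one_of_le₀ (one_le_pow₀ one_le_two) (by positivity)

variable {f : T.Leaf → ℝ} (hf : ∀ x, 0 ≤ f x)

theorem inputMem_treeInput : TreeInput (T.inputMem f e) (hier e hf) (T.idx e) (topIdx e) k f where
  size := rfl
  lt x i _ := topIdx_lt x i
  zero _ := rfl
  leaf i hi := by
    have harr : (T.inputMem f e).arr 0 i = T.level (e ⟨i, hi⟩).1 := by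
      simp [inputMem, hi]
    rw [harr]
    constructor
    · intro h
      refine ⟨⟨_, h⟩, ?_⟩
      have : (Leaf.toEssential ⟨(e ⟨i, hi⟩).1, h⟩ : T.Essential) = e ⟨i, hi⟩ := rfl
      rw [idx, this, Equiv.symm_apply_apply]
    · rintro ⟨x, rfl⟩
      have : (⟨T.idx e x, hi⟩ : Fin k) = e.symm x.toEssential := rfl
      rw [this, Equiv.apply_symm_apply]
      exact x.2
  cost x := by
    have hlt : T.idx e x < k := (e.symm x.toEssential).2
    have he : e ⟨T.idx e x, hlt⟩ = x.toEssential := e.apply_symm_apply x.toEssential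
    have hl : T.level (e ⟨T.idx e x, hlt⟩).1 = 0 := by
      rw [he]
      exact x.2
    simp only [inputMem, hlt, dif_pos, hl, if_true]
    congr 1
    exact Subtype.ext (congrArg (fun v : T.Essential => v.1) he)
  anc _ _ _ := rfl
  next x i hi := by
    obtain ⟨u, -, hn⟩ := nextIdx_of_isNext (e := e) (exists_isNext (x := x) hi)
    have : (T.inputMem f e).arr 1 (topIdx e x i) = T.nextIdx e (e.symm (eAnc x i)) := by
      simp [inputMem, topIdx]
    rw [this, hn]
    exact (e.symm u).2
  last x := by
    have : (T.inputMem f e).arr 1 (topIdx e x T.height) =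
        T.nextIdx e (e.symm (eAnc x T.height)) := by
      simp [inputMem, topIdx]
    exact this.trans (nextIdx_of_not fun u => not_isNext_height u)
  step x i hi := by
    obtain ⟨u, hu, hn⟩ := nextIdx_of_isNext (e := e) (exists_isNext (x := x) hi)
    have h₁ : (T.inputMem f e).arr 1 (topIdx e x i) = e.symm u := by
      rw [← hn]
      simp [inputMem, topIdx]
    have h₂ : (T.inputMem f e).arr 0 (e.symm u : ℕ) = T.level u.1 := by
      simp [inputMem]
    rw [h₁, h₂, topIdx, isNext_level hi hu, topIdx]
    split_ifs <;> rfl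

theorem inputMem_bdd {W : ℕ} (hk : k ≤ W) (hW : T.height ≤ W) : (T.inputMem f e).Bdd W := by
  constructor
  · intro x
    simp only [inputMem]
    split_ifs
    exacts [hk, Nat.zero_le _]
  · intro a i
    simp only [inputMem]
    split_ifs with h₁ h₂ h₃
    · exact (le_height (e ⟨i, h₁⟩).2).trans hW
    · rw [nextIdx]
      split_ifs with h
      · exact h.choose.2.le.trans hk
      · exact hk
    · exact Nat.zero_le _
    · exact Nat.zero_le _

end HST

/-! ### The algorithm -/

/-- Handles a request; the hierarchy is computed when the first one arrives. -/
def handle : Prog := .seq (.ite (.eq (.reg 5) (.const 0)) build .skip) serve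

/-- The facilities in `fac` are cheapest in their classes. -/
def Cheapest {X : Type} (H : Hier X) (num : X → ℕ) (f : X → ℝ) (fac : ℕ → ℕ) : Prop :=
  ∀ x, ∀ i ≤ H.L, ∃ y, fac (H.anc x i) = num y ∧ H.anc y i = H.anc x i ∧
    (∀ z, H.anc z i = H.anc x i → f y ≤ f z) ∧ (i < H.L → H.h (H.anc x i) = max (f y) 1 / 2 ^ i)

/-- The memory before the first request. -/
structure Fresh {X : Type} (m : Mem) (H : Hier X) (num : X → ℕ) (top : X → ℕ → ℕ) (k : ℕ)
    (f : X → ℝ) : Prop where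
  input : TreeInput m H num top k f
  flag : m.reg 5 = 0
  zero : ∀ a, 2 ≤ a → ∀ i, m.arr a i = 0

/-- The memory after the first request. -/
structure Alive {X : Type} (m : Mem) (H : Hier X) (num : X → ℕ) (f : X → ℝ) (M : ℕ)
    (P : Finset ℕ) (home : ℕ → X) (fac : ℕ → ℕ) (s : St) : Prop where
  ready : Ready H fac M P home m s
  flag : m.reg 5 ≠ 0
  cheap : Cheapest H num f fac

/-- An array has been changed at `t` places at most. -/
def Changed (t : ℕ) (u u' : ℕ → ℕ) : Prop := ∃ S : Finset ℕ, S.card ≤ t ∧ ∀ i, u i ≠ u' i → i ∈ S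

section

variable {X : Type} {H : Hier X} {num : X → ℕ} {top : X → ℕ → ℕ} {k : ℕ} {f : X → ℝ} {M W : ℕ}
  {m : Mem} {P : Finset ℕ} {home : ℕ → X} {fac : ℕ → ℕ} {s : St} {j : ℕ} {ins : Bool} {x₀ : X}

theorem Ready.of_eq {m' : Mem} (h : Ready H fac M P home m s) (h4 : m'.reg 4 = m.reg 4)
    (ha : m'.arr = m.arr) (hc : m'.cost = m.cost) : Ready H fac M P home m' s :=
  ⟨h.tree.congr h4 (by rw [ha]) (by rw [ha]) (by rw [ha]) (by rw [hc]),
    h.abs.congr (by rw [ha]) (by rw [ha]) (by rw [ha]) (by rw [ha]) (by rw [ha]), h.cons,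
    by rw [ha]; exact h.asg, by rw [ha]; exact h.home⟩

theorem Ready.mono {M' : ℕ} (h : Ready H fac M P home m s) (hM : M ≤ M') :
    Ready H fac M' P home m s :=
  ⟨h.tree, ⟨h.abs.bags, h.abs.owners, h.abs.fk,
    fun b => (h.abs.bound b).trans (Finset.range_subset_range.2 hM)⟩, h.cons, h.asg, h.home⟩

theorem empty_consistent {fk : ℕ → ℕ} : Consistent H ∅ home ⟨fun _ => ∅, ∅, fk⟩ where
  resid x i _ a := ⟨fun h => absurd h (Finset.notMem_empty a),
    fun h => absurd h.1 (Finset.notMem_empty a)⟩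
  kids x i _ w := by
    refine ⟨fun h => absurd h (Finset.notMem_empty w), ?_⟩
    rintro ⟨y, i', -, -, -, h | ⟨u, h⟩⟩
    · exact absurd h (Finset.notMem_empty _)
    · exact absurd h (Finset.notMem_empty u)
  thresh x i hi := ⟨fun h => absurd h (Finset.notMem_empty _), fun _ => by
    have e : (⟨fun _ => ∅, ∅, fk⟩ : St).R (H.anc x i) = ∅ := rfl
    rw [e, Finset.card_empty, Nat.cast_zero]
    exact H.h_pos x i hi⟩
  owner v hv := absurd hv (Finset.notMem_empty _)

theorem empty_pot (hh : ∀ v ∈ H.ids, 0 ≤ H.h v) {fk : ℕ → ℕ} :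
    St.pot H ⟨fun _ => ∅, ∅, fk⟩ = 0 := by
  refine Finset.sum_eq_zero fun v hv => ?_
  have := hh v hv
  have e : (⟨fun _ => ∅, ∅, fk⟩ : St).R v = ∅ := rfl
  rw [e, pot, if_neg (Finset.notMem_empty v), Finset.card_empty, Nat.cast_zero]
  rw [min_eq_left this]
  exact max_eq_right (by linarith)

theorem serve_alive (hS : SmallHier H M W) (hA : Alive m H num f M P home fac s)
    (hx : home j = x₀) (hP : ins = true → j ∉ P) (hP' : ins = false → j ∈ P) (hjM : j < M)
    (hb : m.Bdd W) (h1 : m.reg 1 = (!ins).toNat) (h2 : m.reg 2 = j)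
    (h3 : ins = true → m.reg 3 = H.anc x₀ 0) :
    ∃ T m' s', Exec W serve m T m' ∧ Alive m' H num f M (change P j ins) home fac s' ∧
      Changed T (m.arr 2) (m'.arr 2) ∧ Changed T (m.arr 3) (m'.arr 3) ∧
      (T : ℝ) + 4800 * s'.pot H ≤ 14000 * ((H.L : ℝ) + 1) ^ 2 + 4800 * s.pot H := by
  obtain ⟨T, t, m', he, ht, s', hR, hT⟩ := serve_runs hS hA.ready hx hP hP' hjM hb h1 h2 h3
  refine ⟨t, m', s', he, ⟨hR, ?_, hA.cheap⟩, he.changed 2, he.changed 3, ?_⟩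
  · rw [he.reg_eq (by decide)]
    exact hA.flag
  · have : (t : ℝ) ≤ T := by exact_mod_cast ht
    linarith

theorem handle_alive (hS : SmallHier H M W) (hA : Alive m H num f M P home fac s)
    (hx : home j = x₀) (hP : ins = true → j ∉ P) (hP' : ins = false → j ∈ P) (hjM : j < M)
    (hb : m.Bdd W) (h1 : m.reg 1 = (!ins).toNat) (h2 : m.reg 2 = j)
    (h3 : ins = true → m.reg 3 = H.anc x₀ 0) :
    ∃ T m' s', Exec W handle m (4 + T) m' ∧ Alive m' H num f M (change P j ins) home fac s' ∧
      Changed T (m.arr 2) (m'.arr 2) ∧ Changed T (m.arr 3) (m'.arr 3) ∧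
      (T : ℝ) + 4800 * s'.pot H ≤ 14000 * ((H.L : ℝ) + 1) ^ 2 + 4800 * s.pot H := by
  obtain ⟨T, m', s', he, h⟩ := serve_alive hS hA hx hP hP' hjM hb h1 h2 h3
  have hf : (Test.eq (.reg 5) (.const 0)).Fits W m := ⟨hb.1 _, Nat.zero_le _⟩
  exact ⟨T, m', s', .seq (.iteFalse _ hf hA.flag (.skip _)) he, h⟩

/-- The times of `build` and of `serve` are kept apart: `build` writes neither the assignment nor
the open facilities, so both recourses are bounded by the second time alone. -/
theorem handle_fresh [Fintype X] [Nonempty X] (hnum : Function.Injective num)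
    (hS : SmallHier H M W) (hh : ∀ v ∈ H.ids, 0 ≤ H.h v)
    (hworth : ∀ x y i, i < H.L → H.anc y i = H.anc x i →
      (∀ z, H.anc z i = H.anc x i → f y ≤ f z) → H.h (H.anc x i) = max (f y) 1 / 2 ^ i)
    (hroot : ∀ x, H.h (H.anc x H.L) = 1 / 2 ^ H.L)
    (hF : Fresh m H num top k f) (hx : home j = x₀) (hins : ins = true) (hjM : j < M)
    (hb : m.Bdd W) (h1 : m.reg 1 = (!ins).toNat) (h2 : m.reg 2 = j)
    (h3 : m.reg 3 = H.anc x₀ 0) :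
    ∃ T₀ T m' fac s', Exec W handle m (3 + T₀ + T) m' ∧
      T₀ ≤ 20 * k + Fintype.card X * (104 * (H.L + 1) + 20) + 20 ∧
      Alive m' H num f M (change ∅ j ins) home fac s' ∧
      Changed T (m.arr 2) (m'.arr 2) ∧ Changed T (m.arr 3) (m'.arr 3) ∧
      (T : ℝ) + 4800 * s'.pot H ≤ 14000 * ((H.L : ℝ) + 1) ^ 2 := by
  obtain ⟨T₀, m₁, he₁, ht₁, hp, h5⟩ := build_runs hnum hb hS hF.input (hF.zero 11 (by norm_num))
  have harr : ∀ a ∉ build.arrs, m₁.arr a = m.arr a := fun a ha => he₁.arr_eq ha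
  have hz : ∀ a ∉ build.arrs, 2 ≤ a → ∀ i, m₁.arr a i = 0 := fun a ha h i => by
    rw [harr a ha, hF.zero a h]
  set s₀ : St := ⟨fun _ => ∅, ∅, fun v => m₁.arr 5 (pr (2 * v + 1) 0)⟩ with hs₀
  have hA : Alive m₁ H num f M ∅ home (m₁.arr 9) s₀ := by
    refine ⟨⟨⟨hp.top, hp.par, hp.pow, fun _ _ _ => rfl, fun x i hi => ?_⟩,
      ⟨⟨?_, ?_, ?_⟩, ⟨?_, ?_⟩, fun _ => rfl, ?_⟩, empty_consistent, ?_, ?_⟩, by rw [h5]; norm_num,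
      fun x i hi => ?_⟩
    · rcases hi.lt_or_eq with hi' | rfl
      · obtain ⟨y, h₁, h₂, h₃, h₄⟩ := hp.best x i hi
        rw [hworth x y i hi' h₁ h₃, h₄ hi']
      · rw [hroot, hp.root, max_eq_right zero_le_one]
    · exact fun b => hz 4 (by decide) (by norm_num) b
    · exact fun b i hi => absurd hi (Nat.not_lt_zero _)
    · exact fun b x hx => absurd hx (Finset.notMem_empty _)
    · intro u
      rw [hz 12 (by decide) (by norm_num)]
      rfl
    · intro y
      rw [hz 3 (by decide) (by norm_num)]
      rfl
    · exact fun _ => Finset.empty_subset _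
    · exact fun a ha => absurd ha (Finset.notMem_empty _)
    · exact fun a ha => absurd ha (Finset.notMem_empty _)
    · obtain ⟨y, h₁, h₂, h₃, h₄⟩ := hp.best x i hi
      exact ⟨y, h₂, h₁, h₃, fun hi' => hworth x y i hi' h₁ h₃⟩
  obtain ⟨T, m', s', he, hA', hc2, hc3, hT⟩ := serve_alive (j := j) (ins := ins) hS hA hx
    (fun _ => Finset.notMem_empty _) (fun h => by rw [hins] at h; cases h) hjM (he₁.bdd hb)
    (by rw [he₁.reg_eq (by decide), h1]) (by rw [he₁.reg_eq (by decide), h2])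
    (fun _ => by rw [he₁.reg_eq (by decide), h3])
  rw [empty_pot hh] at hT
  rw [harr 2 (by decide)] at hc2
  rw [harr 3 (by decide)] at hc3
  have hf : (Test.eq (.reg 5) (.const 0)).Fits W m := ⟨hb.1 _, Nat.zero_le _⟩
  exact ⟨T₀, T, m', _, s', .seq (.iteTrue _ hf hF.flag he₁) he, ht₁, hA', hc2,
    hc3, by linarith⟩

end

/-! ### Runs against an adversary -/

open Classical in
/-- Running time and final memory of a program. -/
noncomputable def Prog.run (p : Prog) (m : Mem) : ℕ × Mem :=
  if h : ∃ q : ℕ × Mem, ∃ W, Exec W p m q.1 q.2 then h.choose else (0, m)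

theorem Exec.run_eq {W : ℕ} {p : Prog} {m m' : Mem} {t : ℕ} (h : Exec W p m t m') :
    p.run m = (t, m') := by
  have hex : ∃ q : ℕ × Mem, ∃ W, Exec W p m q.1 q.2 := ⟨(t, m'), W, h⟩
  rw [Prog.run, dif_pos hex]
  obtain ⟨W', h'⟩ := hex.choose_spec
  obtain ⟨h₁, h₂⟩ := h'.deterministic h
  exact Prod.ext h₁ h₂

/-- The history of a run. -/
structure Snap (X : Type) where
  hist : List Mem
  mem : Mem
  clients : Clients X
  time : ℕ

namespace HST

variable {V : Type} {T : HST V} {k : ℕ} {e : Fin k ≃ T.Essential}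

variable (e) in
/-- The history after one more request. -/
noncomputable def next (p : Prog) (adv : List Mem → Request T.Leaf) (S : Snap T.Leaf) :
    Snap T.Leaf :=
  let q := p.run (T.request e S.clients S.mem (adv S.hist))
  ⟨S.hist ++ [q.2], q.2, S.clients.next (adv S.hist), q.1⟩

variable (e) in
-- The machine is deterministic, so a run is a function of the memory. The play against the
-- adversary is defined by recursion before anything is known about termination, with an arbitrary
-- value where the program does not halt. The history is part of the state because the adversary
-- sees it.
theorem exists_trajectory (p : Prog) (adv : List Mem → Request T.Leaf) (m₀ : Mem) :
    ∃ (s : ℕ → Mem) (τ : ℕ → ℕ), s 0 = m₀ ∧ τ 0 = 1 ∧ ∀ (t W t' : ℕ) (m' : Mem),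
      Exec W p (T.request e (Clients.after (fun t => adv ((List.range (t + 1)).map s)) t) (s t)
        (adv ((List.range (t + 1)).map s))) t' m' → s (t + 1) = m' ∧ τ (t + 1) = t' := by
  set snap : ℕ → Snap T.Leaf := fun t =>
    (next e p adv)^[t] ⟨[m₀], m₀, ⟨0, ∅, fun _ _ => 0⟩, 1⟩ with hsnap
  have hsucc : ∀ t, snap (t + 1) = next e p adv (snap t) := fun t =>
    Function.iterate_succ_apply' _ _ _
  set s : ℕ → Mem := fun t => (snap t).mem with hs
  have hhist : ∀ t, (snap t).hist = (List.range (t + 1)).map s := by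
    intro t
    induction t with
    | zero => rfl
    | succ t ih =>
      rw [List.range_succ, List.map_append, ← ih]
      simp only [List.map_cons, List.map_nil, hs, hsucc t, next]
  have hcl : ∀ t, (snap t).clients =
      Clients.after (fun t => adv ((List.range (t + 1)).map s)) t := by
    intro t
    induction t with
    | zero => rfl
    | succ t ih => rw [hsucc, Clients.after, ← ih, ← hhist]; rfl
  refine ⟨s, fun t => (snap t).time, rfl, rfl, fun t W t' m' he => ?_⟩
  rw [← hcl, ← hhist] at he
  have hr := he.run_eq
  change (snap (t + 1)).mem = m' ∧ (snap (t + 1)).time = t'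
  rw [hsucc]
  exact ⟨congrArg Prod.snd hr, congrArg Prod.fst hr⟩

/-- `home a` is a facility nearest to the client `a`, and distances are as they should be. -/
structure Valid (C : Clients T.Leaf) (home : ℕ → T.Leaf) : Prop where
  lt : ∀ a ∈ C.present, a < C.arrived
  near : ∀ a ∈ C.present, ∀ x, C.dist a (home a) ≤ C.dist a x
  triangle : ∀ a ∈ C.present, ∀ x y, C.dist a x ≤ T.dist x.1 y.1 + C.dist a y
  triangle' : ∀ a ∈ C.present, ∀ x y, (T.dist x.1 y.1 : ℝ) ≤ C.dist a x + C.dist a y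

variable (e) in
/-- A request asks for the insertion (`ins = true`) or removal of the client `j`. -/
structure Asks (C C' : Clients T.Leaf) (home home' : ℕ → T.Leaf) (m m' : Mem) (j : ℕ) (ins : Bool) :
    Prop where
  valid : Valid C' home'
  home : ∀ a ∈ C.present, home' a = home a
  present : C'.present = change C.present j ins
  notMem : ins = true → j ∉ C.present
  mem : ins = false → j ∈ C.present
  lt : j < C'.arrived
  le : C.arrived ≤ C'.arrived
  -- Free of subtraction: requests plus present clients grow by twice the number of arrivals.
  count : C'.present.card + 1 + 2 * C.arrived = C.present.card + 2 * C'.arrived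
  r1 : m'.reg 1 = (!ins).toNat
  r2 : m'.reg 2 = j
  r3 : ins = true → m'.reg 3 = T.idx e (home' j)
  reg : ∀ x, x ≠ 1 → x ≠ 2 → x ≠ 3 → m'.reg x = m.reg x
  arr : m'.arr = m.arr
  cost : m'.cost = m.cost
  bdd : ∀ W, m.Bdd W → k ≤ W → C'.arrived ≤ W → m'.Bdd W

theorem Legal.asks {C : Clients T.Leaf} {r : Request T.Leaf} (h : T.Legal C r)
    {home : ℕ → T.Leaf} (hv : Valid C home) (m : Mem) :
    ∃ home' j ins, Asks e C (C.next r) home home' m (T.request e C m r) j ins := by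
  classical
  cases r with
  | arrive p δ =>
    obtain ⟨h₁, h₂, h₃⟩ := h
    have hn : C.arrived ∉ C.present := fun h => lt_irrefl _ (hv.lt _ h)
    have hne : ∀ a ∈ C.present, a ≠ C.arrived := fun a ha h => hn (h ▸ ha)
    have hmem : ∀ {Q : ℕ → T.Leaf → (T.Leaf → ℝ) → Prop},
        (∀ a ∈ C.present, Q a (home a) (C.dist a)) → Q C.arrived p δ →
        ∀ a ∈ insert C.arrived C.present, Q a (Function.update home C.arrived p a)
          (Function.update C.dist C.arrived δ a) := by
      intro Q hQ hQ' a ha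
      rcases Finset.mem_insert.1 ha with rfl | ha
      · rwa [Function.update_self, Function.update_self]
      · rw [Function.update_of_ne (hne a ha), Function.update_of_ne (hne a ha)]
        exact hQ a ha
    refine ⟨Function.update home C.arrived p, C.arrived, true, ⟨?_, ?_, ?_, ?_⟩, ?_, rfl,
      fun _ => hn, fun h => Bool.noConfusion h, Nat.lt_succ_self _, Nat.le_succ _, ?_, rfl, rfl, ?_,
      ?_, rfl, rfl, ?_⟩
    · intro a ha
      rcases Finset.mem_insert.1 ha with rfl | ha
      · exact Nat.lt_succ_self _
      · exact (hv.lt a ha).trans (Nat.lt_succ_self _)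
    · exact hmem (Q := fun _ q d => ∀ x, d q ≤ d x) hv.near h₁
    · exact hmem (Q := fun _ _ d => ∀ x y : T.Leaf, d x ≤ T.dist x.1 y.1 + d y) hv.triangle h₂
    · exact hmem (Q := fun _ _ d => ∀ x y : T.Leaf, (T.dist x.1 y.1 : ℝ) ≤ d x + d y)
        hv.triangle' h₃
    · exact fun a ha => Function.update_of_ne (hne a ha) _ _
    · simp only [Clients.next, Finset.card_insert_of_notMem hn]
      omega
    · intro _
      simp [request]
    · intro x h₁ h₂ h₃
      simp [request, h₁, h₂, h₃]
    · intro W hb hk ha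
      simp only [Clients.next] at ha
      have hi : T.idx e p < k := (e.symm p.toEssential).2
      exact ((hb.setReg (Nat.zero_le _)).setReg (by omega)).setReg (by omega)
  | depart j =>
    have hj : j ∈ C.present := h
    refine ⟨home, j, false, ⟨?_, ?_, ?_, ?_⟩, fun _ _ => rfl, rfl, fun h => Bool.noConfusion h,
      fun _ => hj, hv.lt j hj, le_rfl, ?_, rfl, rfl, fun h => Bool.noConfusion h, ?_, rfl, rfl, ?_⟩
    · exact fun a ha => hv.lt a (Finset.mem_of_mem_erase ha)
    · exact fun a ha => hv.near a (Finset.mem_of_mem_erase ha)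
    · exact fun a ha => hv.triangle a (Finset.mem_of_mem_erase ha)
    · exact fun a ha => hv.triangle' a (Finset.mem_of_mem_erase ha)
    · have := Finset.card_pos.2 ⟨j, hj⟩
      simp only [Clients.next, Finset.card_erase_of_mem hj]
      omega
    · intro x h₁ h₂ h₃
      simp [request, h₁, h₂, h₃]
    · intro W hb hk ha
      have := hv.lt j hj
      simp only [Clients.next] at ha
      exact ((hb.setReg (by omega)).setReg (by omega)).setReg (Nat.zero_le _)

variable [Fintype V]

theorem ancIdx_zero (x : T.Leaf) : ancIdx e x 0 = T.idx e x := by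
  rw [ancIdx, Nat.mul_zero, Nat.add_zero]
  rfl

variable (T) in
/-- The base of the bounds for the words. -/
noncomputable def base (n : ℕ) : ℕ := (n + 2) * (T.diam + 2)

theorem base_mono {n n' : ℕ} (h : n ≤ n') : T.base n ≤ T.base n' :=
  Nat.mul_le_mul_right _ (by omega)

theorem four_le_base (n : ℕ) : 4 ≤ T.base n :=
  Nat.mul_le_mul (Nat.le_add_left 2 n) (Nat.le_add_left 2 T.diam)

theorem le_base_pow {a n d : ℕ} (h : a ≤ n + 2) (hd : d ≠ 0) : a ≤ T.base n ^ d :=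
  (h.trans (Nat.le_mul_of_pos_right _ (by omega))).trans (Nat.le_self_pow hd _)

/-- With k ≤ |F| (height + 1) the numbers of vertices are below |F| (height + 1)². Both this and the
powers of two in memory are polynomial in the base. -/
theorem height_bound {n : ℕ} : (T.height + 1) ^ 2 * (n + 2) ≤ T.base n ^ 4 ∧
    2 ^ T.height ≤ T.base n ^ 4 := by
  have h₁ : 2 ^ T.height ≤ (T.diam + 2) ^ 2 :=
    two_pow_height_le.trans (by rw [sq]; exact Nat.mul_le_mul_right _ (by omega))
  have h₂ : T.height + 1 ≤ (T.diam + 2) ^ 2 := (Nat.lt_two_pow_self).trans_le h₁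
  have h₃ : (T.height + 1) ^ 2 ≤ (T.diam + 2) ^ 4 := by
    calc (T.height + 1) ^ 2 ≤ ((T.diam + 2) ^ 2) ^ 2 := Nat.pow_le_pow_left h₂ 2
      _ = (T.diam + 2) ^ 4 := by ring
  have h₄ : n + 2 ≤ (n + 2) ^ 4 := Nat.le_self_pow (by norm_num) _
  have h₅ : (T.diam + 2) ^ 4 * (n + 2) ≤ T.base n ^ 4 := by
    rw [base, mul_pow, mul_comm]
    exact Nat.mul_le_mul_right _ h₄
  refine ⟨(Nat.mul_le_mul_right _ h₃).trans h₅, h₁.trans ?_⟩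
  refine le_trans ?_ h₅
  exact (Nat.pow_le_pow_right (by omega) (by norm_num)).trans (Nat.le_mul_of_pos_right _ (by omega))

theorem size_le_base_pow (e : Fin k ≃ T.Essential) {n : ℕ} (hn : Fintype.card T.Leaf ≤ n) :
    k ≤ T.base n ^ 13 ∧ T.height ≤ T.base n ^ 13 := by
  have h₁ := card_essential_le e
  obtain ⟨h₂, h₂'⟩ := (height_bound (T := T) (n := n))
  have h₃ : T.base n ^ 4 ≤ T.base n ^ 13 :=
    Nat.pow_le_pow_right (by have := four_le_base (T := T) n; omega) (by norm_num)
  refine ⟨(h₁.trans ?_).trans (h₂.trans h₃), (Nat.lt_two_pow_self.le.trans h₂').trans h₃⟩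
  rw [mul_comm, sq, mul_assoc]
  refine Nat.mul_le_mul_left _ ((show Fintype.card T.Leaf ≤ n + 2 by omega).trans ?_)
  exact Nat.le_mul_of_pos_left _ (by omega)

/-- For M = Y⁴ with Y ≥ 4 the positions in bags are at most (4 M + 4)² ≤ Y¹² < Y¹³; this is the
origin of the exponent 13. -/
theorem smallHier {f : T.Leaf → ℝ} (hf : ∀ x, 0 ≤ f x) {n : ℕ} (hn : Fintype.card T.Leaf ≤ n) :
    SmallHier (hier e hf) (T.base n ^ 4) (T.base n ^ 13) where
  lt := by
    have h4 := four_le_base (T := T) n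
    set Y := T.base n
    have h₁ : 4 ≤ 4 * Y ^ 4 := by nlinarith [Nat.one_le_pow 4 Y (by omega)]
    have h₂ : 4 * Y ^ 4 + 4 ≤ Y ^ 6 := by
      calc 4 * Y ^ 4 + 4 ≤ (4 * 4) * Y ^ 4 := by nlinarith
        _ ≤ (Y * Y) * Y ^ 4 := Nat.mul_le_mul_right _ (Nat.mul_le_mul h4 h4)
        _ = Y ^ 6 := by ring
    calc (4 * Y ^ 4 + 4) ^ 2 ≤ (Y ^ 6) ^ 2 := Nat.pow_le_pow_left h₂ 2
      _ = Y ^ 12 := by ring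
      _ < Y ^ 13 := Nat.pow_lt_pow_right (by omega) (by norm_num)
  ids v hv := by
    have hv : v < k * (T.height + 1) := Finset.mem_range.1 hv
    have h₁ : k * (T.height + 1) ≤ (T.height + 1) ^ 2 * (n + 2) := by
      calc k * (T.height + 1) ≤ Fintype.card T.Leaf * (T.height + 1) * (T.height + 1) :=
            Nat.mul_le_mul_right _ (card_essential_le e)
        _ = (T.height + 1) ^ 2 * Fintype.card T.Leaf := by ring
        _ ≤ _ := Nat.mul_le_mul_left _ (by omega)
    exact hv.trans_le (h₁.trans height_bound.1)
  pow := height_bound.2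

theorem hier_L {f : T.Leaf → ℝ} (hf : ∀ x, 0 ≤ f x) : (hier e hf).L = T.height := rfl

/-- The invariants of a run; `A`, `A'` and `A''` are the total time and the total recourse for
clients and for facilities. -/
structure RunInv (e : Fin k ≃ T.Essential) {f : T.Leaf → ℝ} (hf : ∀ x, 0 ≤ f x) (t : ℕ)
    (C : Clients T.Leaf) (m : Mem) (A A' A'' : ℕ) (home : ℕ → T.Leaf) (Φ : ℝ) : Prop where
  valid : Valid C home
  count : t + C.present.card = 2 * C.arrived
  bdd : m.Bdd (T.base (Fintype.card T.Leaf + C.arrived) ^ 13)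
  state : (C.present = ∅ ∧ Φ = 0 ∧ A = 0 ∧ m = T.inputMem f e) ∨ ∃ fac s, Φ = s.pot (hier e hf) ∧
    Alive m (hier e hf) (T.idx e) f (T.base (Fintype.card T.Leaf + C.arrived) ^ 4) C.present home
      fac s
  time : A + 4800 * Φ ≤ (14000 * ((T.height : ℝ) + 1) ^ 2 + 5) * t +
    (20 * k + Fintype.card T.Leaf * (104 * (T.height + 1) + 20) + 20)
  client : A' + 4800 * Φ ≤ 14000 * ((T.height : ℝ) + 1) ^ 2 * t
  facility : A'' + 4800 * Φ ≤ 14000 * ((T.height : ℝ) + 1) ^ 2 * t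

theorem _root_.Changed.clientRecourse_le {X : Type} {C C' : Clients X} {m m' : Mem} {t : ℕ}
    (h : Changed t (m.arr 2) (m'.arr 2)) : clientRecourse C C' m m' ≤ t := by
  obtain ⟨S, hS, h⟩ := h
  refine (Finset.card_le_card fun j hj => ?_).trans hS
  exact h j (Finset.mem_filter.1 hj).2

theorem _root_.Changed.facilityRecourse_le [DecidableEq V] {m m' : Mem} {t : ℕ}
    (h : Changed t (m.arr 3) (m'.arr 3)) : facilityRecourse T e m m' ≤ t := by
  obtain ⟨S, hS, h⟩ := h
  refine (Finset.card_le_card_of_injOn (T.idx e) (fun x hx => h _ fun he => ?_)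
    (idx_injective.injOn)).trans hS
  rw [Finset.mem_coe, Finset.mem_symmDiff] at hx
  simp only [openSet, Finset.mem_filter, Finset.mem_univ, true_and, he] at hx
  tauto

theorem handle_first {f : T.Leaf → ℝ} (hf : ∀ x, 0 ≤ f x) {M W j : ℕ} {m : Mem}
    {home : ℕ → T.Leaf} (hS : SmallHier (hier e hf) M W)
    (hF : Fresh m (hier e hf) (T.idx e) (topIdx e) k f) (hjM : j < M) (hb : m.Bdd W)
    (h1 : m.reg 1 = 0) (h2 : m.reg 2 = j) (h3 : m.reg 3 = T.idx e (home j)) :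
    ∃ T₀ T' m' fac s', Exec W handle m (3 + T₀ + T') m' ∧
      T₀ ≤ 20 * k + Fintype.card T.Leaf * (104 * (T.height + 1) + 20) + 20 ∧
      Alive m' (hier e hf) (T.idx e) f M (change ∅ j true) home fac s' ∧
      Changed T' (m.arr 2) (m'.arr 2) ∧ Changed T' (m.arr 3) (m'.arr 3) ∧
      (T' : ℝ) + 4800 * s'.pot (hier e hf) ≤ 14000 * ((T.height : ℝ) + 1) ^ 2 := by
  have hh : ∀ v ∈ (hier e hf).ids, 0 ≤ (hier e hf).h v := fun v _ =>
    div_nonneg (zero_le_one.trans (le_max_right _ _)) (pow_nonneg zero_le_two _)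
  have hworth : ∀ x y i, i < (hier e hf).L → (hier e hf).anc y i = (hier e hf).anc x i →
      (∀ z, (hier e hf).anc z i = (hier e hf).anc x i → f y ≤ f z) →
      (hier e hf).h ((hier e hf).anc x i) = max (f y) 1 / 2 ^ i := fun x y i hi h₁ h₂ =>
    congrArg₂ (fun a b => max a 1 / 2 ^ b) (leastCost_eq (Nat.ne_of_lt hi) h₁ h₂) (ancIdx_div ..)
  have hroot : ∀ x, (hier e hf).h ((hier e hf).anc x (hier e hf).L) = 1 / 2 ^ (hier e hf).L := by
    intro x
    refine (congrArg₂ (fun a b => max a (1 : ℝ) / 2 ^ b) (leastCost_height f x) (ancIdx_div ..)).trans ?_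
    exact congrArg (· / _) (max_eq_right zero_le_one)
  have h3' : m.reg 3 = (hier e hf).anc (home j) 0 := h3.trans (ancIdx_zero _).symm
  have h := handle_fresh (j := j) (home := home) (x₀ := home j) idx_injective hS hh hworth hroot hF
    rfl rfl hjM hb h1 h2 h3'
  rw [hier_L] at h
  exact h

theorem handle_later {f : T.Leaf → ℝ} {hf : ∀ x, 0 ≤ f x} {M W j : ℕ} {ins : Bool} {m : Mem}
    {P : Finset ℕ} {home : ℕ → T.Leaf} {fac : ℕ → ℕ} {s : St} (hS : SmallHier (hier e hf) M W)
    (hA : Alive m (hier e hf) (T.idx e) f M P home fac s) (hP : ins = true → j ∉ P)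
    (hP' : ins = false → j ∈ P) (hjM : j < M) (hb : m.Bdd W) (h1 : m.reg 1 = (!ins).toNat)
    (h2 : m.reg 2 = j) (h3 : ins = true → m.reg 3 = T.idx e (home j)) :
    ∃ T' m' s', Exec W handle m (4 + T') m' ∧
      Alive m' (hier e hf) (T.idx e) f M (change P j ins) home fac s' ∧
      Changed T' (m.arr 2) (m'.arr 2) ∧ Changed T' (m.arr 3) (m'.arr 3) ∧
      (T' : ℝ) + 4800 * s'.pot (hier e hf) ≤
        14000 * ((T.height : ℝ) + 1) ^ 2 + 4800 * s.pot (hier e hf) :=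
  handle_alive hS hA rfl hP hP' hjM hb h1 h2 fun h => (h3 h).trans (ancIdx_zero _).symm

set_option maxHeartbeats 800000 in
-- The bounds for words and numbers grow with the arrivals, so the state is first transported to the
-- bounds valid after the request. Then the two possible states, before and after the first request,
-- are treated by `handle_first` and `handle_later`.
theorem RunInv.step [DecidableEq V] {f : T.Leaf → ℝ} {hf : ∀ x, 0 ≤ f x} {t : ℕ} {C : Clients T.Leaf} {m : Mem}
    {A A' A'' : ℕ} {home : ℕ → T.Leaf} {Φ : ℝ} (hI : RunInv e hf t C m A A' A'' home Φ)
    {r : Request T.Leaf} (hr : T.Legal C r) : ∃ τ m',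
      Exec (T.base (Fintype.card T.Leaf + (C.next r).arrived) ^ 13) handle (T.request e C m r) τ m' ∧
      ∃ home' Φ', RunInv e hf (t + 1) (C.next r) m' (A + τ)
        (A' + clientRecourse C (C.next r) m m') (A'' + facilityRecourse T e m m') home' Φ' := by
  obtain ⟨home', j, ins, hA⟩ := hr.asks (e := e) hI.valid m
  set C' := C.next r with hC'
  set m₁ := T.request e C m r with hm₁
  set n := Fintype.card T.Leaf + C.arrived with hn
  set n' := Fintype.card T.Leaf + C'.arrived with hn'
  have hnn : n ≤ n' := Nat.add_le_add_left hA.le _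
  have hS : SmallHier (hier e hf) (T.base n' ^ 4) (T.base n' ^ 13) := smallHier hf (by omega)
  have hk : k ≤ T.base n' ^ 13 := (size_le_base_pow e (Nat.le_add_right _ _)).1
  have hb₁ : m₁.Bdd (T.base n' ^ 13) := hA.bdd _
    (hI.bdd.mono (Nat.pow_le_pow_left (base_mono hnn) 13)) hk (le_base_pow (by omega) (by norm_num))
  have hjM : j < T.base n' ^ 4 := by
    have : C'.arrived ≤ T.base n' ^ 4 := le_base_pow (by omega) (by norm_num)
    exact hA.lt.trans_le this
  have hcount : t + 1 + C'.present.card = 2 * C'.arrived := by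
    have := hA.count
    have := hI.count
    omega
  have hM : T.base n ^ 4 ≤ T.base n' ^ 4 := Nat.pow_le_pow_left (base_mono hnn) 4
  -- `τ` is the full time and `T'` the part spent in `serve`; only the latter can change the
  -- solution and is charged for recourse.
  have hfin : ∀ {τ T' : ℕ} {m' : Mem} {fac : ℕ → ℕ} {s' : St},
      Exec (T.base n' ^ 13) handle m₁ τ m' →
      Alive m' (hier e hf) (T.idx e) f (T.base n' ^ 4) (change C.present j ins) home' fac s' →
      Changed T' (m₁.arr 2) (m'.arr 2) → Changed T' (m₁.arr 3) (m'.arr 3) →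
      (T' : ℝ) + 4800 * s'.pot (hier e hf) ≤ 14000 * ((T.height : ℝ) + 1) ^ 2 + 4800 * Φ →
      ((A + τ : ℕ) : ℝ) + 4800 * s'.pot (hier e hf) ≤
        (14000 * ((T.height : ℝ) + 1) ^ 2 + 5) * (t + 1 : ℕ) +
        (20 * k + Fintype.card T.Leaf * (104 * (T.height + 1) + 20) + 20) →
      ∃ τ m', Exec (T.base n' ^ 13) handle m₁ τ m' ∧ ∃ home' Φ', RunInv e hf (t + 1) C' m' (A + τ)
        (A' + clientRecourse C C' m m') (A'' + facilityRecourse T e m m') home' Φ' := by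
    intro τ T' m' fac s' he hal h2 h3 hT hA₁
    rw [hA.arr] at h2 h3
    have hc : (clientRecourse C C' m m' : ℝ) ≤ T' := by exact_mod_cast h2.clientRecourse_le
    have hc' : (facilityRecourse T e m m' : ℝ) ≤ T' := by exact_mod_cast h3.facilityRecourse_le
    have h₁ := hI.client
    have h₂ := hI.facility
    refine ⟨τ, m', he, home', s'.pot (hier e hf), hA.valid, hcount, he.bdd hb₁,
      Or.inr ⟨fac, s', rfl, ?_⟩, hA₁, ?_, ?_⟩
    · rw [hA.present]
      exact hal
    · push_cast
      linarith
    · push_cast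
      linarith
  rcases hI.state with ⟨hP, rfl, rfl, hm⟩ | ⟨fac, s, rfl, hal⟩
  -- No client is present yet, so the first request cannot be a departure.
  · have hins : ins = true := by
      by_contra h
      have := hA.mem (by simpa using h)
      rw [hP] at this
      exact Finset.notMem_empty _ this
    have hF : Fresh m₁ (hier e hf) (T.idx e) (topIdx e) k f := by
      refine ⟨(inputMem_treeInput hf).congr ?_ ?_ ?_ ?_, ?_, ?_⟩
      · rw [hA.reg 0 (by norm_num) (by norm_num) (by norm_num), hm]
      · rw [hA.arr, hm]
      · rw [hA.arr, hm]
      · rw [hA.cost, hm]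
      · rw [hA.reg 5 (by norm_num) (by norm_num) (by norm_num), hm]
        rfl
      · intro a ha i
        rw [hA.arr, hm]
        have h₀ : a ≠ 0 := by omega
        have h₁ : a ≠ 1 := by omega
        simp [inputMem, h₀, h₁]
    subst hins
    obtain ⟨T₀, T', m', fac, s', he, hT₀, hal, h2, h3, hT⟩ := handle_first (home := home') hf hS hF
      hjM hb₁ hA.r1 hA.r2 (hA.r3 rfl)
    rw [← hP] at hal
    refine hfin he hal h2 h3 (by linarith) ?_
    have hT₀' : (T₀ : ℝ) ≤ 20 * k + Fintype.card T.Leaf * (104 * (T.height + 1) + 20) + 20 := by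
      exact_mod_cast hT₀
    have h₀ : 0 ≤ (14000 * ((T.height : ℝ) + 1) ^ 2 + 5) * t := by positivity
    rw [Nat.zero_add, Nat.cast_add, Nat.cast_add, Nat.cast_add, mul_add]
    generalize (14000 * ((T.height : ℝ) + 1) ^ 2 + 5) * t = x at h₀ ⊢
    norm_num
    linarith
  · have hal₁ : Alive m₁ (hier e hf) (T.idx e) f (T.base n' ^ 4) C.present home' fac s :=
      ⟨((hal.ready.mono hM).congr hA.home).of_eq (hA.reg 4 (by norm_num) (by norm_num)
        (by norm_num)) hA.arr hA.cost, by
          rw [hA.reg 5 (by norm_num) (by norm_num) (by norm_num)]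
          exact hal.flag, hal.cheap⟩
    obtain ⟨T', m', s', he, hal', h2, h3, hT⟩ := handle_later hS hal₁ hA.notMem hA.mem hjM hb₁
      hA.r1 hA.r2 hA.r3
    refine hfin he hal' h2 h3 hT ?_
    have h₀ := hI.time
    rw [Nat.cast_add, Nat.cast_add, Nat.cast_add, mul_add]
    generalize (14000 * ((T.height : ℝ) + 1) ^ 2 + 5) * t = x at h₀ ⊢
    norm_num at h₀ ⊢
    linarith

end HST

/-! ### Approximation ratio and logarithmic bounds -/

namespace HST

variable {V : Type} [Fintype V] {T : HST V} {k : ℕ} {e : Fin k ≃ T.Essential}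

/-- Moving each client to its nearest facility makes its connection in a competing solution at most
twice as long, and moving it back adds at most its original connection: 2 · 17 + 1 = 35. -/
theorem Alive.cost_le [DecidableEq V] {f : T.Leaf → ℝ} {hf : ∀ x, 0 ≤ f x} {m : Mem} {M : ℕ} {C : Clients T.Leaf}
    {home : ℕ → T.Leaf} {fac : ℕ → ℕ} {s : St}
    (hA : Alive m (hier e hf) (T.idx e) f M C.present home fac s) (hC : Valid C home) :
    ∃ σ : ℕ → T.Leaf, Stores T e C m σ ∧
      ∀ (S' : Finset T.Leaf) (σ' : ℕ → T.Leaf), (∀ j ∈ C.present, σ' j ∈ S') →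
        C.cost f (T.openSet e m) σ ≤ 35 * C.cost f S' σ' := by
  have hfk := hA.ready.abs.firstKid
  have hopen : ∀ x, x ∈ T.openSet e m ↔ ∃ v ∈ s.O, fac v = T.idx e x := by
    intro x
    simp only [openSet, Finset.mem_filter, Finset.mem_univ, true_and, hA.ready.abs.owners.ref,
      ← Nat.pos_iff_ne_zero, Finset.card_pos, Finset.Nonempty]
  have hσ : ∀ a, ∃ z, a ∈ C.present → m.arr 2 a = T.idx e z ∧ z ∈ T.openSet e m := by
    intro a
    by_cases ha : a ∈ C.present
    · obtain ⟨i, hi, hm, -, hrep⟩ := hA.ready.asg a ha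
      obtain ⟨y, i', hi', -, hO, hfac⟩ := hA.ready.cons.rep_owner hfk fac i (home a) hi hm
      obtain ⟨z, hz, -⟩ := hA.cheap y i' (hi'.trans hi)
      exact ⟨z, fun _ => ⟨(hrep.trans hfac).trans hz, (hopen z).2 ⟨_, hO, hz⟩⟩⟩
    · exact ⟨home a, fun h => absurd h ha⟩
  choose σ hσ using hσ
  refine ⟨σ, hσ, fun S' σ' hσ' => ?_⟩
  have hle : T.height ≤ T.level T.root := height_le
  -- The tree distance is used with its arguments exchanged, the orientation in which `Valid`
  -- provides the triangle inequality; so its symmetry is not needed.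
  have h := hA.ready.cons.cost_le hfk hf (d := fun x y => (T.dist y.1 x.1 : ℝ))
    (fun _ _ => Nat.cast_nonneg _) (fun x => by simp only [dist_self, Nat.cast_zero])
    (fun x y i hi h => by
      exact_mod_cast dist_le (hi.trans hle) ((ancIdx_eq_iff hi).1 h).symm)
    (fun x y i hi h => by
      exact_mod_cast le_dist (hi.trans hle) fun h' => h ((ancIdx_eq_iff hi).2 h'.symm))
    (fun x y h => Subtype.ext ((ancIdx_eq_iff (Nat.zero_le _)).1 h))
    idx_injective hA.cheap (σ := σ) (fun a ha => (hσ a ha).1 ▸ hA.ready.asg a ha)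
    (fun x hx => (hopen x).1 hx) hσ'
  have h₁ : ∑ a ∈ C.present, C.dist a (σ a) ≤
      ∑ a ∈ C.present, (T.dist (σ a).1 (home a).1 : ℝ) + ∑ a ∈ C.present, C.dist a (σ' a) := by
    rw [← Finset.sum_add_distrib]
    exact Finset.sum_le_sum fun a ha => (hC.triangle a ha _ _).trans
      (add_le_add_right (hC.near a ha _) _)
  have h₂ : ∑ a ∈ C.present, (T.dist (σ' a).1 (home a).1 : ℝ) ≤
      2 * ∑ a ∈ C.present, C.dist a (σ' a) := by
    rw [Finset.mul_sum]
    exact Finset.sum_le_sum fun a ha => (hC.triangle' a ha _ _).trans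
      (by linarith [hC.near a ha (σ' a)])
  have h₃ : 0 ≤ ∑ x ∈ S', f x := Finset.sum_nonneg fun x _ => hf x
  simp only [Clients.cost]
  linarith

theorem cost_nonneg {f : T.Leaf → ℝ} (hf : ∀ x, 0 ≤ f x) {C : Clients T.Leaf} {home : ℕ → T.Leaf}
    (hC : Valid C home) (S : Finset T.Leaf) (σ : ℕ → T.Leaf) : 0 ≤ C.cost f S σ := by
  refine add_nonneg (Finset.sum_nonneg fun x _ => hf x) (Finset.sum_nonneg fun a ha => ?_)
  have h := hC.triangle' a ha (σ a) (σ a)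
  rw [dist_self, Nat.cast_zero] at h
  linarith

theorem openSet_inputMem (f : T.Leaf → ℝ) : T.openSet e (T.inputMem f e) = ∅ :=
  Finset.filter_false_of_mem fun x _ h => h (by simp [inputMem])

theorem RunInv.cost_le [DecidableEq V] {f : T.Leaf → ℝ} {hf : ∀ x, 0 ≤ f x} {t : ℕ} {C : Clients T.Leaf} {m : Mem}
    {A A' A'' : ℕ} {home : ℕ → T.Leaf} {Φ : ℝ} (hI : RunInv e hf t C m A A' A'' home Φ) :
    ∃ σ : ℕ → T.Leaf, Stores T e C m σ ∧
      ∀ (S' : Finset T.Leaf) (σ' : ℕ → T.Leaf), (∀ j ∈ C.present, σ' j ∈ S') →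
        C.cost f (T.openSet e m) σ ≤ 35 * C.cost f S' σ' := by
  rcases hI.state with ⟨hP, -, -, hm⟩ | ⟨fac, s, -, hA⟩
  · refine ⟨home, fun j hj => absurd (hP ▸ hj) (Finset.notMem_empty j), fun S' σ' _ => ?_⟩
    simp only [Clients.cost, hP, Finset.sum_empty, add_zero, hm, openSet_inputMem]
    exact mul_nonneg (by norm_num) (Finset.sum_nonneg fun x _ => hf x)
  · exact Alive.cost_le hA hI.valid

theorem RunInv.pot_nonneg {f : T.Leaf → ℝ} {hf : ∀ x, 0 ≤ f x} {t : ℕ} {C : Clients T.Leaf}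
    {m : Mem} {A A' A'' : ℕ} {home : ℕ → T.Leaf} {Φ : ℝ}
    (hI : RunInv e hf t C m A A' A'' home Φ) : 0 ≤ Φ := by
  rcases hI.state with ⟨-, h, -⟩ | ⟨fac, s, h, -⟩
  · exact h.ge
  · exact h ▸ St.pot_nonneg _ _

theorem RunInv.init (e : Fin k ≃ T.Essential) {f : T.Leaf → ℝ} (hf : ∀ x, 0 ≤ f x)
    (home : ℕ → T.Leaf) :
    RunInv e hf 0 ⟨0, ∅, fun _ _ => 0⟩ (T.inputMem f e) 0 0 0 home 0 where
  valid := ⟨fun a ha => absurd ha (Finset.notMem_empty a),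
    fun a ha => absurd ha (Finset.notMem_empty a), fun a ha => absurd ha (Finset.notMem_empty a),
    fun a ha => absurd ha (Finset.notMem_empty a)⟩
  count := rfl
  bdd := inputMem_bdd (size_le_base_pow e (Nat.le_add_right _ _)).1
    (size_le_base_pow e (Nat.le_add_right _ _)).2
  state := Or.inl ⟨rfl, rfl, rfl, rfl⟩
  time := by
    rw [Nat.cast_zero, mul_zero, mul_zero, zero_add, zero_add]
    positivity
  client := by simp
  facility := by simp

/-- Taking logarithms, height · log 2 ≤ 2 log (D + 2), and log 2 > 0.69. The second bound lets
additive constants and an extra logarithm be absorbed. -/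
theorem height_add_one_le : (T.height : ℝ) + 1 ≤ 5 * Real.log (T.diam + 2) ∧
    (0.69 : ℝ) ≤ Real.log (T.diam + 2) := by
  have h₁ : ((2 : ℝ) ^ T.height) ≤ 2 * (T.diam + 2) := by exact_mod_cast two_pow_height_le (T := T)
  have h₂ := Real.log_le_log (by positivity) h₁
  rw [Real.log_pow, Real.log_mul two_ne_zero (by positivity)] at h₂
  have h₃ : Real.log 2 ≤ Real.log (T.diam + 2) :=
    Real.log_le_log two_pos (le_add_of_nonneg_left (Nat.cast_nonneg _))
  have h₄ := Real.log_two_gt_d9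
  have h₅ : (T.height : ℝ) * 0.69 ≤ T.height * Real.log 2 :=
    mul_le_mul_of_nonneg_left (by linarith) (Nat.cast_nonneg _)
  constructor <;> linarith

theorem recourse_bound (N : ℕ) : 14000 * ((T.height : ℝ) + 1) ^ 2 * N ≤
    2000000 * N * Real.log (T.diam + 2) ^ 2 := by
  have h₁ : ((T.height : ℝ) + 1) ^ 2 ≤ (5 * Real.log (T.diam + 2)) ^ 2 :=
    pow_le_pow_left₀ (by positivity) height_add_one_le.1 2
  have h₂ := mul_le_mul_of_nonneg_right h₁ (Nat.cast_nonneg (α := ℝ) N)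
  have h₃ : 0 ≤ Real.log (T.diam + 2) ^ 2 * (N : ℝ) := by positivity
  linarith

/-- Every term is at most a constant times n (height + 1)², because N ≤ 2 n and the cost of building
the hierarchy is O(n (height + 1)). Writing l = log (D + 2), (height + 1)² ≤ 25 l² ≤ 40 l³ by l ≥
0.69; the cubic exponent is not exhausted. -/
theorem time_bound (e : Fin k ≃ T.Essential) {N n : ℕ} (hN : N ≤ 2 * n)
    (hn : Fintype.card T.Leaf ≤ n) : (14000 * ((T.height : ℝ) + 1) ^ 2 + 5) * N +
      (20 * k + Fintype.card T.Leaf * (104 * (T.height + 1) + 20) + 20) ≤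
    2000000 * n * Real.log (T.diam + 2) ^ 3 := by
  obtain ⟨hH, hl⟩ := T.height_add_one_le
  have hk : (k : ℝ) ≤ Fintype.card T.Leaf * ((T.height : ℝ) + 1) := by
    exact_mod_cast card_essential_le e
  have hF : (1 : ℝ) ≤ Fintype.card T.Leaf := by exact_mod_cast Fintype.card_pos (α := T.Leaf)
  have hN' : (N : ℝ) ≤ 2 * n := by exact_mod_cast hN
  have hn' : (Fintype.card T.Leaf : ℝ) ≤ n := by exact_mod_cast hn
  have hH₁ : (1 : ℝ) ≤ (T.height : ℝ) + 1 := le_add_of_nonneg_left (Nat.cast_nonneg _)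
  generalize (T.height : ℝ) + 1 = H at *
  generalize (Fintype.card T.Leaf : ℝ) = F at *
  generalize Real.log ((T.diam : ℝ) + 2) = l at *
  have h₁ : (14000 * H ^ 2 + 5) * N ≤ (14000 * H ^ 2 + 5) * (2 * n) :=
    mul_le_mul_of_nonneg_left hN' (by positivity)
  have h₂ : F * H ≤ n * H := mul_le_mul_of_nonneg_right hn' (by linarith)
  have hHH : H ≤ H ^ 2 := le_self_pow₀ hH₁ two_ne_zero
  have hn0 : (0 : ℝ) ≤ n := Nat.cast_nonneg n
  have h₃ : n * H ≤ n * H ^ 2 := mul_le_mul_of_nonneg_left hHH hn0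
  have h₄ : (n : ℝ) ≤ n * H := le_mul_of_one_le_right hn0 hH₁
  have h₅ : H ^ 2 ≤ (5 * l) ^ 2 := pow_le_pow_left₀ (by linarith) hH 2
  have h₆ : 0.69 * l ^ 2 ≤ l ^ 3 := by
    rw [pow_succ l 2, mul_comm]
    exact mul_le_mul_of_nonneg_left hl (sq_nonneg l)
  have h₇ : (n : ℝ) * H ^ 2 ≤ n * (40 * l ^ 3) :=
    mul_le_mul_of_nonneg_left (by nlinarith [sq_nonneg l]) hn0
  linarith

end HST

/-- `pre` and `upd` are the programs for preprocessing and for handling a request. The adversary is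
adaptive: it sees all memory contents `s 0, …, s t` so far before it makes the request `r t`.
`τ 0` is the preprocessing time and `τ (t + 1)` the time spent on the request `r t`. -/
theorem theorem3 :
    ∃ (pre upd : Prog) (K : ℝ) (c : ℕ),
      ∀ (V : Type) [Fintype V] [DecidableEq V] (T : HST V) (f : T.Leaf → ℝ) (_ : ∀ x, 0 ≤ f x)
        (k : ℕ) (e : Fin k ≃ T.Essential) (adv : List Mem → Request T.Leaf),
      ∃ (s : ℕ → Mem) (τ : ℕ → ℕ),
        let r : ℕ → Request T.Leaf := fun t => adv ((List.range (t + 1)).map s)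
        let C : ℕ → Clients T.Leaf := Clients.after r
        let D : ℕ := T.diam
        let n : ℕ → ℕ := fun t => Fintype.card T.Leaf + (C t).arrived
        let W : ℕ → ℕ := fun t => ((n t + 2) * (D + 2)) ^ c
        Exec (W 0) pre (T.inputMem f e) (τ 0) (s 0) ∧
        (τ 0 : ℝ) ≤ K * Fintype.card T.Leaf ∧
        ∀ N : ℕ, (∀ t < N, T.Legal (C t) (r t)) →
          (∀ t < N, Exec (W (t + 1)) upd (T.request e (C t) (s t) (r t)) (τ (t + 1)) (s (t + 1))) ∧
          (∃ σ : ℕ → T.Leaf, Stores T e (C N) (s N) σ ∧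
            ∀ (S' : Finset T.Leaf) (σ' : ℕ → T.Leaf), (∀ j ∈ (C N).present, σ' j ∈ S') →
              (C N).cost f (T.openSet e (s N)) σ ≤ K * (C N).cost f S' σ') ∧
          ((∑ t ∈ Finset.range N, τ (t + 1) : ℕ) : ℝ) ≤ K * n N * Real.log (D + 2) ^ 3 ∧
          ((∑ t ∈ Finset.range N, clientRecourse (C t) (C (t + 1)) (s t) (s (t + 1)) : ℕ) : ℝ) ≤
            K * N * Real.log (D + 2) ^ 2 ∧
          ((∑ t ∈ Finset.range N, facilityRecourse T e (s t) (s (t + 1)) : ℕ) : ℝ) ≤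
            K * N * Real.log (D + 2) ^ 2 := by
  -- Preprocessing is empty; `handle` computes the hierarchy on the first request, within the bound
  -- for the update time.
  refine ⟨.skip, handle, 2000000, 13, fun V _ _ T f hf k e adv => ?_⟩
  obtain ⟨s, τ, hs, hτ, hstep⟩ := HST.exists_trajectory e handle adv (T.inputMem f e)
  obtain ⟨x₀⟩ : Nonempty T.Leaf := inferInstance
  refine ⟨s, τ, ?_⟩
  intro r C D n W
  refine ⟨?_, ?_, fun N hN => ?_⟩
  · rw [hs, hτ]
    exact .skip _
  · have : (1 : ℝ) ≤ Fintype.card T.Leaf := by exact_mod_cast Fintype.card_pos (α := T.Leaf)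
    rw [hτ, Nat.cast_one]
    linarith
  -- Legality is known only for the first `N` requests, so the induction runs up to `N` and at each
  -- step identifies the execution found with the trajectory.
  have key : ∀ M ≤ N, (∀ t < M, Exec (W (t + 1)) handle (T.request e (C t) (s t) (r t)) (τ (t + 1))
      (s (t + 1))) ∧ ∃ home Φ, HST.RunInv e hf M (C M) (s M) (∑ t ∈ Finset.range M, τ (t + 1))
        (∑ t ∈ Finset.range M, clientRecourse (C t) (C (t + 1)) (s t) (s (t + 1)))
        (∑ t ∈ Finset.range M, facilityRecourse T e (s t) (s (t + 1))) home Φ := by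
    intro M
    induction M with
    | zero =>
      refine fun _ => ⟨fun t ht => absurd ht (Nat.not_lt_zero t), fun _ => x₀, 0, ?_⟩
      rw [hs]
      exact HST.RunInv.init e hf _
    | succ M ih =>
      intro hM
      obtain ⟨hE, home, Φ, hI⟩ := ih (by omega)
      obtain ⟨t', m', he, home', Φ', hI'⟩ := hI.step (hN M hM)
      obtain ⟨rfl, rfl⟩ := hstep M _ t' m' he
      refine ⟨fun t ht => ?_, home', Φ', ?_⟩
      · rcases (Nat.lt_succ_iff.1 ht).lt_or_eq with h | rfl
        · exact hE t h
        · exact he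
      · rw [Finset.sum_range_succ, Finset.sum_range_succ, Finset.sum_range_succ]
        exact hI'
  obtain ⟨hE, home, Φ, hI⟩ := key N le_rfl
  have hΦ := hI.pot_nonneg
  refine ⟨hE, ?_, ?_, ?_, ?_⟩
  · obtain ⟨σ, hσ, h⟩ := hI.cost_le
    refine ⟨σ, hσ, fun S' σ' hσ' => (h S' σ' hσ').trans (mul_le_mul_of_nonneg_right (by norm_num) ?_)⟩
    exact HST.cost_nonneg hf hI.valid S' σ'
  · have h₁ := hI.time
    have h₂ := hI.count
    -- N plus the number of present clients is twice the number of arrivals, hence N ≤ 2 n.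
    have h₃ := HST.time_bound e (N := N) (n := n N) (by simp only [n]; omega) (Nat.le_add_right _ _)
    linarith
  · have h₁ := hI.client
    have h₂ := HST.recourse_bound (T := T) N
    linarith
  · have h₁ := hI.facility
    have h₂ := HST.recourse_bound (T := T) N
    linarith
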